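/- Conventions. A covering projection $p:Y\to Z$ is a continuous map such that every point of $Z$ has an open neighbourhood $U$ that is evenly covered, i.e. $p^{-1}(U)$ is a (possibly empty) disjoint union of open sets each mapped homeomorphically onto $U$. It is regular if for each closed path in $Z$ either all liftings are closed or none is; it is finitely listed if its fibres are finite. $G(Y|Z)$ is the group of homeomorphisms $g$ of $Y$ with $p\circ g=p$. Let $\mathfrak S_{\mathcal X}=\{\mathcal X_0\leftarrow\mathcal X_1\leftarrow\cdots\}$ be a topological finite covering sequence: all $\mathcal X_n$ are second-countable locally compact connected Hausdorff spaces, all maps $\mathcal X_n\to\mathcal X_m$ $(m\le n)$ are regular finitely listed covering projections, and for $k<l<m$ there is the natural exact sequence $\{e\}\to G(\mathcal X_m|\mathcal X_l)\to G(\mathcal X_m|\mathcal X_k)\to G(\mathcal X_l|\mathcal X_k)\to\{e\}$. Let $\widehat{\mathcal X}=\varprojlim\mathcal X_n$ be the projective limit, with projections $\widetilde\pi_n:\widehat{\mathcal X}\to\mathcal X_n$. A subset $\mathcal V\subset\widehat{\mathcal X}$ is special if $\widetilde\pi_0(\mathcal V)$ is evenly covered by $\mathcal X_1\to\mathcal X_0$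 and, for every $n\ge 0$, $\widetilde\pi_n(\mathcal V)$ is open and connected and $\widetilde\pi_n|_{\mathcal V}$ is injective. Let $\widetilde{\mathcal X}$ be the set $\widehat{\mathcal X}$ with the topology generated by the special sets. Assume that $\mathcal X_0$ is locally path-connected and that every point of $\widehat{\mathcal X}$ lies in a special set. A covering projection of $\mathfrak S_{\mathcal X}$ is a space $\mathcal Y$ with surjective regular covering projections $\pi^{\mathcal Y}_n:\mathcal Y\to\mathcal X_n$ $(n\ge0)$ compatible with the maps of the sequence; a morphism $\mathcal Y'\to\mathcal Y''$ is a covering projection commuting with the maps to all $\mathcal X_n$. The inverse limit $\varprojlim\mathfrak S_{\mathcal X}$ is the final object of this category. Let $\widehat A$ be the $C^*$-inductive limit of $C_0(\mathcal X_0)\to C_0(\mathcal X_1)\to\cdots$ (the maps being composition with $\mathcal X_n\to\mathcal X_m$), let $\widehat G$ be the group of $*$-automorphisms of $\widehat A$ that fix $C_0(\mathcal X_0)$ pointwise, and let $J_n\subset\widehat G$ be the subgroup fixing $C_0(\mathcal X_n)$ pointwise. Let $\rho:\widehat A\to B(H)$ be a representation on a Hilbert space and $u$ a unitary representation of $\widehat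 G$ on $H$ with $\rho(ga)=u_g\rho(a)u_g^*$; put $gT=u_gTu_g^*$ for $T\in B(H)$. A positive $T\in B(H)$ is special if for every $n\ge0$ the series $\sum_{g\in J_n}gT$ and $\sum_{g\in J_n}gT^2$ converge strongly (as unordered sums) to $\rho(a_n)$, $\rho(b_n)$ with $a_n,b_n\in C_0(\mathcal X_n)$, and $\|a_n^2-b_n\|\to0$. The inverse noncommutative limit $\varprojlim\mathfrak S_{C_0(\mathcal X)}\subset B(H)$ formed in $(\rho,u)$ is the norm closure of the algebra generated by the special elements. The reduced atomic representation is $\widehat A$ acting on $\ell^2(\mathrm{Spec}\,\widehat A)$ by $\rho(a)e_\chi=\chi(a)e_\chi$, with $u_ge_\chi=e_{\chi\circ g^{-1}}$. Theorem. (i) $(\widetilde{\mathcal X},\{\widetilde\pi_n\})=\varprojlim\mathfrak S_{\mathcal X}$, that is, it is the final object described above. (ii) $\widehat G$ is a covering transformation group of the sequence $C_0(\mathcal X_n)$: $\widehat A^{\widehat G}=C_0(\mathcal X_0)$, and for every $n$ the group $\widehat G$ preserves $C_0(\mathcal X_n)$ and restricts onto $G(\mathcal X_n|\mathcal X_0)$.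 (iii) The reduced atomic representation of $\widehat A$ is faithful, and for the inverse noncommutative limit formed in it there is exactly one $*$-isomorphism $\Phi:C_0(\widetilde{\mathcal X})\to\varprojlim\mathfrak S_{C_0(\mathcal X)}$ with $\Phi\big((a\circ\widetilde\pi_n)f\big)=\rho(a)\Phi(f)$ for all $n$, $a\in C_0(\mathcal X_n)$, $f\in C_0(\widetilde{\mathcal X})$. Thus $\varprojlim\mathfrak S_{C_0(\mathcal X)}\cong C_0(\varprojlim\mathfrak S_{\mathcal X})$ naturally. (iv) The same holds in every $(\rho,u)$ on a Hilbert space $H$ for which there is a faithful nondegenerate representation $\sigma:C_0(\widetilde{\mathcal X})\to B(H)$ with $\sigma\big((a\circ\widetilde\pi_n)f\big)=\rho(a)\sigma(f)$ for all $n$, $a\in C_0(\mathcal X_n)$, $f\in C_0(\widetilde{\mathcal X})$: the map $\sigma$ is then a $*$-isomorphism of $C_0(\widetilde{\mathcal X})$ onto the inverse noncommutative limit formed in $(\rho,u)$. -/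

import Mathlib

open Topology ZeroAtInfty
open scoped ENNReal

universe u v w

/-! ## Coverings -/

section Coverings

variable {Y : Type u} {Z : Type v} [TopologicalSpace Y] [TopologicalSpace Z]

/-- An open set `U` is evenly covered by `p` if its preimage is a disjoint union of open sets,
each of which is mapped homeomorphically onto `U` by `p`. -/
def EvenlyCovered (p : Y → Z) (U : Set Z) : Prop :=
  IsOpen U ∧ ∃ sheets : Set (Set Y),
    sheets.PairwiseDisjoint id ∧ ⋃₀ sheets = p ⁻¹' U ∧
    ∀ s ∈ sheets, ∃ e : OpenPartialHomeomorph Y Z, e.source = s ∧ e.target = U ∧ Set.EqOn e p s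

/-- A covering projection is regular if, for every closed path in the base, either all of its
liftings are closed or none of them is. -/
def IsRegularCovering (p : Y → Z) : Prop :=
  IsCoveringMap p ∧
    ∀ ω : C(unitInterval, Z), ω 0 = ω 1 →
      (∀ l : C(unitInterval, Y), (∀ t, p (l t) = ω t) → l 0 = l 1) ∨
      (∀ l : C(unitInterval, Y), (∀ t, p (l t) = ω t) → l 0 ≠ l 1)

/-- The group `G(Y | Z)` of covering transformations of `p : Y → Z`. -/
def Deck (p : Y → Z) : Subgroup (Y ≃ₜ Y) where
  carrier := {g | ∀ y, p (g y) = p y}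
  mul_mem' {a b} ha hb y := (ha (b y)).trans (hb y)
  one_mem' _ := rfl
  inv_mem' {a} ha y := by
    have h := ha (a⁻¹ y)
    rw [← h]
    exact congrArg p (a.apply_symm_apply y)

/-- A covering map with finite fibres is proper, so preimages of compact sets are compact. -/
theorem tendsto_cocompact_of_finite_covering {p : Y → Z} (hp : IsCoveringMap p)
    (hfin : ∀ z, (p ⁻¹' {z}).Finite) :
    Filter.Tendsto p (Filter.cocompact Y) (Filter.cocompact Z) := by
  suffices hprop : IsProperMap p by
    rw [Filter.hasBasis_cocompact.tendsto_right_iff]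
    intro K hK
    exact (hprop.isCompact_preimage hK).compl_mem_cocompact
  rw [isProperMap_iff_ultrafilter]
  refine ⟨hp.continuous, fun 𝒰 z hz => ?_⟩
  obtain ⟨-, U, hzU, hU, hpU, e, he⟩ := hp z
  have hfz : Finite (p ⁻¹' {z}) := hfin z
  have hUU : U ∈ Filter.map p (𝒰 : Filter Y) := hz (hU.mem_nhds hzU)
  have hmem : p ⁻¹' U ∈ (𝒰 : Filter Y) := hUU
  -- the sheets indexed by the finite fibre
  let s : (p ⁻¹' {z}) → Set Y := fun i => {y | ∃ h : y ∈ p ⁻¹' U, (e ⟨y, h⟩).2 = i}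
  have hcov : (⋃ i, s i) ∈ (𝒰 : Filter Y) := by
    filter_upwards [hmem] with y hy
    exact Set.mem_iUnion.2 ⟨_, hy, rfl⟩
  obtain ⟨i, hi⟩ : ∃ i, s i ∈ (𝒰 : Filter Y) := by
    have := (Ultrafilter.finite_biUnion_mem_iff (Set.finite_univ (α := p ⁻¹' {z}))
      (f := 𝒰) (s := s)).1 (by simpa using hcov)
    obtain ⟨i, -, hi⟩ := this
    exact ⟨i, hi⟩
  let g : U → Y := fun x => (e.symm (x, i)).1
  have hg : Continuous g := by fun_prop
  refine ⟨g ⟨z, hzU⟩, ?_, ?_⟩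
  · have h1 := he (e.symm (⟨z, hzU⟩, i))
    rw [e.apply_symm_apply] at h1
    exact h1.symm
  · intro W hW
    have hgW : g ⁻¹' W ∈ 𝓝 (⟨z, hzU⟩ : U) := hg.continuousAt hW
    rw [nhds_subtype_eq_comap, Filter.mem_comap] at hgW
    obtain ⟨T, hT, hTW⟩ := hgW
    have hTp : p ⁻¹' T ∈ (𝒰 : Filter Y) := hz hT
    change W ∈ (𝒰 : Filter Y)
    filter_upwards [hi, hTp] with y hy hyT
    obtain ⟨hyU, hyi⟩ := hy
    have h2 : (e ⟨y, hyU⟩) = (⟨p y, hyU⟩, i) := by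
      refine Prod.ext (Subtype.ext (he ⟨y, hyU⟩)) hyi
    have h3 : g ⟨p y, hyU⟩ = y := by
      change (e.symm (⟨p y, hyU⟩, i)).1 = y
      rw [← h2, e.symm_apply_apply]
    have h4 : (⟨p y, hyU⟩ : U) ∈ g ⁻¹' W := hTW hyT
    simpa [h3] using h4

end Coverings

/-! ## Topological finite covering sequences and their inverse limits -/

/-- A sequence `X 0 ← X 1 ← ⋯` in which all maps `X n → X m` are regular finitely listed covering
projections and the groups of covering transformations form natural exact sequences
`1 → G(X m | X l) → G(X m | X k) → G(X l | X k) → 1`. -/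
structure FiniteCoveringSequence (X : ℕ → Type u) [∀ n, TopologicalSpace (X n)] where
  π : ∀ {m n : ℕ}, m ≤ n → X n → X m
  π_self : ∀ n (x : X n), π le_rfl x = x
  π_comp : ∀ {k l m : ℕ} (hkl : k ≤ l) (hlm : l ≤ m) (x : X m),
    π hkl (π hlm x) = π (hkl.trans hlm) x
  regular : ∀ {m n : ℕ} (h : m ≤ n), IsRegularCovering (π h)
  finite_fibre : ∀ {m n : ℕ} (h : m ≤ n) (x : X m), (π h ⁻¹' {x}).Finite
  exact : ∀ {k l m : ℕ} (hkl : k < l) (hlm : l < m),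
    ∃ r : Deck (π (hkl.trans hlm).le) →* Deck (π hkl.le),
      (∀ g x, π hlm.le (g.1 x) = (r g).1 (π hlm.le x)) ∧
      Function.Surjective r ∧
      r.ker = (Deck (π hlm.le)).subgroupOf (Deck (π (hkl.trans hlm).le))

namespace FiniteCoveringSequence

variable {X : ℕ → Type u} [∀ n, TopologicalSpace (X n)] (S : FiniteCoveringSequence X)

/-- A coherent system: a set `Y` with compatible surjections onto all `X n`. -/
structure IsCoherentSystem {Y : Type w} (q : ∀ n, Y → X n) : Prop where
  comm : ∀ {m n : ℕ} (h : m ≤ n) (y : Y), S.π h (q n y) = q m y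
  surjective : ∀ n, Function.Surjective (q n)

/-- Special subsets of (the underlying set of) a coherent system. -/
def IsSpecialSet {Y : Type w} (q : ∀ n, Y → X n) (V : Set Y) : Prop :=
  EvenlyCovered (S.π (Nat.zero_le 1)) (q 0 '' V) ∧
    ∀ n, IsOpen (q n '' V) ∧ IsConnected (q n '' V) ∧ Set.InjOn (q n) V

/-- A covering projection of the sequence: a coherent system of regular covering projections. -/
structure IsCovering {Y : Type w} [TopologicalSpace Y] (q : ∀ n, Y → X n) : Prop
    extends S.IsCoherentSystem q where
  regular : ∀ n, IsRegularCovering (q n)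

/-- `(L, q)` is the inverse limit of the sequence: a final object in the category of covering
projections of the sequence, whose morphisms are the covering projections over all `X n`. -/
structure IsInverseLimit {L : Type u} [TopologicalSpace L] (q : ∀ n, L → X n) : Prop
    extends S.IsCovering q where
  final : ∀ (Y : Type u) [TopologicalSpace Y] (r : ∀ n, Y → X n), S.IsCovering r →
    ∃! f : Y → L, IsCoveringMap f ∧ ∀ n y, q n (f y) = r n y

/-- The projective limit of the sequence, as a set; it carries the topology generated by the
special sets (not the projective limit topology). -/
def CoveringLimit : Type u :=
  {x : ∀ n, X n // ∀ {m n : ℕ} (h : m ≤ n), S.π h (x n) = x m}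

/-- The natural maps of the projective limit to the spaces of the sequence. -/
def proj (n : ℕ) (x : S.CoveringLimit) : X n := x.1 n

instance : TopologicalSpace S.CoveringLimit :=
  TopologicalSpace.generateFrom {V | S.IsSpecialSet S.proj V}

/-- The map `C₀(X m) → C₀(X n)` induced by the covering projection `X n → X m`. -/
noncomputable def pullback {m n : ℕ} (h : m ≤ n) : C₀(X m, ℂ) →⋆ₙₐ[ℂ] C₀(X n, ℂ) where
  toFun a :=
    { toFun := fun x => a (S.π h x)
      continuous_toFun := (map_continuous a).comp (S.regular h).1.continuous
      zero_at_infty' := (zero_at_infty a).comp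
        (tendsto_cocompact_of_finite_covering (S.regular h).1 (S.finite_fibre h)) }
  map_smul' _ _ := rfl
  map_zero' := rfl
  map_add' _ _ := rfl
  map_mul' _ _ := rfl
  map_star' _ := rfl

/-- The group of covering transformations `G(X n | X 0)`, acting on `C₀(X n)`. -/
def deckAut (n : ℕ) : Subgroup (C₀(X n, ℂ) ≃⋆ₐ[ℂ] C₀(X n, ℂ)) where
  carrier := {α | ∃ d ∈ Deck (S.π (Nat.zero_le n)), ∀ (a : C₀(X n, ℂ)) x, α a (d x) = a x}
  mul_mem' := by
    rintro α β ⟨d, hd, hα⟩ ⟨e, he, hβ⟩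
    exact ⟨d * e, mul_mem hd he, fun a x => (hα (β a) (e x)).trans (hβ a x)⟩
  one_mem' := ⟨1, one_mem _, fun _ _ => rfl⟩
  inv_mem' := by
    rintro α ⟨d, hd, hα⟩
    refine ⟨d⁻¹, inv_mem hd, fun a x => ?_⟩
    have h := hα (α⁻¹ a) (d⁻¹ x)
    have h1 : α (α⁻¹ a) = a := α.apply_symm_apply a
    have h2 : d (d⁻¹ x) = x := d.apply_symm_apply x
    rw [h1, h2] at h
    exact h.symm

end FiniteCoveringSequence

/-! ## Inverse noncommutative limits of sequences of `C*`-algebras -/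

section Noncommutative

variable {A : ℕ → Type u} [∀ n, NonUnitalCStarAlgebra (A n)]
variable {B : Type v} [NonUnitalCStarAlgebra B]

/-- `B`, with the maps `φ n : A n → B`, is the `C*`-inductive limit of the sequence of injective
`*`-homomorphisms `ι`. -/
structure IsCStarInductiveLimit (ι : ∀ {m n : ℕ}, m ≤ n → A m →⋆ₙₐ[ℂ] A n)
    (φ : ∀ n, A n →⋆ₙₐ[ℂ] B) : Prop where
  compatible : ∀ {m n : ℕ} (h : m ≤ n) (a : A m), φ n (ι h a) = φ m a
  injective : ∀ n, Function.Injective (φ n)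
  dense : Dense (⋃ n, Set.range (φ n))

/-- The group of `*`-automorphisms of `B` that fix the image of `φ` pointwise. -/
def fixingGroup {A₀ : Type u} [NonUnitalCStarAlgebra A₀] (φ : A₀ →⋆ₙₐ[ℂ] B) :
    Subgroup (B ≃⋆ₐ[ℂ] B) where
  carrier := {g | ∀ a, g (φ a) = φ a}
  mul_mem' {g h} hg hh a := (congrArg g (hh a)).trans (hg a)
  one_mem' _ := rfl
  inv_mem' {g} hg a := by
    have h : g⁻¹ (g (φ a)) = φ a := g.symm_apply_apply (φ a)
    rwa [hg a] at h

/-- The covering transformation group `G(B | A 0)` of the sequence. -/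
abbrev coveringGroup (φ : ∀ n, A n →⋆ₙₐ[ℂ] B) : Subgroup (B ≃⋆ₐ[ℂ] B) := fixingGroup (φ 0)

/-- The kernel `J n` of the restriction map `G(B | A 0) → G(A n | A 0)`. -/
abbrev restrictionKernel (φ : ∀ n, A n →⋆ₙₐ[ℂ] B) (n : ℕ) : Subgroup (coveringGroup φ) :=
  (fixingGroup (φ n)).subgroupOf (coveringGroup φ)

/-- Regularity of the sequence with covering transformation groups `G n = G(A n | A 0)`: the
algebra of invariants of the covering group is `A 0`, and restriction to `A n` is a well-defined
surjection onto `G n` for every `n`. -/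
structure IsRegularSequence (φ : ∀ n, A n →⋆ₙₐ[ℂ] B)
    (G : ∀ n, Subgroup (A n ≃⋆ₐ[ℂ] A n)) : Prop where
  invariants : ∀ b : B, (∀ g ∈ coveringGroup φ, g b = b) ↔ b ∈ Set.range (φ 0)
  restrict : ∀ n, ∀ g ∈ coveringGroup φ, ∃ d ∈ G n, ∀ a, g (φ n a) = φ n (d a)
  surjective : ∀ n, ∀ d ∈ G n, ∃ g ∈ coveringGroup φ, ∀ a, g (φ n a) = φ n (d a)

/-- A covariant representation: the algebra of bounded operators on `H` with the action
`T ↦ u g * T * (u g)⋆` of the group and the equivariant `*`-homomorphism `ρ` from `B`. -/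
structure CovariantRep (G : Subgroup (B ≃⋆ₐ[ℂ] B)) (H : Type w) [NormedAddCommGroup H]
    [InnerProductSpace ℂ H] [CompleteSpace H] where
  ρ : B →⋆ₙₐ[ℂ] (H →L[ℂ] H)
  u : G →* unitary (H →L[ℂ] H)
  covariant : ∀ (g : G) (b : B),
    ρ (g.1 b) = (u g : H →L[ℂ] H) * ρ b * star (u g : H →L[ℂ] H)

variable {H : Type w} [NormedAddCommGroup H] [InnerProductSpace ℂ H] [CompleteSpace H]

/-- Special elements: positive operators `T` such that, for every `n`, the series `∑ g T` and
`∑ g T²` over `g ∈ J n` converge strongly to elements `a n` and `b n` of `A n`, and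
`‖(a n)² - b n‖ → 0`. -/
def IsSpecialElement (φ : ∀ n, A n →⋆ₙₐ[ℂ] B) (R : CovariantRep (coveringGroup φ) H)
    (T : H →L[ℂ] H) : Prop :=
  T.IsPositive ∧ ∃ a b : ∀ n, A n,
    (∀ n (ξ : H), HasSum (fun g : restrictionKernel φ n =>
      ((R.u g.1 : H →L[ℂ] H) * T * star (R.u g.1 : H →L[ℂ] H)) ξ) (R.ρ (φ n (a n)) ξ)) ∧
    (∀ n (ξ : H), HasSum (fun g : restrictionKernel φ n =>
      ((R.u g.1 : H →L[ℂ] H) * (T * T) * star (R.u g.1 : H →L[ℂ] H)) ξ) (R.ρ (φ n (b n)) ξ)) ∧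
    ∀ ε > 0, ∃ N, ∀ n ≥ N, ‖a n * a n - b n‖ < ε

/-- The inverse noncommutative limit: the norm closure of the algebra generated by the special
elements. -/
noncomputable def ncInverseLimit (φ : ∀ n, A n →⋆ₙₐ[ℂ] B)
    (R : CovariantRep (coveringGroup φ) H) : NonUnitalStarSubalgebra ℂ (H →L[ℂ] H) :=
  (NonUnitalStarAlgebra.adjoin ℂ {T | IsSpecialElement φ R T}).topologicalClosure

end Noncommutative

/-! ## The reduced atomic representation of a commutative `C*`-algebra -/

section Atomic

/-- The Hilbert space `ℓ²(I)`. -/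
abbrev EllTwo (I : Type v) : Type v := lp (fun _ : I => ℂ) 2

theorem memℓp_two_mul {I : Type v} {c : I → ℂ} {C : ℝ} (hc : ∀ i, ‖c i‖ ≤ C)
    (f : EllTwo I) : Memℓp (fun i => c i * f i) 2 := by
  have h := (lp.memℓp f).const_smul (C : ℂ)
  refine memℓp_gen ?_
  refine Summable.of_nonneg_of_le (fun i => by positivity) (fun i => ?_)
    (h.summable (by norm_num))
  have hC : 0 ≤ C := (norm_nonneg _).trans (hc i)
  simp only [Pi.smul_apply, smul_eq_mul, norm_mul, Complex.norm_real, Real.norm_eq_abs,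
    abs_of_nonneg hC]
  have := hc i
  gcongr

/-- Multiplication by a bounded function on `ℓ²(I)`. -/
noncomputable def mulOp {I : Type v} (c : I → ℂ) (C : ℝ) (hC : 0 ≤ C) (hc : ∀ i, ‖c i‖ ≤ C) :
    EllTwo I →L[ℂ] EllTwo I :=
  LinearMap.mkContinuous
    { toFun := fun f => ⟨fun i => c i * f i, memℓp_two_mul hc f⟩
      map_add' := fun f g => by ext i; exact mul_add (c i) (f i) (g i)
      map_smul' := fun z f => by ext i; exact mul_left_comm (c i) z (f i) }
    C (fun f => by
      have h : ‖(⟨fun i => c i * f i, memℓp_two_mul hc f⟩ : EllTwo I)‖ ≤ ‖(C : ℂ) • f‖ := by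
        refine lp.norm_mono (by norm_num) (fun i => ?_)
        have := hc i
        simp only [lp.coeFn_smul, Pi.smul_apply, smul_eq_mul, norm_mul, Complex.norm_real,
          Real.norm_eq_abs, abs_of_nonneg hC]
        gcongr
      rw [norm_smul, Complex.norm_real, Real.norm_eq_abs, abs_of_nonneg hC] at h
      exact h)

@[simp] theorem mulOp_apply {I : Type v} (c : I → ℂ) (C : ℝ) (hC : 0 ≤ C)
    (hc : ∀ i, ‖c i‖ ≤ C) (f : EllTwo I) (i : I) : mulOp c C hC hc f i = c i * f i := rfl

/-- The unitary of `ℓ²(I)` induced by a permutation of `I`: `(U f) i = f (e⁻¹ i)`. -/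
noncomputable def permUnitary {I : Type v} : Equiv.Perm I →* unitary (EllTwo I →L[ℂ] EllTwo I) :=
  (Unitary.linearIsometryEquiv (𝕜 := ℂ) (H := EllTwo I)).symm.toMonoidHom.comp
    { toFun := fun e =>
        { toFun := fun f => ⟨fun i => f (e⁻¹ i), by
            refine memℓp_gen ?_
            exact (Equiv.summable_iff e⁻¹).2 ((lp.memℓp f).summable (by norm_num))⟩
          invFun := fun f => ⟨fun i => f (e i), by
            refine memℓp_gen ?_
            exact (Equiv.summable_iff e).2 ((lp.memℓp f).summable (by norm_num))⟩
          map_add' := fun f g => rfl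
          map_smul' := fun z f => rfl
          left_inv := fun f => by ext i; simp
          right_inv := fun f => by ext i; simp
          norm_map' := fun f => by
            rw [lp.norm_eq_tsum_rpow (by norm_num), lp.norm_eq_tsum_rpow (by norm_num)]
            congr 1
            exact Equiv.tsum_eq e⁻¹ (fun i => ‖f i‖ ^ (2 : ℝ≥0∞).toReal) }
      map_one' := by ext; rfl
      map_mul' := fun a b => by ext f i; rfl }

theorem permUnitary_apply {I : Type v} (e : Equiv.Perm I) (f : EllTwo I) (i : I) :
    (permUnitary e : EllTwo I →L[ℂ] EllTwo I) f i = f (e⁻¹ i) := rfl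

variable (B : Type v) [NonUnitalCStarAlgebra B]

/-- The characters of `B`, which for commutative `B` are the pure states. -/
abbrev Character : Type v := {χ : B →⋆ₙₐ[ℂ] ℂ // χ ≠ 0}

variable {B}

/-- The action `χ ↦ χ ∘ g⁻¹` of `*`-automorphisms on characters. -/
def charPerm : (B ≃⋆ₐ[ℂ] B) →* Equiv.Perm (Character B) where
  toFun g :=
    { toFun := fun χ => ⟨χ.1.comp (g⁻¹ : B ≃⋆ₐ[ℂ] B), fun h => χ.2 (by
        ext b
        have := DFunLike.congr_fun h (g b)
        simpa [StarAlgEquiv.aut_inv] using this)⟩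
      invFun := fun χ => ⟨χ.1.comp (g : B ≃⋆ₐ[ℂ] B), fun h => χ.2 (by
        ext b
        have := DFunLike.congr_fun h (g⁻¹ b)
        simpa [StarAlgEquiv.aut_inv] using this)⟩
      left_inv := fun χ => by ext b; simp [StarAlgEquiv.aut_inv]
      right_inv := fun χ => by ext b; simp [StarAlgEquiv.aut_inv] }
  map_one' := by ext χ b; rfl
  map_mul' a b := by ext χ x; rfl

/-- The direct sum of all characters, on `ℓ²` of the set of characters, made covariant by the
action of the group on characters: for commutative `B`, the reduced atomic representation. -/
noncomputable def atomicRep (G : Subgroup (B ≃⋆ₐ[ℂ] B)) :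
    CovariantRep G (EllTwo (Character B)) where
  ρ :=
    { toFun := fun b => mulOp (fun χ => χ.1 b) ‖b‖ (norm_nonneg b)
        (fun χ => NonUnitalStarAlgHom.norm_apply_le χ.1 b)
      map_smul' := fun z b => by ext f χ; simp [mul_assoc]
      map_zero' := by ext f χ; simp
      map_add' := fun a b => by ext f χ; simp [add_mul]
      map_mul' := fun a b => by ext f χ; simp [mul_assoc]
      map_star' := fun b => by
        rw [ContinuousLinearMap.star_eq_adjoint, ContinuousLinearMap.eq_adjoint_iff]
        intro f g
        rw [lp.inner_eq_tsum, lp.inner_eq_tsum]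
        refine tsum_congr fun χ => ?_
        have hs : χ.1 (star b) = star (χ.1 b) := map_star χ.1 b
        simp [hs]
        ring }
  u := permUnitary.comp (charPerm.comp G.subtype)
  covariant := fun g b => by
    have key : ∀ (U : unitary (EllTwo (Character B) →L[ℂ] EllTwo (Character B)))
        (S T : EllTwo (Character B) →L[ℂ] EllTwo (Character B)),
        S * (U : EllTwo (Character B) →L[ℂ] EllTwo (Character B)) = U * T →
        S = U * T * star (U : EllTwo (Character B) →L[ℂ] EllTwo (Character B)) := by
      intro U S T h
      rw [← h, mul_assoc, Unitary.mul_star_self_of_mem U.2, mul_one]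
    refine key _ _ _ ?_
    ext f χ
    change χ.1 (g.1 b) * f ((charPerm g.1)⁻¹ χ) = ((charPerm g.1)⁻¹ χ).1 b * f ((charPerm g.1)⁻¹ χ)
    rfl

end Atomic

/-! The limit carries a topology finer than that of the projective limit: by local
path-connectedness of `X 0`, a special set is an open sheet mapped homeomorphically to every stage.
Two facts control this topology. A coordinatewise continuous map from a connected space that stays
over a special set and meets it never leaves it (`IsSpecialSet.mem_of_preconnected`); hence on
locally connected domains coordinatewise continuity is continuity, and the morphism from any
covering of the sequence, forced coordinate by coordinate, exists. Moreover the compatible families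
of deck transformations (`towerGroup`) act transitively on the fibres over `X 0`, and a family that
is trivial at stage `n` but not the identity moves a special set off itself, so each projection is a
quotient covering.

The characters of the inductive limit are the points of the covering limit, and its elements become
bounded functions there (`evalHom`). An automorphism fixing `C₀(X 0)` moves each point inside its
fibre. The limit may be disconnected, so the family moving a point could depend on the point;
uniform approximation by functions from finite stages excludes this, because every path component is
mapped onto every stage (`exists_towerGroup_eval`). Thus the covering group is `towerGroup`.

Both noncommutative limits are treated through a faithful nondegenerate `σ`. A nonnegative function
with compact support in a special set has disjoint translates under `J n`, whose sums are its
push-forward `a n` and the square `a n * a n`; partitions of unity and density then place all of `σ`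
in the limit. Conversely let `T` be special. As `J n` shrinks to the identity, `ρ (a n)` converges
strongly to `T`. Therefore the translates of `T` inherit from the commuting positive stage functions
that `⟨gTξ, hTξ⟩` has nonnegative real part, and the defect `‖a n * a n - b n‖` in the identity of
Pythagoras bounds `2 a_k (a_n - a_k)` for `k ≥ n`. So `a_k` is close either to `a_n` or to zero; a
connected set cannot cross this gap, which upgrades the decreasing pointwise convergence of the
stage functions to locally uniform convergence. Summation over two disjoint cosets shows that
distinct points over one point of `X n` share the value of `a_n`, so at most one of them carries a
large limit value; this gives decay at infinity. Hence `T` is `σ` of the limit function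
(`exists_of_isSpecialElement`). -/

section CoveringMaps

/-! ### Covering maps: lifting, deck transformations, factors of coverings -/

variable {Y : Type u} {Z : Type v} [TopologicalSpace Y] [TopologicalSpace Z] {p : Y → Z}

theorem IsCoveringMap.surjective_of_preconnectedSpace (hp : IsCoveringMap p) [Nonempty Y]
    [PreconnectedSpace Z] : Function.Surjective p := by
  have hclosed : IsClosed (Set.range p) := by
    refine isClosed_of_closure_subset fun z hz => ?_
    obtain ⟨-, U, hzU, hU, -, e, he⟩ := hp z
    obtain ⟨_, hyU, y, rfl⟩ := mem_closure_iff.1 hz U hU hzU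
    obtain ⟨i, hi⟩ := (e ⟨y, hyU⟩).2
    exact ⟨i, hi⟩
  have : Set.range p = Set.univ :=
    IsClopen.eq_univ ⟨hclosed, hp.isOpenMap.isOpen_range⟩ (Set.range_nonempty p)
  exact Set.range_eq_univ.1 this

theorem IsLocalHomeomorph.locallyPathConnectedSpace (hp : IsLocalHomeomorph p)
    [LocallyPathConnectedSpace Z] : LocallyPathConnectedSpace Y := by
  refine ⟨fun y => ⟨fun W => ⟨fun hW => ?_, fun ⟨U, hU, hUW⟩ => Filter.mem_of_superset hU.1 hUW⟩⟩⟩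
  obtain ⟨e, hy, rfl⟩ := hp y
  have h1 : e.target ∩ e.symm ⁻¹' W ∈ 𝓝 (e y) :=
    Filter.inter_mem (e.open_target.mem_nhds (e.map_source hy))
      ((e.continuousAt_symm (e.map_source hy)) (by rwa [e.left_inv hy]))
  obtain ⟨U, ⟨hU, hUc⟩, hUs⟩ := (path_connected_basis (e y)).mem_iff.1 h1
  refine ⟨e.symm '' U, ⟨?_, ?_⟩, ?_⟩
  · have := e.symm.image_mem_nhds (e.map_source hy) hU
    rwa [e.left_inv hy] at this
  · exact hUc.image' (e.continuousOn_symm.mono fun z hz => (hUs hz).1)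
  · rintro _ ⟨z, hz, rfl⟩
    exact (hUs hz).2

theorem IsLocalHomeomorph.locallyCompactSpace (hp : IsLocalHomeomorph p)
    [LocallyCompactSpace Z] : LocallyCompactSpace Y := by
  refine ⟨fun y W hW => ?_⟩
  obtain ⟨e, hy, rfl⟩ := hp y
  have h1 : e.target ∩ e.symm ⁻¹' W ∈ 𝓝 (e y) :=
    Filter.inter_mem (e.open_target.mem_nhds (e.map_source hy))
      ((e.continuousAt_symm (e.map_source hy)) (by rwa [e.left_inv hy]))
  obtain ⟨K, hK, hKs, hKc⟩ := LocallyCompactSpace.local_compact_nhds _ _ h1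
  refine ⟨e.symm '' K, ?_, ?_, ?_⟩
  · have := e.symm.image_mem_nhds (e.map_source hy) hK
    rwa [e.left_inv hy] at this
  · rintro _ ⟨z, hz, rfl⟩
    exact (hKs hz).2
  · exact hKc.image_of_continuousOn (e.continuousOn_symm.mono fun z hz => (hKs hz).1)

theorem Deck.eq_of_apply_eq [PreconnectedSpace Y] (hp : IsCoveringMap p) {g h : Y ≃ₜ Y}
    (hg : g ∈ Deck p) (hh : h ∈ Deck p) (y : Y) (hy : g y = h y) : g = h := by
  refine Homeomorph.ext fun x => congrFun (hp.eq_of_comp_eq g.continuous h.continuous ?_ y hy) x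
  funext x
  exact (hg x).trans (hh x).symm

/-- The lifting criterion asks that lifts of `p ∘ γ` and `p ∘ γ'` from `y'` end together whenever
`γ` and `γ'` do. Regularity gives this without fundamental groups: the loop formed by `γ` and the
reverse of `γ'` is itself a closed lift, so every lift of its image is closed. -/
theorem IsRegularCovering.exists_lift (hp : IsRegularCovering p) [PathConnectedSpace Y]
    [LocallyPathConnectedSpace Y] {y y' : Y} (h : p y = p y') :
    ∃ F : C(Y, Y), F y = y' ∧ p ∘ F = p := by
  have hc := hp.1
  refine (hc.isLocalHomeomorph.existsUnique_continuousMap_lifts ⟨p, hc.continuous⟩ y y' h.symm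
    (fun γ hγ => ?_) ?_).exists
  · obtain ⟨Γ, h1, h2⟩ := hc.exists_path_lifts ((⟨p, hc.continuous⟩ : C(Y, Z)).comp γ) y'
      (by simp [hγ, h])
    exact ⟨Γ, h2, h1⟩
  · intro γ γ' Γ Γ' hγ hγ' hΓ hΓ' hl hl' h1
    -- `Θ` continues `Γ` along the reversed image of `γ'`; once it is known to return to `y'`, its
    -- reversal must be `Γ'` by uniqueness of lifts.
    obtain ⟨Θ, hΘ, hΘ0⟩ := hc.exists_path_lifts
      ((⟨p, hc.continuous⟩ : C(Y, Z)).comp (γ'.comp ⟨unitInterval.symm, by fun_prop⟩)) (Γ 1)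
      (by simpa [← h1] using (congrFun hl 1).symm)
    let a : Path y (γ 1) := ⟨γ, hγ, rfl⟩
    let a' : Path y (γ 1) := ⟨γ', hγ', h1.symm⟩
    let b : Path y' (Γ 1) := ⟨Γ, hΓ, rfl⟩
    let c : Path (Γ 1) (Θ 1) := ⟨Θ, hΘ0, rfl⟩
    have hbl : ∀ t, p (b t) = p (a t) := fun t => congrFun hl t
    have hcl : ∀ t, p (c t) = p (a'.symm t) := fun t => congrFun hΘ t
    have hloop : Θ 1 = y' := by
      rcases hp.2 ⟨fun t => p ((a.trans a'.symm) t), by have := hc.continuous; fun_prop⟩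
        (by simp) with hr | hr
      · have := hr (b.trans c).toContinuousMap (fun t => by
          change p ((b.trans c) t) = p ((a.trans a'.symm) t)
          simp only [Path.trans_apply]
          split_ifs
          · exact hbl _
          · exact hcl _)
        have h2 : (b.trans c) 0 = (b.trans c) 1 := this
        simpa using h2.symm
      · exact absurd (by simp : (a.trans a'.symm) 0 = (a.trans a'.symm) 1)
          (hr (a.trans a'.symm).toContinuousMap fun t => rfl)
    have hΓ'' : Γ'.1 = fun t => Θ (unitInterval.symm t) := by
      refine hc.eq_of_comp_eq Γ'.2 (by fun_prop) ?_ 0 ?_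
      · funext t
        have h3 := congrFun hΘ (unitInterval.symm t)
        have h4 := congrFun hl' t
        simp only [Function.comp_apply, ContinuousMap.comp_apply, ContinuousMap.coe_mk,
          unitInterval.symm_symm] at h3 h4
        simp only [Function.comp_apply]
        exact h4.trans h3.symm
      · simpa [hloop] using hΓ'
    have := congrFun hΓ'' 1
    simp only [unitInterval.symm_one, hΘ0] at this
    exact this.symm

/-- Lifts of `p` through itself in the two directions compose to lifts with a fixed point, and these
are the identity. -/
theorem IsRegularCovering.exists_deck (hp : IsRegularCovering p) [PathConnectedSpace Y]
    [LocallyPathConnectedSpace Y] {y y' : Y} (h : p y = p y') :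
    ∃ g ∈ Deck p, g y = y' := by
  obtain ⟨F, hF, hpF⟩ := hp.exists_lift h
  obtain ⟨F', hF', hpF'⟩ := hp.exists_lift h.symm
  have h1 : F' ∘ F = id := hp.1.eq_of_comp_eq (by fun_prop) continuous_id
    (by rw [← Function.comp_assoc, hpF', hpF]; rfl) y (by simp [hF, hF'])
  have h2 : F ∘ F' = id := hp.1.eq_of_comp_eq (by fun_prop) continuous_id
    (by rw [← Function.comp_assoc, hpF, hpF']; rfl) y' (by simp [hF, hF'])
  exact ⟨⟨⟨F, F', congrFun h1, congrFun h2⟩, F.continuous, F'.continuous⟩, congrFun hpF, hF⟩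

theorem EvenlyCovered.mono {U U' : Set Z} (h : EvenlyCovered p U) (hU' : IsOpen U')
    (hs : U' ⊆ U) : EvenlyCovered p U' := by
  obtain ⟨hU, sheets, hd, hun, he⟩ := h
  refine ⟨hU', (fun s => s ∩ p ⁻¹' U') '' sheets, ?_, ?_, ?_⟩
  · rintro _ ⟨s, hs, rfl⟩ _ ⟨t, ht, rfl⟩ hne
    have : s ≠ t := fun h => hne (by rw [h])
    exact (hd hs ht this).mono Set.inter_subset_left Set.inter_subset_left
  · ext y
    simp only [Set.sUnion_image, Set.mem_iUnion, Set.mem_inter_iff, Set.mem_preimage, exists_prop]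
    constructor
    · rintro ⟨s, _, _, h⟩
      exact h
    · intro hy
      have : y ∈ ⋃₀ sheets := by rw [hun]; exact hs hy
      obtain ⟨s, h1, h2⟩ := this
      exact ⟨s, h1, h2, hy⟩
  · rintro _ ⟨s, hs', rfl⟩
    obtain ⟨e, h1, h2, h3⟩ := he s hs'
    have key : e.source ∩ e ⁻¹' U' = s ∩ p ⁻¹' U' := by
      rw [h1]
      ext y
      refine and_congr_right fun hy => ?_
      simp [h3 hy]
    have hop : IsOpen (s ∩ p ⁻¹' U') := by
      rw [← key]
      exact e.isOpen_inter_preimage hU'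
    refine ⟨e.restrOpen (s ∩ p ⁻¹' U') hop, ?_, ?_, ?_⟩
    · rw [OpenPartialHomeomorph.restrOpen_source, h1, ← Set.inter_assoc, Set.inter_self]
    · rw [← OpenPartialHomeomorph.image_source_eq_target, OpenPartialHomeomorph.restrOpen_source,
        h1, ← Set.inter_assoc, Set.inter_self]
      ext z
      constructor
      · rintro ⟨y, ⟨hy, hyU⟩, rfl⟩
        simpa [h3 hy] using hyU
      · intro hz
        have hz' : z ∈ e.target := h2 ▸ hs hz
        have hy := e.map_target hz'
        rw [h1] at hy
        have hpe := h3 hy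
        rw [e.right_inv hz'] at hpe
        exact ⟨e.symm z, ⟨hy, by simpa [← hpe] using hz⟩, e.right_inv hz'⟩
    · intro y hy
      exact h3 hy.1

/-- Over a connected set evenly covered by both `p` and `p ∘ f`, each sheet of `p ∘ f` is carried by
`f` into a single sheet of `p`. The preimage of one sheet `V` of `p` is therefore the union of those
sheets that land in `V`. -/
theorem IsCoveringMap.of_comp {W : Type w} [TopologicalSpace W] [LocallyConnectedSpace Z]
    {f : W → Y} (hp : IsCoveringMap p) (hpf : IsCoveringMap (p ∘ f)) (hf : Continuous f) :
    IsCoveringMap f := by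
  intro x
  obtain ⟨hI, U₁, hx₁, hU₁, hpU₁, e₁, he₁⟩ := hp (p x)
  obtain ⟨hJ, U₂, hx₂, hU₂, hpU₂, e₂, he₂⟩ := hpf (p x)
  let U := connectedComponentIn (U₁ ∩ U₂) (p x)
  have hxU : p x ∈ U := mem_connectedComponentIn ⟨hx₁, hx₂⟩
  have hU : IsOpen U := (hU₁.inter hU₂).connectedComponentIn
  have hUs : U ⊆ U₁ ∩ U₂ := connectedComponentIn_subset _ _
  have hUc : IsPreconnected U := isPreconnected_connectedComponentIn
  let lab : p ⁻¹' U₁ → (p ⁻¹' {p x}) := fun y => (e₁ y).2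
  have hlab : Continuous lab := by fun_prop
  let i₀ := lab ⟨x, hx₁⟩
  let V : Set Y := Subtype.val '' (lab ⁻¹' {i₀} ∩ {y | p y ∈ U})
  have hV : IsOpen V := hpU₁.isOpenMap_subtype_val _
    (((isOpen_discrete {i₀}).preimage hlab).inter
      (hU.preimage (hp.continuous.comp continuous_subtype_val)))
  have hVU : ∀ y ∈ V, p y ∈ U := by
    rintro _ ⟨y, hy, rfl⟩
    exact hy.2
  have hVlab : ∀ y (hy : y ∈ V), lab ⟨y, (hUs (hVU y hy)).1⟩ = i₀ := by
    rintro _ ⟨y, hy, rfl⟩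
    exact hy.1
  have memV : ∀ y (hy : p y ∈ U), lab ⟨y, (hUs hy).1⟩ = i₀ → y ∈ V :=
    fun y hy h => ⟨⟨y, (hUs hy).1⟩, ⟨h, hy⟩, rfl⟩
  let g : (z : U) → (j : p ∘ f ⁻¹' {p x}) → W := fun z j => (e₂.symm (⟨z.1, (hUs z.2).2⟩, j)).1
  have hg : Continuous fun q : U × (p ∘ f ⁻¹' {p x}) => g q.1 q.2 := by
    refine continuous_subtype_val.comp (e₂.symm.continuous.comp ?_)
    exact ((continuous_subtype_val.comp continuous_fst).subtype_mk _).prodMk continuous_snd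
  have hpg : ∀ z j, p (f (g z j)) = z := by
    intro z j
    have := he₂ (e₂.symm (⟨z.1, (hUs z.2).2⟩, j))
    rw [e₂.apply_symm_apply] at this
    exact this.symm
  have hgm : ∀ z j, p (f (g z j)) ∈ U := fun z j => by rw [hpg]; exact z.2
  -- The sheet label is a continuous map from a connected set to a discrete space.
  have hconst : ∀ j z z', lab ⟨f (g z j), (hUs (hgm z j)).1⟩ =
      lab ⟨f (g z' j), (hUs (hgm z' j)).1⟩ := by
    intro j z z'
    have : PreconnectedSpace U := isPreconnected_iff_preconnectedSpace.1 hUc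
    refine PreconnectedSpace.constant this (f := fun z =>
      lab ⟨f (g z j), (hUs (hgm z j)).1⟩) ?_
    refine hlab.comp (Continuous.subtype_mk (hf.comp ?_) _)
    exact hg.comp (by fun_prop : Continuous fun z : U => (z, j))
  -- By `hconst` it does not matter over which point of `U` membership in `V` is tested.
  let J := {j : p ∘ f ⁻¹' {p x} // f (g ⟨p x, hxU⟩ j) ∈ V}
  have hJV : ∀ j, f (g ⟨p x, hxU⟩ j) ∈ V ↔ ∀ z, f (g z j) ∈ V := fun j =>
    ⟨fun h z => memV _ (hgm z j) (by rw [hconst j z ⟨p x, hxU⟩]; exact hVlab _ h), fun h => h _⟩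
  have hge : ∀ w (hw : p (f w) ∈ U), g ⟨p (f w), hw⟩ (e₂ ⟨w, (hUs hw).2⟩).2 = w := by
    intro w hw
    have : (⟨p (f w), (hUs hw).2⟩, (e₂ ⟨w, (hUs hw).2⟩).2) = e₂ ⟨w, (hUs hw).2⟩ :=
      Prod.ext (Subtype.ext (he₂ ⟨w, (hUs hw).2⟩).symm) rfl
    simp only [g, this, e₂.symm_apply_apply]
  have inj : ∀ y y', y ∈ V → y' ∈ V → p y = p y' → y = y' := by
    intro y y' hy hy' h
    have h1 : e₁ ⟨y, (hUs (hVU y hy)).1⟩ = e₁ ⟨y', (hUs (hVU y' hy')).1⟩ := by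
      refine Prod.ext (Subtype.ext ?_) ?_
      · rw [he₁, he₁]; exact h
      · exact (hVlab y hy).trans (hVlab y' hy').symm
    exact congrArg Subtype.val (e₁.injective h1)
  have hxV : x ∈ V := memV x hxU rfl
  refine IsEvenlyCovered.to_isEvenlyCovered_preimage (I := J)
    ⟨inferInstance, V, hxV, hV, hV.preimage hf,
    { toFun := fun w => (⟨f w, w.2⟩, ⟨(e₂ ⟨w, (hUs (hVU _ w.2)).2⟩).2, (hJV _).2 fun z => by
        refine memV _ (hgm z _) ?_
        rw [hconst _ z ⟨p (f w), hVU _ w.2⟩]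
        simp only [hge]
        exact hVlab _ w.2⟩)
      invFun := fun q => ⟨g ⟨p q.1, hVU _ q.1.2⟩ q.2.1, (hJV _).1 q.2.2 _⟩
      left_inv := fun w => Subtype.ext (hge _ _)
      right_inv := fun q => by
        refine Prod.ext (Subtype.ext ?_) (Subtype.ext ?_)
        · exact inj _ _ ((hJV _).1 q.2.2 _) q.1.2 (hpg _ _)
        · simp [g]
      continuous_toFun := by
        refine (Continuous.subtype_mk (hf.comp continuous_subtype_val) _).prodMk
          (Continuous.subtype_mk ?_ _)
        exact continuous_snd.comp (e₂.continuous.comp (continuous_subtype_val.subtype_mk _))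
      continuous_invFun := by
        refine Continuous.subtype_mk ?_ _
        refine hg.comp (Continuous.prodMk (Continuous.subtype_mk ?_ _) ?_)
        · exact hp.continuous.comp (continuous_subtype_val.comp continuous_fst)
        · exact continuous_subtype_val.comp continuous_snd },
    fun w => rfl⟩

end CoveringMaps

/-! ### Points of the projective limit and the action of compatible deck transformations -/

namespace FiniteCoveringSequence

section Basics

variable {X : ℕ → Type u} [∀ n, TopologicalSpace (X n)] (S : FiniteCoveringSequence X)

theorem proj_comm {m n : ℕ} (h : m ≤ n) (x : S.CoveringLimit) : S.π h (S.proj n x) = S.proj m x :=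
  x.2 h

theorem ext_proj {x y : S.CoveringLimit} (h : ∀ n, S.proj n x = S.proj n y) : x = y :=
  Subtype.ext (funext h)

theorem ext_of_eventually_proj {x y : S.CoveringLimit} (N : ℕ)
    (h : ∀ n ≥ N, S.proj n x = S.proj n y) : x = y :=
  S.ext_proj fun n => by
    rw [← S.proj_comm (le_max_left n N) x, ← S.proj_comm (le_max_left n N) y,
      h _ (le_max_right n N)]

theorem isCoveringMap {m n : ℕ} (h : m ≤ n) : IsCoveringMap (S.π h) := (S.regular h).1

theorem π_surjective [∀ n, ConnectedSpace (X n)] {m n : ℕ} (h : m ≤ n) :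
    Function.Surjective (S.π h) := (S.isCoveringMap h).surjective_of_preconnectedSpace

include S in
theorem locallyPathConnectedSpace [LocallyPathConnectedSpace (X 0)] (n : ℕ) :
    LocallyPathConnectedSpace (X n) :=
  (S.isCoveringMap (Nat.zero_le n)).isLocalHomeomorph.locallyPathConnectedSpace

include S in
theorem pathConnectedSpace [∀ n, ConnectedSpace (X n)] [LocallyPathConnectedSpace (X 0)] (n : ℕ) :
    PathConnectedSpace (X n) :=
  have := S.locallyPathConnectedSpace n
  PathConnectedSpace.of_locallyPathConnectedSpace

theorem exists_coherent_of_chain (n : ℕ) (z : ∀ k, X (n + k))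
    (hz : ∀ k, S.π (Nat.le_succ (n + k)) (z (k + 1)) = z k) :
    ∃ x : S.CoveringLimit, ∀ k, S.proj (n + k) x = z k := by
  have hz' : ∀ k l (h : n + k ≤ n + l), S.π h (z l) = z k := by
    intro k l h
    obtain ⟨j, rfl⟩ := Nat.exists_eq_add_of_le (Nat.le_of_add_le_add_left h)
    induction j with
    | zero => exact S.π_self _ _
    | succ j ih =>
      have := ih (by omega)
      rw [← hz (k + j), S.π_comp] at this
      exact this
  -- The entry `z m` lives at stage `n + m ≥ m`, so it has a projection to every stage `m`, also
  -- below `n`.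
  refine ⟨⟨fun m => S.π (Nat.le_add_left m n) (z m), fun {a b} h => ?_⟩, ?_⟩
  · change S.π h (S.π _ (z b)) = S.π _ (z a)
    rw [S.π_comp, ← hz' a b (by omega), S.π_comp]
  · exact fun k => hz' k (n + k) (by omega)

theorem proj_surjective [∀ n, ConnectedSpace (X n)] (n : ℕ) : Function.Surjective (S.proj n) := by
  intro x
  choose s hs using fun k => S.π_surjective (Nat.le_succ (n + k))
  obtain ⟨y, hy⟩ := S.exists_coherent_of_chain n (fun k => Nat.rec x (fun k y => s k y) k)
    fun k => hs k _
  exact ⟨y, hy 0⟩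

theorem isCoherentSystem [∀ n, ConnectedSpace (X n)] : S.IsCoherentSystem S.proj :=
  ⟨S.proj_comm, S.proj_surjective⟩

/-! ### Compatible families of covering transformations -/

/-- The group of compatible families of covering transformations over `X 0`. -/
def towerGroup : Subgroup (∀ n, X n ≃ₜ X n) where
  carrier := {d | d 0 = 1 ∧ ∀ {m n : ℕ} (h : m ≤ n) x, S.π h (d n x) = d m (S.π h x)}
  mul_mem' {a b} ha hb := ⟨by rw [Pi.mul_apply, ha.1, hb.1, one_mul], fun h x =>
    (ha.2 h _).trans (congrArg _ (hb.2 h x))⟩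
  one_mem' := ⟨rfl, fun _ _ => rfl⟩
  inv_mem' {a} ha := ⟨by rw [Pi.inv_apply, ha.1, inv_one], fun {m n} h x => by
    have h1 := ha.2 h ((a n)⁻¹ x)
    have h2 : a n ((a n)⁻¹ x) = x := (a n).apply_symm_apply x
    rw [h2] at h1
    rw [h1]
    exact ((a m).symm_apply_apply _).symm⟩

variable {S} in
theorem towerGroup_π (d : S.towerGroup) {m n : ℕ} (h : m ≤ n) (x : X n) :
    S.π h (d.1 n x) = d.1 m (S.π h x) := d.2.2 h x

theorem towerGroup_mem_deck (d : S.towerGroup) (n : ℕ) : d.1 n ∈ Deck (S.π (Nat.zero_le n)) := by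
  intro x
  rw [towerGroup_π, d.2.1]
  rfl

instance : MulAction S.towerGroup S.CoveringLimit where
  smul d x := ⟨fun n => d.1 n (x.1 n), fun h => by rw [towerGroup_π, x.2 h]⟩
  one_smul _ := rfl
  mul_smul _ _ _ := rfl

@[simp] theorem proj_smul (d : S.towerGroup) (x : S.CoveringLimit) (n : ℕ) :
    S.proj n (d • x) = d.1 n (S.proj n x) := rfl

theorem proj_zero_smul (d : S.towerGroup) (x : S.CoveringLimit) :
    S.proj 0 (d • x) = S.proj 0 x := by
  rw [proj_smul, d.2.1]
  rfl

/-- The compatible families that are trivial at stage `n`. -/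
def towerKernel (n : ℕ) : Subgroup S.towerGroup where
  carrier := {d | d.1 n = 1}
  mul_mem' {a b} ha hb := by
    change a.1 n * b.1 n = 1
    rw [ha, hb, one_mul]
  one_mem' := rfl
  inv_mem' {a} ha := by
    change (a.1 n)⁻¹ = 1
    rw [ha, inv_one]

variable {S}

theorem mem_towerKernel {n : ℕ} {d : S.towerGroup} : d ∈ S.towerKernel n ↔ d.1 n = 1 := Iff.rfl

variable [∀ n, ConnectedSpace (X n)]

theorem towerGroup_ext_stage (d d' : S.towerGroup) (n : ℕ) (x : X n) (h : d.1 n x = d'.1 n x) :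
    d.1 n = d'.1 n :=
  Deck.eq_of_apply_eq (S.isCoveringMap _) (S.towerGroup_mem_deck d n) (S.towerGroup_mem_deck d' n)
    x h

theorem towerGroup_ext (d d' : S.towerGroup) (x : S.CoveringLimit) (h : d • x = d' • x) :
    d = d' :=
  Subtype.ext <| funext fun n => towerGroup_ext_stage d d' n (S.proj n x)
    (congrArg (S.proj n) h)

variable [LocallyPathConnectedSpace (X 0)]

/-- Regularity supplies a deck transformation at each stage separately; uniqueness of lifts makes
these choices compatible automatically. -/
theorem exists_smul_eq {x y : S.CoveringLimit} (h : S.proj 0 x = S.proj 0 y) :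
    ∃ d : S.towerGroup, d • x = y := by
  have key : ∀ n, ∃ g ∈ Deck (S.π (Nat.zero_le n)), g (S.proj n x) = S.proj n y := by
    intro n
    have := S.locallyPathConnectedSpace n
    have := S.pathConnectedSpace n
    exact (S.regular (Nat.zero_le n)).exists_deck (by rw [proj_comm, proj_comm, h])
  choose d hd hdx using key
  -- Both sides lift the map `X n → X 0` through `X m`, and they agree at `S.proj n x`.
  have hcomp : ∀ {m n : ℕ} (h : m ≤ n) x, S.π h (d n x) = d m (S.π h x) := by
    intro m n h
    refine congrFun ((S.isCoveringMap (Nat.zero_le m)).eq_of_comp_eq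
      ((S.isCoveringMap h).continuous.comp (d n).continuous)
      ((d m).continuous.comp (S.isCoveringMap h).continuous) (funext fun z => ?_) (S.proj n x) ?_)
    · simp only [Function.comp_apply]
      rw [S.π_comp, hd n z, hd m, S.π_comp]
    · rw [hdx, proj_comm, proj_comm, hdx]
  refine ⟨⟨d, Homeomorph.ext fun z => ?_, hcomp⟩, S.ext_proj hdx⟩
  have := hd 0 z
  rw [S.π_self, S.π_self] at this
  exact this

theorem exists_towerKernel_smul_eq {n : ℕ} {x y : S.CoveringLimit}
    (h : S.proj n x = S.proj n y) : ∃ d ∈ S.towerKernel n, d • x = y := by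
  obtain ⟨d, hd⟩ := exists_smul_eq (S := S) (x := x) (y := y)
    (by rw [← S.proj_comm (Nat.zero_le n) x, h, proj_comm])
  refine ⟨d, ?_, hd⟩
  refine towerGroup_ext_stage d 1 n (S.proj n x) ?_
  rw [← proj_smul, hd, ← h]
  rfl

theorem exists_towerGroup_stage (n : ℕ) {g : X n ≃ₜ X n} (hg : g ∈ Deck (S.π (Nat.zero_le n))) :
    ∃ d : S.towerGroup, d.1 n = g := by
  obtain ⟨z⟩ : Nonempty (X n) := inferInstance
  obtain ⟨x, rfl⟩ := S.proj_surjective n z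
  obtain ⟨y, hy⟩ := S.proj_surjective n (g (S.proj n x))
  obtain ⟨d, rfl⟩ := exists_smul_eq (S := S) (x := x) (y := y)
    (by rw [← S.proj_comm (Nat.zero_le n) x, ← S.proj_comm (Nat.zero_le n) y, hy, hg])
  exact ⟨d, Deck.eq_of_apply_eq (S.isCoveringMap _) (S.towerGroup_mem_deck d n) hg (S.proj n x) hy⟩

end Basics

/-! ### Special sets -/

section Special

variable {X : ℕ → Type u} [∀ n, TopologicalSpace (X n)] {S : FiniteCoveringSequence X}
  {V : Set S.CoveringLimit}

theorem IsSpecialSet.isOpen (hV : S.IsSpecialSet S.proj V) : IsOpen V :=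
  TopologicalSpace.isOpen_generateFrom_of_mem hV

/-- The topology of the limit plays no role here. Coordinatewise continuity holds because the
preimage of an open `O` is the image of the open set `S.proj n '' V ∩ O` under the open map to `X
0`. -/
theorem IsSpecialSet.exists_section (hV : S.IsSpecialSet S.proj V) :
    ∃ s : X 0 → S.CoveringLimit, (∀ z ∈ S.proj 0 '' V, s z ∈ V ∧ S.proj 0 (s z) = z) ∧
      (∀ x ∈ V, s (S.proj 0 x) = x) ∧ ∀ n, ContinuousOn (S.proj n ∘ s) (S.proj 0 '' V) := by
  have hne : Nonempty S.CoveringLimit := (hV.2 0).2.1.nonempty.of_image.to_subtype.map Subtype.val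
  have h : ∀ z, ∃ x, z ∈ S.proj 0 '' V → x ∈ V ∧ S.proj 0 x = z := fun z => by
    by_cases hz : z ∈ S.proj 0 '' V
    · obtain ⟨x, hx⟩ := hz
      exact ⟨x, fun _ => hx⟩
    · exact ⟨hne.some, fun h => absurd h hz⟩
  choose s hs using h
  have hsx : ∀ x ∈ V, s (S.proj 0 x) = x := fun x hx =>
    (hV.2 0).2.2 (hs _ ⟨x, hx, rfl⟩).1 hx (hs _ ⟨x, hx, rfl⟩).2
  refine ⟨s, hs, hsx, fun n => ?_⟩
  rw [continuousOn_open_iff (hV.2 0).1]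
  intro O hO
  have : S.proj 0 '' V ∩ (S.proj n ∘ s) ⁻¹' O = S.π (Nat.zero_le n) '' (S.proj n '' V ∩ O) := by
    ext z
    constructor
    · rintro ⟨hz, hzO⟩
      refine ⟨_, ⟨⟨s z, (hs z hz).1, rfl⟩, hzO⟩, ?_⟩
      rw [proj_comm, (hs z hz).2]
    · rintro ⟨_, ⟨⟨x, hx, rfl⟩, hxO⟩, rfl⟩
      rw [proj_comm]
      refine ⟨⟨x, hx, rfl⟩, ?_⟩
      simpa [hsx x hx] using hxO
  rw [this]
  exact (S.isCoveringMap _).isOpenMap _ ((hV.2 n).1.inter hO)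

theorem IsSpecialSet.restrict (hV : S.IsSpecialSet S.proj V) {U : Set (X 0)} (hU : IsOpen U)
    (hUc : IsConnected U) (hUV : U ⊆ S.proj 0 '' V) :
    S.IsSpecialSet S.proj (V ∩ S.proj 0 ⁻¹' U) ∧ S.proj 0 '' (V ∩ S.proj 0 ⁻¹' U) = U := by
  obtain ⟨s, hs, hsx, hsc⟩ := hV.exists_section
  have h0 : S.proj 0 '' (V ∩ S.proj 0 ⁻¹' U) = U := by
    rw [Set.image_inter_preimage, Set.inter_eq_right.2 hUV]
  refine ⟨⟨by rw [h0]; exact hV.1.mono hU hUV, fun n => ⟨?_, ?_, ?_⟩⟩, h0⟩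
  · have : S.proj n '' (V ∩ S.proj 0 ⁻¹' U) = S.proj n '' V ∩ S.π (Nat.zero_le n) ⁻¹' U := by
      rw [← Set.image_inter_preimage, ← Set.preimage_comp]
      congr 2
      ext x
      simp [proj_comm]
    rw [this]
    exact (hV.2 n).1.inter (hU.preimage (S.isCoveringMap _).continuous)
  · have : S.proj n '' (V ∩ S.proj 0 ⁻¹' U) = (S.proj n ∘ s) '' U := by
      ext z
      constructor
      · rintro ⟨x, ⟨hx, hxU⟩, rfl⟩
        exact ⟨_, hxU, by simp [hsx x hx]⟩
      · rintro ⟨z, hz, rfl⟩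
        obtain ⟨h1, h2⟩ := hs z (hUV hz)
        exact ⟨s z, ⟨h1, by simpa [h2] using hz⟩, rfl⟩
    rw [this]
    exact hUc.image _ ((hsc n).mono hUV)
  · exact (hV.2 n).2.2.mono Set.inter_subset_left

theorem IsSpecialSet.smul (hV : S.IsSpecialSet S.proj V) (d : S.towerGroup) :
    S.IsSpecialSet S.proj ((d • ·) '' V) ∧ S.proj 0 '' ((d • ·) '' V) = S.proj 0 '' V := by
  have hn : ∀ n, S.proj n '' ((d • ·) '' V) = d.1 n '' (S.proj n '' V) := fun n => by
    rw [Set.image_image, Set.image_image]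
    rfl
  have h0 : S.proj 0 '' ((d • ·) '' V) = S.proj 0 '' V := by
    rw [hn, d.2.1]
    exact Set.image_id _
  refine ⟨⟨by rw [h0]; exact hV.1, fun n => ⟨?_, ?_, ?_⟩⟩, h0⟩
  · rw [hn]
    exact (d.1 n).isOpenMap _ (hV.2 n).1
  · rw [hn]
    exact (hV.2 n).2.1.image _ (d.1 n).continuous.continuousOn
  · rintro _ ⟨x, hx, rfl⟩ _ ⟨y, hy, rfl⟩ h
    exact congrArg (d • ·) ((hV.2 n).2.2 hx hy ((d.1 n).injective h))

/-- A coordinatewise continuous map from a connected space into the limit that stays over a special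
set and meets it is contained in it. -/
theorem IsSpecialSet.mem_of_preconnected (hV : S.IsSpecialSet S.proj V)
    {D : Type w} [TopologicalSpace D] [PreconnectedSpace D] {f : D → S.CoveringLimit}
    (hf : ∀ n, Continuous (S.proj n ∘ f)) (hfV : ∀ t, S.proj 0 (f t) ∈ S.proj 0 '' V) {t₀ : D}
    (ht₀ : f t₀ ∈ V) (t : D) : f t ∈ V := by
  obtain ⟨s, hs, hsx, hsc⟩ := hV.exists_section
  suffices f t = s (S.proj 0 (f t)) by
    rw [this]
    exact (hs _ (hfV t)).1
  refine S.ext_proj fun n => congrFun ((S.isCoveringMap (Nat.zero_le n)).eq_of_comp_eq (hf n)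
    (g₂ := fun t => S.proj n (s (S.proj 0 (f t)))) ?_ (funext fun t => ?_) t₀ ?_) t
  · exact (hsc n).comp_continuous (hf 0) hfV
  · simp only [Function.comp_apply]
    rw [proj_comm, proj_comm, (hs _ (hfV t)).2]
  · simp [hsx _ ht₀]

/-- The section of `W` over its connected image in `X 0` stays over `V` and meets it at `x`, so it
cannot leave `V`. This is what makes the special sets a basis. -/
theorem IsSpecialSet.subset_of_subset (hV : S.IsSpecialSet S.proj V) {W : Set S.CoveringLimit}
    (hW : S.IsSpecialSet S.proj W) (h : S.proj 0 '' W ⊆ S.proj 0 '' V) {x : S.CoveringLimit}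
    (hxV : x ∈ V) (hxW : x ∈ W) : W ⊆ V := by
  obtain ⟨s, hs, hsx, hsc⟩ := hW.exists_section
  intro y hy
  have : PreconnectedSpace (S.proj 0 '' W) :=
    isPreconnected_iff_preconnectedSpace.1 (hW.2 0).2.1.isPreconnected
  have := hV.mem_of_preconnected (f := fun z : S.proj 0 '' W => s z)
    (fun n => (hsc n).comp_continuous continuous_subtype_val fun z => z.2)
    (fun z => by
      rw [(hs _ z.2).2]
      exact h z.2)
    (t₀ := ⟨_, x, hxW, rfl⟩) (by simpa [hsx x hxW] using hxV) ⟨_, y, hy, rfl⟩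
  simpa [hsx y hy] using this

end Special

/-! ### The topology of the covering limit -/

section LimitTopology

variable {X : ℕ → Type u} [∀ n, TopologicalSpace (X n)] [LocallyPathConnectedSpace (X 0)]
  {S : FiniteCoveringSequence X}

theorem IsSpecialSet.exists_restrict {V : Set S.CoveringLimit} (hV : S.IsSpecialSet S.proj V)
    {x : S.CoveringLimit} (hx : x ∈ V) {O : Set (X 0)} (hO : IsOpen O) (hxO : S.proj 0 x ∈ O) :
    ∃ W, S.IsSpecialSet S.proj W ∧ x ∈ W ∧ W ⊆ V ∧ S.proj 0 '' W ⊆ O := by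
  have hmem : S.proj 0 x ∈ S.proj 0 '' V ∩ O := ⟨⟨x, hx, rfl⟩, hxO⟩
  have hsub := connectedComponentIn_subset (S.proj 0 '' V ∩ O) (S.proj 0 x)
  obtain ⟨h1, h2⟩ := hV.restrict (((hV.2 0).1.inter hO).connectedComponentIn)
    (isConnected_connectedComponentIn_iff.2 hmem) (hsub.trans Set.inter_subset_left)
  refine ⟨_, h1, ⟨hx, mem_connectedComponentIn hmem⟩, Set.inter_subset_left, ?_⟩
  rw [h2]
  exact hsub.trans Set.inter_subset_right

variable (hS : ∀ x : S.CoveringLimit, ∃ V, S.IsSpecialSet S.proj V ∧ x ∈ V)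

include hS

theorem isTopologicalBasis_special :
    TopologicalSpace.IsTopologicalBasis {V | S.IsSpecialSet S.proj V} where
  exists_subset_inter := by
    intro V hV W hW x hx
    obtain ⟨U, hU, hxU, hUV, hU0⟩ := IsSpecialSet.exists_restrict hV hx.1 (hW.2 0).1
      (Set.mem_image_of_mem _ hx.2)
    exact ⟨U, hU, hxU, Set.subset_inter hUV (IsSpecialSet.subset_of_subset hW hU hU0 hx.2 hxU)⟩
  sUnion_eq := Set.sUnion_eq_univ_iff.2 fun x => by
    obtain ⟨V, hV, hx⟩ := hS x
    exact ⟨V, hV, hx⟩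
  eq_generateFrom := rfl

theorem continuous_proj (n : ℕ) : Continuous (S.proj n) := by
  refine continuous_def.2 fun O hO => ?_
  rw [(isTopologicalBasis_special hS).isOpen_iff]
  intro x hx
  obtain ⟨V, hV, hxV⟩ := hS x
  obtain ⟨s, hs, hsx, hsc⟩ := hV.exists_section
  obtain ⟨W, hW, hxW, hWV, hWs⟩ := hV.exists_restrict hxV
    ((hsc n).isOpen_inter_preimage (hV.2 0).1 hO)
    ⟨⟨x, hxV, rfl⟩, by simpa [hsx x hxV] using hx⟩
  refine ⟨W, hW, hxW, fun y hy => ?_⟩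
  have := (hWs ⟨y, hy, rfl⟩).2
  simpa [hsx y (hWV hy)] using this

/-- The topology is finer than the product topology, so local connectedness of the domain is
essential: on a connected neighbourhood that stays over a special set, the map cannot jump to
another sheet. -/
theorem continuous_of_proj_comp {D : Type w} [TopologicalSpace D] [LocallyConnectedSpace D]
    {f : D → S.CoveringLimit} (hf : ∀ n, Continuous (S.proj n ∘ f)) : Continuous f := by
  rw [(isTopologicalBasis_special hS).continuous_iff]
  intro V hV
  refine isOpen_iff_mem_nhds.2 fun t ht => ?_
  have hopen : IsOpen ((S.proj 0 ∘ f) ⁻¹' (S.proj 0 '' V)) := (hV.2 0).1.preimage (hf 0)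
  have ht' : t ∈ (S.proj 0 ∘ f) ⁻¹' (S.proj 0 '' V) := ⟨f t, ht, rfl⟩
  refine Filter.mem_of_superset (hopen.connectedComponentIn.mem_nhds
    (mem_connectedComponentIn ht')) fun t' ht'' => ?_
  have : PreconnectedSpace (connectedComponentIn ((S.proj 0 ∘ f) ⁻¹' (S.proj 0 '' V)) t) :=
    isPreconnected_iff_preconnectedSpace.1 isPreconnected_connectedComponentIn
  exact IsSpecialSet.mem_of_preconnected hV (f := fun c :
      connectedComponentIn ((S.proj 0 ∘ f) ⁻¹' (S.proj 0 '' V)) t => f c)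
    (fun n => (hf n).comp continuous_subtype_val)
    (fun c => connectedComponentIn_subset ((S.proj 0 ∘ f) ⁻¹' (S.proj 0 '' V)) t c.2)
    (t₀ := ⟨t, mem_connectedComponentIn ht'⟩) ht ⟨t', ht''⟩

theorem isLocalHomeomorph_proj_zero : IsLocalHomeomorph (S.proj 0) := by
  intro x
  obtain ⟨V, hV, hxV⟩ := hS x
  obtain ⟨s, hs, hsx, hsc⟩ := hV.exists_section
  have hloc : LocallyConnectedSpace (S.proj 0 '' V) :=
    have := (hV.2 0).1.locallyPathConnectedSpace
    inferInstance
  let e : OpenPartialHomeomorph S.CoveringLimit (X 0) :=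
    { toFun := S.proj 0
      invFun := s
      source := V
      target := S.proj 0 '' V
      map_source' := fun y hy => ⟨y, hy, rfl⟩
      map_target' := fun z hz => (hs z hz).1
      left_inv' := hsx
      right_inv' := fun z hz => (hs z hz).2
      open_source := hV.isOpen
      open_target := (hV.2 0).1
      continuousOn_toFun := (continuous_proj hS 0).continuousOn
      continuousOn_invFun := by
        rw [continuousOn_iff_continuous_domRestrict]
        exact continuous_of_proj_comp hS fun n => (hsc n).comp_continuous continuous_subtype_val
          fun z => z.2 }
  exact ⟨e, hxV, rfl⟩

theorem locallyPathConnectedSpace_coveringLimit : LocallyPathConnectedSpace S.CoveringLimit :=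
  (isLocalHomeomorph_proj_zero hS).locallyPathConnectedSpace

theorem locallyCompactSpace_coveringLimit [LocallyCompactSpace (X 0)] :
    LocallyCompactSpace S.CoveringLimit :=
  (isLocalHomeomorph_proj_zero hS).locallyCompactSpace

theorem t2Space_coveringLimit [∀ n, T2Space (X n)] : T2Space S.CoveringLimit := by
  refine ⟨fun x y hxy => ?_⟩
  obtain ⟨n, hn⟩ : ∃ n, S.proj n x ≠ S.proj n y := by
    by_contra h
    push Not at h
    exact hxy (S.ext_proj h)
  exact separated_by_continuous (continuous_proj hS n) hn

theorem isOpenMap_proj (n : ℕ) : IsOpenMap (S.proj n) :=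
  (isTopologicalBasis_special hS).isOpenMap_iff.2 fun _ hV => (hV.2 n).1

theorem continuous_smul (d : S.towerGroup) : Continuous fun x : S.CoveringLimit => d • x := by
  have := locallyPathConnectedSpace_coveringLimit hS
  exact continuous_of_proj_comp hS fun n => (d.1 n).continuous.comp (continuous_proj hS n)

variable [∀ n, ConnectedSpace (X n)]

/-- The fibres of `S.proj n` are the orbits of `S.towerKernel n`, and this action is properly
discontinuous. -/
theorem isCoveringMap_proj (n : ℕ) : IsCoveringMap (S.proj n) := by
  have hq : IsQuotientCoveringMap (S.proj n) (S.towerKernel n) :=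
    { (isOpenMap_proj hS n).isQuotientMap (continuous_proj hS n) (S.proj_surjective n) with
      continuous_const_smul := fun d => continuous_smul hS d.1
      apply_eq_iff_mem_orbit := by
        intro x y
        constructor
        · intro h
          obtain ⟨d, hd, hdx⟩ := exists_towerKernel_smul_eq h.symm
          exact ⟨⟨d, hd⟩, hdx⟩
        · rintro ⟨d, rfl⟩
          change d.1.1 n (S.proj n y) = _
          rw [mem_towerKernel.1 d.2]
          rfl
      -- If a special set meets its translate by an element trivial at stage `n`, injectivity of
      -- `S.proj n` on it produces a fixed point, so the element is the identity.
      disjoint := by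
        intro x
        obtain ⟨V, hV, hxV⟩ := hS x
        refine ⟨V, hV.isOpen.mem_nhds hxV, fun d => ?_⟩
        rintro ⟨_, ⟨y, hy, rfl⟩, hdy⟩
        have : d.1 • y = y := (hV.2 n).2.2 hdy hy (by
          change d.1.1 n (S.proj n y) = _
          rw [mem_towerKernel.1 d.2]
          rfl)
        exact Subtype.ext (towerGroup_ext d.1 1 y (by rw [this, one_smul])) }
  exact hq.isCoveringMap

/-- One closed lift projects to a closed lift at every stage `k ≥ n`. Regularity of `X k → X n` then
closes the projections of all other lifts, and the coordinates from `n` on determine a point of the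
limit. -/
theorem isRegularCovering_proj (n : ℕ) : IsRegularCovering (S.proj n) := by
  refine ⟨isCoveringMap_proj hS n, fun ω hω => ?_⟩
  by_cases h : ∃ l : C(unitInterval, S.CoveringLimit), (∀ t, S.proj n (l t) = ω t) ∧ l 0 = l 1
  · left
    obtain ⟨l, hl, hl01⟩ := h
    intro l' hl'
    refine S.ext_of_eventually_proj n fun k hk => ?_
    rcases (S.regular hk).2 ω hω with hr | hr
    · exact hr ⟨fun t => S.proj k (l' t), (continuous_proj hS k).comp l'.continuous⟩
        fun t => by simp [proj_comm, hl']
    · exact absurd (congrArg (S.proj k) hl01)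
        (hr ⟨fun t => S.proj k (l t), (continuous_proj hS k).comp l.continuous⟩
          fun t => by simp [proj_comm, hl])
  · right
    intro l hl hl01
    exact h ⟨l, hl, hl01⟩

theorem isCovering_proj : S.IsCovering S.proj :=
  { S.isCoherentSystem with regular := isRegularCovering_proj hS }

/-- Compatibility with the projections leaves no choice for the morphism. It is continuous because
`Y` inherits local path-connectedness from `X 0`, and it is a covering because its composite with
`S.proj 0` is one. -/
theorem isInverseLimit_proj : S.IsInverseLimit S.proj where
  toIsCovering := isCovering_proj hS
  final := by
    intro Y _ r hr
    let f : Y → S.CoveringLimit := fun y => ⟨fun n => r n y, fun h => hr.comm h y⟩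
    have := (hr.regular 0).1.isLocalHomeomorph.locallyPathConnectedSpace
    have hf : Continuous f := continuous_of_proj_comp hS fun n => (hr.regular n).1.continuous
    refine ⟨f, ⟨IsCoveringMap.of_comp (isCoveringMap_proj hS 0) (hr.regular 0).1 hf,
      fun _ _ => rfl⟩, fun g hg => funext fun y => S.ext_proj fun n => hg.2 n y⟩

end LimitTopology

end FiniteCoveringSequence

/-! ### Functions vanishing at infinity and their characters -/

section ZeroAtInfty

variable {X : Type u} [TopologicalSpace X]

/-- A compactly supported continuous function as a function vanishing at infinity. -/
def ZeroAtInftyContinuousMap.ofHasCompactSupport (f : C(X, ℂ)) (hf : HasCompactSupport f) :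
    C₀(X, ℂ) := ⟨f, hf.is_zero_at_infty⟩

@[simp] theorem ZeroAtInftyContinuousMap.ofHasCompactSupport_apply (f : C(X, ℂ))
    (hf : HasCompactSupport f) (x : X) :
    ZeroAtInftyContinuousMap.ofHasCompactSupport f hf x = f x := rfl

theorem ZeroAtInftyContinuousMap.norm_apply_le (f : C₀(X, ℂ)) (x : X) : ‖f x‖ ≤ ‖f‖ :=
  f.toBCF.norm_coe_le_norm x

theorem ZeroAtInftyContinuousMap.norm_le {f : C₀(X, ℂ)} {C : ℝ} (hC : 0 ≤ C) :
    ‖f‖ ≤ C ↔ ∀ x, ‖f x‖ ≤ C :=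
  f.toBCF.norm_le hC

theorem ZeroAtInftyContinuousMap.isCompact_le_norm (f : C₀(X, ℂ)) {ε : ℝ} (hε : 0 < ε) :
    IsCompact {x | ε ≤ ‖f x‖} := by
  have h : {x | ‖f x‖ < ε} ∈ Filter.cocompact X := by
    have := (zero_at_infty f).eventually (Metric.ball_mem_nhds 0 hε)
    simpa using! this
  obtain ⟨K, hK, hKs⟩ := Filter.mem_cocompact.1 h
  refine hK.of_isClosed_subset (isClosed_le continuous_const (by fun_prop)) fun x hx => ?_
  by_contra hxK
  exact absurd (show ‖f x‖ < ε from hKs hxK) (not_lt.2 hx)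

theorem ZeroAtInftyContinuousMap.tendsto_zero_of_isCompact {f : X → ℂ}
    (h : ∀ ε > 0, ∃ K, IsCompact K ∧ ∀ x ∉ K, ‖f x‖ < ε) :
    Filter.Tendsto f (Filter.cocompact X) (𝓝 0) := by
  rw [Metric.tendsto_nhds]
  intro ε hε
  obtain ⟨K, hK, hKs⟩ := h ε hε
  filter_upwards [hK.compl_mem_cocompact] with x hx
  simpa using hKs x hx

variable [T2Space X] [LocallyCompactSpace X]

theorem ZeroAtInftyContinuousMap.exists_bump {K U : Set X} (hK : IsCompact K) (hU : IsOpen U)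
    (hKU : K ⊆ U) : ∃ f : C₀(X, ℂ), IsCompact (tsupport f) ∧ tsupport f ⊆ U ∧
      (∀ x ∈ K, f x = 1) ∧ ∀ x, ∃ r : ℝ, f x = r ∧ 0 ≤ r ∧ r ≤ 1 := by
  obtain ⟨f, hf1, hf2, hf3, hf4⟩ := exists_continuousMap_one_of_isCompact_subset_isOpen hK hU hKU
  have hs : tsupport (fun x => (f x : ℂ)) = tsupport f := by
    refine congrArg closure (Set.ext fun x => ?_)
    simp
  refine ⟨.ofHasCompactSupport ⟨fun x => (f x : ℂ), by fun_prop⟩ ?_, ?_, ?_, ?_, ?_⟩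
  · change IsCompact (tsupport fun x => (f x : ℂ))
    rwa [hs]
  · change IsCompact (tsupport fun x => (f x : ℂ))
    rwa [hs]
  · change tsupport (fun x => (f x : ℂ)) ⊆ U
    rwa [hs]
  · intro x hx
    simp [hf1 hx]
  · intro x
    exact ⟨f x, rfl, (hf4 x).1, (hf4 x).2⟩

theorem ZeroAtInftyContinuousMap.exists_bump_point {x : X} {U : Set X} (hU : IsOpen U)
    (hx : x ∈ U) : ∃ f : C₀(X, ℂ), f x = 1 ∧ ∀ y ∉ U, f y = 0 := by
  obtain ⟨f, -, h2, h3, -⟩ := exists_bump isCompact_singleton hU (Set.singleton_subset_iff.2 hx)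
  exact ⟨f, h3 x rfl, fun y hy => image_eq_zero_of_notMem_tsupport fun h => hy (h2 h)⟩

theorem ZeroAtInftyContinuousMap.eq_of_forall_apply_eq {x y : X}
    (h : ∀ f : C₀(X, ℂ), f x = f y) : x = y := by
  by_contra hxy
  obtain ⟨f, hf1, hf2⟩ := exists_bump_point (isOpen_compl_singleton (x := y)) hxy
  have := h f
  rw [hf1, hf2 y (by simp)] at this
  exact one_ne_zero this

theorem ZeroAtInftyContinuousMap.continuous_of_forall_comp {D : Type w} [TopologicalSpace D]
    {g : D → X} (h : ∀ f : C₀(X, ℂ), Continuous fun t => f (g t)) : Continuous g := by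
  refine continuous_def.2 fun U hU => isOpen_iff_mem_nhds.2 fun t ht => ?_
  obtain ⟨f, hf1, hf2⟩ := exists_bump_point hU ht
  refine Filter.mem_of_superset (((h f).isOpen_preimage _ isOpen_ne).mem_nhds
    (show f (g t) ≠ 0 by rw [hf1]; exact one_ne_zero)) fun t' ht' => ?_
  by_contra hc
  exact ht' (hf2 _ hc)

omit [T2Space X] [LocallyCompactSpace X] in
-- Otherwise compactness of `{ε ≤ ‖a‖}` gives a finite sum `F` of squares from the kernel that is
-- positive on this set. Dividing by `F`, regularized by a small constant, approximates `a` within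
-- `‖χ a‖ / 2` by elements of the kernel, which contradicts contractivity of `χ`.
theorem ZeroAtInftyContinuousMap.exists_zero_of_character {χ : C₀(X, ℂ) →⋆ₙₐ[ℂ] ℂ} {a : C₀(X, ℂ)}
    (ha : χ a ≠ 0) : ∃ x, a x ≠ 0 ∧ ∀ f, χ f = 0 → f x = 0 := by
  by_contra hcon
  push Not at hcon
  set ε := ‖χ a‖ / 2 with hε
  have hε0 : 0 < ε := by positivity
  have hK := a.isCompact_le_norm hε0
  have hx : ∀ x ∈ {x | ε ≤ ‖a x‖}, ∃ f : C₀(X, ℂ), χ f = 0 ∧ f x ≠ 0 := fun x hx =>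
    hcon x (norm_pos_iff.1 (hε0.trans_le hx))
  choose! f hf0 hfx using hx
  obtain ⟨t, htK, ht⟩ := hK.elim_nhds_subcover (fun x => {y | f x y ≠ 0})
    (fun x hx => (isOpen_ne.preimage (map_continuous (f x))).mem_nhds (hfx x hx))
  let F : C₀(X, ℂ) := ∑ x ∈ t, star (f x) * f x
  have hF : χ F = 0 := by
    simp only [F, map_sum, map_mul]
    exact Finset.sum_eq_zero fun x hx => by rw [hf0 x (htK x hx), mul_zero]
  let G : X → ℝ := fun y => ∑ x ∈ t, ‖f x y‖ ^ 2
  have hFG : ∀ y, F y = (G y : ℂ) := by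
    intro y
    have : F y = ∑ x ∈ t, (star (f x) * f x) y :=
      map_sum ({ toFun := fun h => h y, map_zero' := rfl, map_add' := fun _ _ => rfl } :
        C₀(X, ℂ) →+ ℂ) _ _
    rw [this]
    simp only [G, ZeroAtInftyContinuousMap.mul_apply, ZeroAtInftyContinuousMap.star_apply]
    push_cast
    exact Finset.sum_congr rfl fun x _ => by
      rw [RCLike.star_def, Complex.conj_mul']
  have hGc : Continuous G := by fun_prop
  have hG0 : ∀ y, 0 ≤ G y := fun y => Finset.sum_nonneg fun x _ => by positivity
  have hGpos : ∀ y ∈ {x | ε ≤ ‖a x‖}, 0 < G y := by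
    intro y hy
    obtain ⟨x, hx, hxy⟩ := Set.mem_iUnion₂.1 (ht hy)
    exact Finset.sum_pos' (fun x _ => by positivity) ⟨x, hx, by
      have : f x y ≠ 0 := hxy
      positivity⟩
  obtain ⟨δ, hδ, hGδ⟩ : ∃ δ > 0, ∀ y ∈ {x | ε ≤ ‖a x‖}, δ ≤ G y := by
    rcases Set.eq_empty_or_nonempty {x | ε ≤ ‖a x‖} with he | he
    · exact ⟨1, one_pos, by simp [he]⟩
    · obtain ⟨y, hy, hmin⟩ := hK.exists_isMinOn he hGc.continuousOn
      exact ⟨G y, hGpos y hy, fun z hz => hmin hz⟩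
  -- The error `η a / (G + η)` is at most `‖a‖` everywhere in absolute value pointwise, which
  -- suffices where `a` is small; where `G ≥ δ`, this choice of `η` makes it at most `ε`.
  let η := δ * ε / (‖a‖ + 1)
  have hη : 0 < η := by positivity
  have hne : ∀ y, ((G y : ℂ) + η) ≠ 0 := fun y => by
    have : 0 < G y + η := add_pos_of_nonneg_of_pos (hG0 y) hη
    exact_mod_cast this.ne'
  let H : C₀(X, ℂ) := ⟨⟨fun y => a y / ((G y : ℂ) + η),
    (map_continuous a).div (by fun_prop) hne⟩, by
      refine ZeroAtInftyContinuousMap.tendsto_zero_of_isCompact fun e he =>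
        ⟨_, a.isCompact_le_norm (mul_pos he hη), fun y hy => ?_⟩
      have h1 : ‖a y‖ < e * η := not_le.1 hy
      have h2 : ‖((G y : ℂ) + η)‖ = G y + η := by
        rw [← Complex.ofReal_add, Complex.norm_real, Real.norm_of_nonneg]
        exact add_nonneg (hG0 y) hη.le
      change ‖a y / ((G y : ℂ) + η)‖ < e
      rw [norm_div, h2, div_lt_iff₀ (by linarith [hG0 y])]
      nlinarith [hG0 y]⟩
  have hval : ∀ y, (a - F * H) y = η * a y / ((G y : ℂ) + η) := by
    intro y
    change a y - F y * (a y / ((G y : ℂ) + η)) = _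
    rw [hFG]
    field_simp [hne y]
    ring
  have hle : ‖a - F * H‖ ≤ ε := by
    refine (ZeroAtInftyContinuousMap.norm_le hε0.le).2 fun y => ?_
    have h2 : ‖((G y : ℂ) + η)‖ = G y + η := by
      rw [← Complex.ofReal_add, Complex.norm_real, Real.norm_of_nonneg]
      exact add_nonneg (hG0 y) hη.le
    rw [hval, norm_div, norm_mul, h2, Complex.norm_real, Real.norm_of_nonneg hη.le,
      div_le_iff₀ (by linarith [hG0 y])]
    by_cases hy : ε ≤ ‖a y‖
    · have h3 := hGδ y hy
      have h4 := a.norm_apply_le y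
      have h5 : η * (‖a‖ + 1) = δ * ε := by
        simp only [η]
        field_simp
      nlinarith
    · push Not at hy
      nlinarith [hG0 y]
  have h1 : χ (a - F * H) = χ a := by rw [map_sub, map_mul, hF, zero_mul, sub_zero]
  have h2 := NonUnitalStarAlgHom.norm_apply_le χ (a - F * H)
  rw [h1] at h2
  have : 0 < ‖χ a‖ := norm_pos_iff.2 ha
  linarith

omit [T2Space X] [LocallyCompactSpace X] in
-- Every element of the kernel vanishes at `x`, in particular `χ a • f - χ f • a`. So `χ` is
-- proportional to evaluation, and multiplicativity, tested on `a * a`, makes the factor one.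
theorem ZeroAtInftyContinuousMap.exists_eval_of_character (χ : C₀(X, ℂ) →⋆ₙₐ[ℂ] ℂ) (hχ : χ ≠ 0) :
    ∃ x, ∀ a, χ a = a x := by
  obtain ⟨a, ha⟩ : ∃ a, χ a ≠ 0 := by
    by_contra h
    push Not at h
    exact hχ (by ext a; exact h a)
  obtain ⟨x, hax, hx⟩ := exists_zero_of_character ha
  have key : ∀ f, f x * χ a = χ f * a x := by
    intro f
    have h1 : χ (χ a • f - χ f • a) = 0 := by simp [mul_comm]
    have h2 := hx _ h1
    simp only [ZeroAtInftyContinuousMap.sub_apply, ZeroAtInftyContinuousMap.smul_apply,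
      smul_eq_mul] at h2
    linear_combination h2
  refine ⟨x, fun f => ?_⟩
  have h3 := key (a * a)
  rw [map_mul, ZeroAtInftyContinuousMap.mul_apply] at h3
  have h4 : a x = χ a := by
    have : (a x * χ a) * (a x - χ a) = 0 := by linear_combination h3
    rcases mul_eq_zero.1 this with h | h
    · exact absurd h (mul_ne_zero hax ha)
    · exact sub_eq_zero.1 h
  have h5 := key f
  rw [h4] at h5
  exact (mul_right_cancel₀ ha h5).symm

/-- The automorphism `a ↦ a ∘ h⁻¹` of `C₀(X)` induced by a homeomorphism `h`. -/
noncomputable def Homeomorph.zeroAtInftyAut {X : Type u} [TopologicalSpace X] (h : X ≃ₜ X) :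
    C₀(X, ℂ) ≃⋆ₐ[ℂ] C₀(X, ℂ) where
  toFun a := a.comp ⟨⟨h.symm, h.symm.continuous⟩, h.symm.isClosedEmbedding.tendsto_cocompact⟩
  invFun a := a.comp ⟨⟨h, h.continuous⟩, h.isClosedEmbedding.tendsto_cocompact⟩
  left_inv a := by ext x; exact congrArg a (h.symm_apply_apply x)
  right_inv a := by ext x; exact congrArg a (h.apply_symm_apply x)
  map_mul' _ _ := rfl
  map_add' _ _ := rfl
  map_star' _ := rfl
  map_smul' _ _ := rfl

theorem Homeomorph.zeroAtInftyAut_apply {X : Type u} [TopologicalSpace X] (h : X ≃ₜ X)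
    (a : C₀(X, ℂ)) (x : X) : h.zeroAtInftyAut a x = a (h.symm x) := rfl

end ZeroAtInfty

theorem NonUnitalStarAlgHom.continuous_complex {A : Type u} {B : Type v} [NonUnitalCStarAlgebra A]
    [NonUnitalCStarAlgebra B] (f : A →⋆ₙₐ[ℂ] B) : Continuous f :=
  AddMonoidHomClass.continuous_of_bound f 1 fun a => by
    rw [one_mul]
    exact NonUnitalStarAlgHom.norm_apply_le f a

/-! ### Density and the universal property of the inductive limit -/

section InductiveLimit

variable {A : ℕ → Type u} [∀ n, NonUnitalCStarAlgebra (A n)]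
variable {B : Type v} [NonUnitalCStarAlgebra B] {C : Type w} [NonUnitalCStarAlgebra C]
variable {ι : ∀ {m n : ℕ}, m ≤ n → A m →⋆ₙₐ[ℂ] A n} {φ : ∀ n, A n →⋆ₙₐ[ℂ] B}

theorem IsCStarInductiveLimit.denseRange (h : IsCStarInductiveLimit ι φ) :
    DenseRange fun p : Σ n, A n => φ p.1 p.2 := by
  have : Set.range (fun p : Σ n, A n => φ p.1 p.2) = ⋃ n, Set.range (φ n) := by
    ext b
    simp
  rw [DenseRange, this]
  exact h.dense

theorem IsCStarInductiveLimit.exists_norm_sub_lt (h : IsCStarInductiveLimit ι φ) (b : B) {ε : ℝ}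
    (hε : 0 < ε) (N : ℕ) : ∃ n ≥ N, ∃ a, ‖b - φ n a‖ < ε := by
  obtain ⟨_, hb, p, rfl⟩ := Metric.dense_iff.1 h.denseRange b ε hε
  refine ⟨max p.1 N, le_max_right _ _, ι (le_max_left _ _) p.2, ?_⟩
  rw [h.compatible, ← dist_eq_norm, dist_comm]
  exact hb

theorem IsCStarInductiveLimit.norm_map (h : IsCStarInductiveLimit ι φ) (n : ℕ) (a : A n) :
    ‖φ n a‖ = ‖a‖ :=
  NonUnitalStarAlgHom.norm_map (φ n) (h.injective n) a

theorem IsCStarInductiveLimit.ext_of_continuous (h : IsCStarInductiveLimit ι φ)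
    {T : Type w} [TopologicalSpace T] [T2Space T] {f g : B → T} (hf : Continuous f)
    (hg : Continuous g) (hfg : ∀ n a, f (φ n a) = g (φ n a)) : f = g :=
  h.denseRange.equalizer hf hg (funext fun p => hfg p.1 p.2)

/-- Two elements of the dense union can be moved to a common stage. There the maps into `B` are
isometric and those into `C` contractive, so the assignment on the union is well defined and extends
by uniform continuity. -/
theorem IsCStarInductiveLimit.exists_lift (h : IsCStarInductiveLimit ι φ)
    (ψ : ∀ n, A n →⋆ₙₐ[ℂ] C) (hψ : ∀ {m n : ℕ} (hmn : m ≤ n) a, ψ n (ι hmn a) = ψ m a) :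
    ∃ Ψ : B →⋆ₙₐ[ℂ] C, ∀ n a, Ψ (φ n a) = ψ n a := by
  let D : Set B := ⋃ n, Set.range (φ n)
  have hD : Dense D := h.dense
  have hmem : ∀ p : D, ∃ n, ∃ a : A n, φ n a = p := fun p => by
    obtain ⟨n, a, ha⟩ := Set.mem_iUnion.1 p.2
    exact ⟨n, a, ha⟩
  choose ν α hα using hmem
  let f : D → C := fun p => ψ (ν p) (α p)
  have hpair : ∀ {m n : ℕ} (a : A m) (b : A n), ∃ k, ∃ a' b' : A k, φ m a = φ k a' ∧
      φ n b = φ k b' ∧ ψ m a = ψ k a' ∧ ψ n b = ψ k b' := fun {m n} a b =>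
    ⟨max m n, ι (le_max_left _ _) a, ι (le_max_right _ _) b, (h.compatible _ _).symm,
      (h.compatible _ _).symm, (hψ _ _).symm, (hψ _ _).symm⟩
  have hdist : ∀ {m n : ℕ} (a : A m) (b : A n), dist (ψ m a) (ψ n b) ≤ dist (φ m a) (φ n b) := by
    intro m n a b
    obtain ⟨k, a', b', h1, h2, h3, h4⟩ := hpair a b
    rw [h1, h2, h3, h4, dist_eq_norm, dist_eq_norm, ← map_sub, ← map_sub, h.norm_map]
    exact NonUnitalStarAlgHom.norm_apply_le _ _
  have hf : UniformContinuous f := by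
    refine (LipschitzWith.of_dist_le_mul (K := 1) fun p q => ?_).uniformContinuous
    rw [NNReal.coe_one, one_mul]
    refine (hdist _ _).trans_eq ?_
    rw [hα, hα]
    rfl
  let Ψ := hD.extend f
  have hΨc : Continuous Ψ := (hD.uniformContinuous_extend hf).continuous
  have hΨφ : ∀ n a, Ψ (φ n a) = ψ n a := by
    intro n a
    have h1 : Ψ (φ n a) = f ⟨φ n a, Set.mem_iUnion.2 ⟨n, a, rfl⟩⟩ :=
      hD.extend_of_ind hf ⟨φ n a, Set.mem_iUnion.2 ⟨n, a, rfl⟩⟩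
    rw [h1]
    refine dist_le_zero.1 ((hdist _ _).trans_eq ?_)
    rw [hα]
    exact dist_self _
  have hd := h.denseRange
  refine ⟨⟨⟨⟨⟨Ψ, ?_⟩, ?_, ?_⟩, ?_⟩, ?_⟩, hΨφ⟩
  · intro z b
    change Ψ (z • b) = z • Ψ b
    induction b using hd.induction_on with
    | hp => exact isClosed_eq (by fun_prop) (by fun_prop)
    | ih p => exact (congrArg Ψ (map_smul (φ p.1) z p.2).symm).trans (by
        rw [hΨφ, map_smul, hΨφ])
  · have := hΨφ 0 0
    rwa [map_zero, map_zero] at this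
  · intro x y
    change Ψ (x + y) = Ψ x + Ψ y
    induction x, y using hd.induction_on₂ with
    | hp => exact isClosed_eq (by fun_prop) (by fun_prop)
    | h p q =>
      obtain ⟨n, a, b, h1, h2, h3, h4⟩ := hpair p.2 q.2
      rw [hΨφ, hΨφ, h1, h2, h3, h4, ← map_add, hΨφ, map_add]
  · intro x y
    change Ψ (x * y) = Ψ x * Ψ y
    induction x, y using hd.induction_on₂ with
    | hp => exact isClosed_eq (by fun_prop) (by fun_prop)
    | h p q =>
      obtain ⟨n, a, b, h1, h2, h3, h4⟩ := hpair p.2 q.2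
      rw [hΨφ, hΨφ, h1, h2, h3, h4, ← map_mul, hΨφ, map_mul]
  · intro b
    change Ψ (star b) = star (Ψ b)
    induction b using hd.induction_on with
    | hp => exact isClosed_eq (by fun_prop) (by fun_prop)
    | ih p => exact (congrArg Ψ (map_star (φ p.1) p.2).symm).trans (by rw [hΨφ, map_star, hΨφ])

end InductiveLimit

/-! ### Elements of the inductive limit as functions on the covering limit -/

namespace FiniteCoveringSequence

section Evaluation

set_option linter.unusedSectionVars false

variable {X : ℕ → Type u} [∀ n, TopologicalSpace (X n)] [∀ n, T2Space (X n)]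
    [∀ n, LocallyCompactSpace (X n)] [∀ n, ConnectedSpace (X n)] [LocallyPathConnectedSpace (X 0)]
    {S : FiniteCoveringSequence X}
    (hS : ∀ x : S.CoveringLimit, ∃ V, S.IsSpecialSet S.proj V ∧ x ∈ V)
    {B : Type v} [NonUnitalCStarAlgebra B] {φ : ∀ n, C₀(X n, ℂ) →⋆ₙₐ[ℂ] B}
    (hφ : IsCStarInductiveLimit S.pullback φ)

/-- Composition with `L → X n`, from `C₀(X n)` to bounded functions on `L`. -/
noncomputable def boundedPullback (hS : ∀ x : S.CoveringLimit, ∃ V, S.IsSpecialSet S.proj V ∧ x ∈ V)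
    (n : ℕ) : C₀(X n, ℂ) →⋆ₙₐ[ℂ] BoundedContinuousFunction S.CoveringLimit ℂ where
  toFun a := a.toBCF.compContinuous ⟨S.proj n, continuous_proj hS n⟩
  map_smul' _ _ := rfl
  map_zero' := rfl
  map_add' _ _ := rfl
  map_mul' _ _ := rfl
  map_star' _ := rfl

include hS hφ in
theorem exists_evalHom : ∃ Ψ : B →⋆ₙₐ[ℂ] BoundedContinuousFunction S.CoveringLimit ℂ,
    ∀ n a, Ψ (φ n a) = boundedPullback hS n a :=
  hφ.exists_lift (boundedPullback hS) fun h a => by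
    ext x
    exact congrArg a (S.proj_comm h x)

/-- Elements of the inductive limit as bounded continuous functions on the covering limit. -/
noncomputable def evalHom : B →⋆ₙₐ[ℂ] BoundedContinuousFunction S.CoveringLimit ℂ :=
  (exists_evalHom hS hφ).choose

@[simp] theorem evalHom_apply (n : ℕ) (a : C₀(X n, ℂ)) (x : S.CoveringLimit) :
    evalHom hS hφ (φ n a) x = a (S.proj n x) := by
  rw [evalHom, (exists_evalHom hS hφ).choose_spec]
  rfl

theorem continuous_evalHom : Continuous (evalHom hS hφ) :=
  (evalHom hS hφ).continuous_complex

theorem continuous_evalHom_apply (x : S.CoveringLimit) :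
    Continuous fun b => evalHom hS hφ b x :=
  (BoundedContinuousFunction.evalCLM ℂ x).continuous.comp (continuous_evalHom hS hφ)

/-- Surjectivity of the projections makes this an isometry on each stage, and the stages are dense.
-/
theorem norm_evalHom (b : B) : ‖evalHom hS hφ b‖ = ‖b‖ := by
  refine congrFun (hφ.ext_of_continuous (f := fun b => ‖evalHom hS hφ b‖) (g := fun b => ‖b‖)
    (continuous_evalHom hS hφ).norm continuous_norm fun n a => ?_) b
  rw [hφ.norm_map]
  refine le_antisymm ?_ ?_
  · exact (NonUnitalStarAlgHom.norm_apply_le _ _).trans_eq (hφ.norm_map n a)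
  · refine (ZeroAtInftyContinuousMap.norm_le (norm_nonneg _)).2 fun z => ?_
    obtain ⟨x, rfl⟩ := S.proj_surjective n z
    rw [← evalHom_apply hS hφ]
    exact BoundedContinuousFunction.norm_coe_le_norm _ x

theorem ext_evalHom {b c : B} (h : ∀ x, evalHom hS hφ b x = evalHom hS hφ c x) : b = c := by
  have h1 : evalHom hS hφ (b - c) = 0 := by
    ext x
    simp [h x]
  rw [← sub_eq_zero, ← norm_eq_zero, ← norm_evalHom hS hφ, h1, norm_zero]

theorem eq_of_evalHom_eq {x y : S.CoveringLimit}
    (h : ∀ b, evalHom hS hφ b x = evalHom hS hφ b y) : x = y :=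
  S.ext_proj fun n => ZeroAtInftyContinuousMap.eq_of_forall_apply_eq fun a => by
    rw [← evalHom_apply hS hφ, ← evalHom_apply hS hφ, h]

/-- A nonzero character is nonzero on some stage, hence on all later ones. There it is an
evaluation, and the resulting points form a coherent chain. -/
theorem exists_point_of_character {χ : B →⋆ₙₐ[ℂ] ℂ} (hχ : χ ≠ 0) :
    ∃ x : S.CoveringLimit, ∀ b, χ b = evalHom hS hφ b x := by
  have hc : Continuous χ := χ.continuous_complex
  obtain ⟨N, a, ha⟩ : ∃ n, ∃ a, χ (φ n a) ≠ 0 := by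
    by_contra h
    push Not at h
    refine hχ (DFunLike.coe_injective (hφ.ext_of_continuous hc continuous_const fun n a => ?_))
    exact h n a
  have hne : ∀ k, χ.comp (φ (N + k)) ≠ 0 := fun k h => ha (by
    rw [← hφ.compatible (Nat.le_add_right N k)]
    exact DFunLike.congr_fun h _)
  choose z hz using fun k => ZeroAtInftyContinuousMap.exists_eval_of_character _ (hne k)
  obtain ⟨x, hx⟩ := S.exists_coherent_of_chain N z fun k =>
    ZeroAtInftyContinuousMap.eq_of_forall_apply_eq fun f => by
      rw [← hz k f]
      have := hz (k + 1) (S.pullback (Nat.le_succ (N + k)) f)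
      change χ (φ (N + k + 1) (S.pullback _ f)) = _ at this
      rw [hφ.compatible] at this
      exact this.symm
  refine ⟨x, fun b => congrFun (hφ.ext_of_continuous hc (continuous_evalHom_apply hS hφ x)
    fun n a => ?_) b⟩
  rw [evalHom_apply, ← hφ.compatible (Nat.le_add_left n N) a]
  have := hz n (S.pullback (Nat.le_add_left n N) a)
  rw [← hx n] at this
  refine this.trans ?_
  exact congrArg a (S.proj_comm _ x)

/-- Evaluation at a point of the covering limit, as a character. -/
noncomputable def evalChar (x : S.CoveringLimit) : Character B :=
  ⟨{ toFun := fun b => evalHom hS hφ b x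
     map_smul' := fun z b => by simp
     map_zero' := by simp
     map_add' := fun b c => by simp
     map_mul' := fun b c => by simp
     map_star' := fun b => by rw [map_star]; rfl }, fun h => by
      obtain ⟨f, hf, -⟩ := ZeroAtInftyContinuousMap.exists_bump_point (x := S.proj 0 x)
        isOpen_univ trivial
      have h1 : evalHom hS hφ (φ 0 f) x = 0 := DFunLike.congr_fun h (φ 0 f)
      rw [evalHom_apply, hf] at h1
      exact one_ne_zero h1⟩

theorem evalChar_apply (x : S.CoveringLimit) (b : B) :
    (evalChar hS hφ x).1 b = evalHom hS hφ b x := rfl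

theorem evalChar_bijective : Function.Bijective (evalChar hS hφ) := by
  refine ⟨fun x y h => eq_of_evalHom_eq hS hφ fun b => ?_, fun χ => ?_⟩
  · rw [← evalChar_apply, h, evalChar_apply]
  · obtain ⟨x, hx⟩ := exists_point_of_character hS hφ χ.2
    exact ⟨x, Subtype.ext (DFunLike.ext _ _ fun b => (hx b).symm)⟩

/-! ### The covering transformation group of the inductive limit -/

/-- Dually, `g` gives a map `T` of points over `X 0`, with `T x = D x • x`. The substance is that `D
x` does not depend on `x`, although the covering limit may be disconnected. -/
theorem exists_towerGroup_eval {g : B ≃⋆ₐ[ℂ] B} (hg : g ∈ coveringGroup φ) :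
    ∃ d : S.towerGroup, ∀ b x, evalHom hS hφ (g b) (d • x) = evalHom hS hφ b x := by
  have hT : ∀ x, ∃ y : S.CoveringLimit, ∀ b, evalHom hS hφ (g b) x = evalHom hS hφ b y := by
    intro x
    obtain ⟨y, hy⟩ := exists_point_of_character hS hφ
      (χ := (evalChar hS hφ x).1.comp (g : B →⋆ₙₐ[ℂ] B)) fun h => by
        refine (evalChar hS hφ x).2 (DFunLike.ext _ _ fun b => ?_)
        have := DFunLike.congr_fun h (g⁻¹ b)
        have h2 : g (g⁻¹ b) = b := g.apply_symm_apply b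
        simpa [h2] using this
    exact ⟨y, hy⟩
  choose T hT using hT
  have hTn : ∀ n a x, evalHom hS hφ (g (φ n a)) x = a (S.proj n (T x)) := fun n a x => by
    rw [hT, evalHom_apply]
  have hT0 : ∀ x, S.proj 0 x = S.proj 0 (T x) := fun x =>
    ZeroAtInftyContinuousMap.eq_of_forall_apply_eq fun a => by
      rw [← hTn, hg a, evalHom_apply]
  choose D hD using fun x => exists_smul_eq (hT0 x)
  have hTc : ∀ n, Continuous fun x => S.proj n (T x) := fun n =>
    ZeroAtInftyContinuousMap.continuous_of_forall_comp fun a => by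
      simp_rw [← hTn]
      exact (evalHom hS hφ (g (φ n a))).continuous
  -- Along a path, `T` and the action of `D (l 0)` give two lifts of the same path of `X 0` with a
  -- common starting point.
  have hpath : ∀ n (l : C(unitInterval, S.CoveringLimit)), (D (l 1)).1 n = (D (l 0)).1 n := by
    intro n l
    refine towerGroup_ext_stage _ _ n (S.proj n (l 1)) ?_
    rw [← proj_smul, hD]
    refine congrFun ((S.isCoveringMap (Nat.zero_le n)).eq_of_comp_eq
      (g₁ := fun t => S.proj n (T (l t))) (g₂ := fun t => (D (l 0)).1 n (S.proj n (l t)))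
      ((hTc n).comp l.continuous)
      (((D (l 0)).1 n).continuous.comp ((continuous_proj hS n).comp l.continuous))
      (funext fun t => ?_) 0 ?_) 1
    · simp only [Function.comp_apply]
      rw [towerGroup_mem_deck, proj_comm, proj_comm, ← hT0]
    · rw [← proj_smul, hD]
  -- Path lifting through `S.proj k` shows that each path component reaches every point of stage
  -- `k`.
  have hleaf : ∀ k (x : S.CoveringLimit) (z : X k), ∃ l : C(unitInterval, S.CoveringLimit),
      l 0 = x ∧ S.proj k (l 1) = z := by
    intro k x z
    have := S.pathConnectedSpace k
    let γ := PathConnectedSpace.somePath (S.proj k x) z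
    obtain ⟨l, hl, hl0⟩ := (isCoveringMap_proj hS k).exists_path_lifts γ.toContinuousMap x
      (by simp)
    refine ⟨l, hl0, ?_⟩
    have := congrFun hl 1
    simpa using this
  have hconst : ∀ n x y, (D x).1 n = (D y).1 n := by
    intro n x y
    refine towerGroup_ext_stage _ _ n (S.proj n y) ?_
    by_contra hne
    obtain ⟨a, ha1, ha0⟩ := ZeroAtInftyContinuousMap.exists_bump_point
      (isOpen_compl_singleton (x := (D y).1 n (S.proj n y))) hne
    -- A function `c` from stage `k` cannot distinguish `l 1` from `y`. Yet it is within `1 / 2` of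
    -- the function `a ∘ S.proj n ∘ T`, whose values there are 1 and 0.
    obtain ⟨k, hk, c, hc⟩ := hφ.exists_norm_sub_lt (g (φ n a)) (ε := 1 / 2) (by norm_num) n
    obtain ⟨l, rfl, hl⟩ := hleaf k x (S.proj k y)
    have hln : S.proj n (l 1) = S.proj n y := by
      rw [← S.proj_comm hk, hl, proj_comm]
    have hest : ∀ w, ‖a (S.proj n (T w)) - c (S.proj k w)‖ < 1 / 2 := by
      intro w
      rw [← hTn, ← evalHom_apply hS hφ]
      refine lt_of_le_of_lt ?_ hc
      rw [← norm_evalHom hS hφ, map_sub]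
      exact BoundedContinuousFunction.norm_coe_le_norm
        (evalHom hS hφ (g (φ n a)) - evalHom hS hφ (φ k c)) w
    have h1 := hest (l 1)
    have h2 := hest y
    have e1 : S.proj n (T (l 1)) = (D (l 0)).1 n (S.proj n y) := by
      rw [← hD, proj_smul, hpath, hln]
    have e2 : S.proj n (T y) = (D y).1 n (S.proj n y) := by rw [← hD y, proj_smul]
    rw [e1, ha1, hl] at h1
    rw [e2, ha0 _ (by simp)] at h2
    have h3 : ‖(1 : ℂ)‖ < 1 / 2 + 1 / 2 := by
      calc ‖(1 : ℂ)‖ = ‖(1 - c (S.proj k y)) - (0 - c (S.proj k y))‖ := by ring_nf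
        _ ≤ _ := norm_sub_le _ _
        _ < _ := add_lt_add h1 h2
    norm_num at h3
  obtain ⟨z⟩ : Nonempty (X 0) := inferInstance
  obtain ⟨x₀, -⟩ := S.proj_surjective 0 z
  -- The inverse appears because `T` describes pullback of functions by `g`.
  refine ⟨(D x₀)⁻¹, fun b x => ?_⟩
  have h1 : D ((D x₀)⁻¹ • x) = D x₀ := Subtype.ext (funext fun n => hconst n _ _)
  have h2 := hD ((D x₀)⁻¹ • x)
  rw [h1, smul_inv_smul] at h2
  rw [hT, ← h2]

theorem exists_lift_towerGroup (d : S.towerGroup) :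
    ∃ Ψ : B →⋆ₙₐ[ℂ] B, ∀ b x, evalHom hS hφ (Ψ b) (d • x) = evalHom hS hφ b x := by
  obtain ⟨Ψ, hΨ⟩ := hφ.exists_lift
    (fun n => (φ n).comp ((d.1 n).zeroAtInftyAut : C₀(X n, ℂ) →⋆ₙₐ[ℂ] C₀(X n, ℂ)))
    fun {m n} h a => by
      refine ext_evalHom hS hφ fun x => ?_
      change evalHom hS hφ (φ n ((d.1 n).zeroAtInftyAut (S.pullback h a))) x =
        evalHom hS hφ (φ m ((d.1 m).zeroAtInftyAut a)) x
      rw [evalHom_apply, evalHom_apply]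
      refine congrArg a ?_
      have h1 := towerGroup_π d⁻¹ h (S.proj n x)
      rw [proj_comm] at h1
      exact h1
  refine ⟨Ψ, fun b x => congrFun (hφ.ext_of_continuous
    ((continuous_evalHom_apply hS hφ (d • x)).comp Ψ.continuous_complex)
    (continuous_evalHom_apply hS hφ x) fun n a => ?_) b⟩
  change evalHom hS hφ (Ψ (φ n a)) (d • x) = _
  rw [hΨ, evalHom_apply]
  change evalHom hS hφ (φ n ((d.1 n).zeroAtInftyAut a)) (d • x) = _
  rw [evalHom_apply, proj_smul, Homeomorph.zeroAtInftyAut_apply, Homeomorph.symm_apply_apply]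

theorem exists_coveringGroup_eval (d : S.towerGroup) :
    ∃ g ∈ coveringGroup φ, ∀ b x, evalHom hS hφ (g b) (d • x) = evalHom hS hφ b x := by
  obtain ⟨Ψ, hΨ⟩ := exists_lift_towerGroup hS hφ d
  obtain ⟨Ψ', hΨ'⟩ := exists_lift_towerGroup hS hφ d⁻¹
  refine ⟨{ toFun := Ψ
            invFun := Ψ'
            left_inv := fun b => ext_evalHom hS hφ fun x => ?_
            right_inv := fun b => ext_evalHom hS hφ fun x => ?_
            map_mul' := map_mul Ψ
            map_add' := map_add Ψ
            map_star' := map_star Ψ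
            map_smul' := map_smul Ψ }, fun a => ext_evalHom hS hφ fun x => ?_, hΨ⟩
  · have := hΨ' (Ψ b) (d • x)
    rwa [inv_smul_smul, hΨ] at this
  · have := hΨ (Ψ' b) (d⁻¹ • x)
    rwa [smul_inv_smul, hΨ'] at this
  · have := hΨ (φ 0 a) (d⁻¹ • x)
    rw [smul_inv_smul, evalHom_apply, proj_zero_smul] at this
    rw [evalHom_apply]
    exact this

/-- The compatible family of covering transformations induced by an element of the covering
transformation group of the inductive limit. -/
noncomputable def galoisFun (g : coveringGroup φ) : S.towerGroup :=
  (exists_towerGroup_eval hS hφ g.2).choose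

theorem evalHom_galoisFun_smul (g : coveringGroup φ) (b : B) (x : S.CoveringLimit) :
    evalHom hS hφ (g.1 b) (galoisFun hS hφ g • x) = evalHom hS hφ b x :=
  (exists_towerGroup_eval hS hφ g.2).choose_spec b x

theorem galoisFun_eq (g : coveringGroup φ) (d : S.towerGroup)
    (h : ∀ b x, evalHom hS hφ (g.1 b) (d • x) = evalHom hS hφ b x) : galoisFun hS hφ g = d := by
  obtain ⟨z⟩ : Nonempty (X 0) := inferInstance
  obtain ⟨x₀, -⟩ := S.proj_surjective 0 z
  refine towerGroup_ext _ _ x₀ (eq_of_evalHom_eq hS hφ fun b => ?_)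
  have h1 : g.1 (g.1⁻¹ b) = b := g.1.apply_symm_apply b
  rw [← h1, h, evalHom_galoisFun_smul]

/-- The covering transformation group of the inductive limit is the group of compatible families of
covering transformations. -/
noncomputable def galoisEquiv : coveringGroup φ ≃* S.towerGroup := by
  refine MulEquiv.ofBijective (MonoidHom.mk' (galoisFun hS hφ) fun g h => ?_)
    ⟨fun g h hgh => ?_, fun d => ?_⟩
  · refine galoisFun_eq hS hφ _ _ fun b x => ?_
    rw [mul_smul]
    exact (evalHom_galoisFun_smul hS hφ g (h.1 b) _).trans (evalHom_galoisFun_smul hS hφ h b x)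
  · refine Subtype.ext (DFunLike.ext _ _ fun b => ext_evalHom hS hφ fun x => ?_)
    have hgh' : galoisFun hS hφ g = galoisFun hS hφ h := hgh
    have h1 := evalHom_galoisFun_smul hS hφ g b ((galoisFun hS hφ g)⁻¹ • x)
    have h2 := evalHom_galoisFun_smul hS hφ h b ((galoisFun hS hφ g)⁻¹ • x)
    rw [smul_inv_smul] at h1
    rw [← hgh', smul_inv_smul] at h2
    rw [h1, h2]
  · obtain ⟨g, hg, hgd⟩ := exists_coveringGroup_eval hS hφ d
    exact ⟨⟨g, hg⟩, galoisFun_eq hS hφ _ _ hgd⟩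

theorem evalHom_galoisEquiv_smul (g : coveringGroup φ) (b : B) (x : S.CoveringLimit) :
    evalHom hS hφ (g.1 b) (galoisEquiv hS hφ g • x) = evalHom hS hφ b x :=
  evalHom_galoisFun_smul hS hφ g b x

theorem evalHom_galois_apply (g : coveringGroup φ) (b : B) (x : S.CoveringLimit) :
    evalHom hS hφ (g.1 b) x = evalHom hS hφ b ((galoisEquiv hS hφ g)⁻¹ • x) := by
  rw [← evalHom_galoisEquiv_smul hS hφ g b, smul_inv_smul]

theorem galois_apply (g : coveringGroup φ) (n : ℕ) (a : C₀(X n, ℂ)) :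
    g.1 (φ n a) = φ n (((galoisEquiv hS hφ g).1 n).zeroAtInftyAut a) := by
  refine ext_evalHom hS hφ fun x => ?_
  rw [evalHom_galois_apply, evalHom_apply, evalHom_apply]
  rfl

theorem galoisEquiv_mem_towerKernel_iff (g : coveringGroup φ) (n : ℕ) :
    galoisEquiv hS hφ g ∈ S.towerKernel n ↔ g ∈ restrictionKernel φ n := by
  rw [mem_towerKernel, Subgroup.mem_subgroupOf]
  constructor
  · intro h a
    have := galois_apply hS hφ g n a
    rw [h] at this
    exact this
  · intro h
    refine Homeomorph.ext fun z => ZeroAtInftyContinuousMap.eq_of_forall_apply_eq fun a => ?_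
    have h1 : g.1 (φ n a) = φ n a := h a
    rw [galois_apply hS hφ] at h1
    have h2 := DFunLike.congr_fun (hφ.injective n h1) (((galoisEquiv hS hφ g).1 n) z)
    rw [Homeomorph.zeroAtInftyAut_apply, Homeomorph.symm_apply_apply] at h2
    exact h2.symm

include hS hφ in
-- An invariant function is constant on the fibres over `X 0` and descends along the quotient map
-- `S.proj 0`.
theorem mem_range_of_invariant {b : B} (hb : ∀ g ∈ coveringGroup φ, g b = b) :
    b ∈ Set.range (φ 0) := by
  have hinv : ∀ (d : S.towerGroup) x, evalHom hS hφ b (d • x) = evalHom hS hφ b x := by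
    intro d x
    obtain ⟨g, hg, hgd⟩ := exists_coveringGroup_eval hS hφ d
    have := hgd b x
    rwa [hb g hg] at this
  choose s hs using S.proj_surjective 0
  have hsx : ∀ x, evalHom hS hφ b (s (S.proj 0 x)) = evalHom hS hφ b x := fun x => by
    obtain ⟨d, hd⟩ := exists_smul_eq (x := x) (y := s (S.proj 0 x)) (hs _).symm
    rw [← hd, hinv]
  have hq : IsQuotientMap (S.proj 0) := (isCoveringMap_proj hS 0).isQuotientMap
    (S.proj_surjective 0)
  let c : C₀(X 0, ℂ) := ⟨⟨fun z => evalHom hS hφ b (s z), by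
      rw [hq.continuous_iff]
      exact (evalHom hS hφ b).continuous.congr fun x => (hsx x).symm⟩, by
    -- Decay survives the descent: `b` is within `ε / 2` of a function from stage `n`, and the
    -- compact set where that function is large has compact image in `X 0`.
    refine ZeroAtInftyContinuousMap.tendsto_zero_of_isCompact fun ε hε => ?_
    obtain ⟨n, -, a, ha⟩ := hφ.exists_norm_sub_lt b (half_pos hε) 0
    refine ⟨_, (a.isCompact_le_norm (half_pos hε)).image
      (S.isCoveringMap (Nat.zero_le n)).continuous, fun z hz => ?_⟩
    have h1 : ‖a (S.proj n (s z))‖ < ε / 2 := by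
      by_contra h
      refine hz ⟨S.proj n (s z), not_lt.1 h, ?_⟩
      rw [proj_comm, hs]
    have h2 : ‖evalHom hS hφ b (s z) - a (S.proj n (s z))‖ < ε / 2 := by
      rw [← evalHom_apply hS hφ]
      refine lt_of_le_of_lt ?_ ha
      rw [← norm_evalHom hS hφ, map_sub]
      exact BoundedContinuousFunction.norm_coe_le_norm
        (evalHom hS hφ b - evalHom hS hφ (φ n a)) (s z)
    change ‖evalHom hS hφ b (s z)‖ < ε
    calc _ = ‖(evalHom hS hφ b (s z) - a (S.proj n (s z))) + a (S.proj n (s z))‖ := by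
          rw [sub_add_cancel]
      _ ≤ _ := norm_add_le _ _
      _ < ε / 2 + ε / 2 := add_lt_add h2 h1
      _ = ε := add_halves ε⟩
  refine ⟨c, ext_evalHom hS hφ fun x => ?_⟩
  rw [evalHom_apply]
  exact hsx x

include hS hφ in
theorem isRegularSequence : IsRegularSequence φ S.deckAut where
  invariants b := ⟨mem_range_of_invariant hS hφ, by
    rintro ⟨a, rfl⟩ g hg
    exact hg a⟩
  restrict n g hg := ⟨_, ⟨(galoisEquiv hS hφ ⟨g, hg⟩).1 n, towerGroup_mem_deck _ _ _, fun a x => by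
      rw [Homeomorph.zeroAtInftyAut_apply, Homeomorph.symm_apply_apply]⟩,
    galois_apply hS hφ ⟨g, hg⟩ n⟩
  surjective n α := by
    rintro ⟨d, hd, hα⟩
    obtain ⟨t, rfl⟩ := exists_towerGroup_stage n hd
    obtain ⟨g, rfl⟩ := (galoisEquiv hS hφ).surjective t
    refine ⟨g.1, g.2, fun a => ?_⟩
    rw [galois_apply hS hφ]
    refine congrArg (φ n) (ZeroAtInftyContinuousMap.ext fun x => ?_)
    obtain ⟨y, rfl⟩ := ((galoisEquiv hS hφ g).1 n).surjective x
    rw [hα, Homeomorph.zeroAtInftyAut_apply, Homeomorph.symm_apply_apply]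

include hS hφ in
theorem atomicRep_injective : Function.Injective (atomicRep (coveringGroup φ)).ρ := by
  rw [injective_iff_map_eq_zero]
  intro b hb
  refine ext_evalHom hS hφ fun x => ?_
  classical
  have h1 := congrArg (fun T : EllTwo (Character B) →L[ℂ] EllTwo (Character B) =>
    (T (lp.single 2 (evalChar hS hφ x) (1 : ℂ))) (evalChar hS hφ x)) hb
  have h2 : (evalChar hS hφ x).1 b * (lp.single 2 (evalChar hS hφ x) (1 : ℂ) :
    EllTwo (Character B)) (evalChar hS hφ x) = 0 := h1
  rw [lp.single_apply_self, mul_one, evalChar_apply] at h2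
  rw [h2, map_zero]
  rfl

end Evaluation

end FiniteCoveringSequence

/-! ### Products, square roots and cut-offs -/

section MulZeroAtInfty

variable {L : Type u} [TopologicalSpace L]

/-- The product of a bounded continuous function and a function vanishing at infinity. -/
noncomputable def BoundedContinuousFunction.mulZeroAtInfty (F : BoundedContinuousFunction L ℂ)
    (f : C₀(L, ℂ)) : C₀(L, ℂ) where
  toFun x := F x * f x
  continuous_toFun := F.continuous.mul (map_continuous f)
  zero_at_infty' := by
    refine squeeze_zero_norm (a := fun x => ‖F‖ * ‖f x‖) (fun x => ?_) ?_
    · rw [norm_mul]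
      exact mul_le_mul_of_nonneg_right (F.norm_coe_le_norm x) (norm_nonneg _)
    · have := (zero_at_infty f).norm.const_mul ‖F‖
      simpa using this

@[simp] theorem BoundedContinuousFunction.mulZeroAtInfty_apply (F : BoundedContinuousFunction L ℂ)
    (f : C₀(L, ℂ)) (x : L) : F.mulZeroAtInfty f x = F x * f x := rfl

theorem BoundedContinuousFunction.norm_mulZeroAtInfty_le (F : BoundedContinuousFunction L ℂ)
    (f : C₀(L, ℂ)) : ‖F.mulZeroAtInfty f‖ ≤ ‖F‖ * ‖f‖ := by
  refine (ZeroAtInftyContinuousMap.norm_le (by positivity)).2 fun x => ?_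
  rw [mulZeroAtInfty_apply, norm_mul]
  exact mul_le_mul (F.norm_coe_le_norm x) (f.norm_apply_le x) (norm_nonneg _) (norm_nonneg _)

/-- Composition of a function vanishing at infinity with a real function fixing the origin. -/
noncomputable def ZeroAtInftyContinuousMap.compReal (f : C₀(L, ℂ)) (θ : ℂ → ℝ) (hθ : Continuous θ)
    (h0 : θ 0 = 0) : C₀(L, ℂ) where
  toFun x := θ (f x)
  continuous_toFun := Complex.continuous_ofReal.comp (hθ.comp (map_continuous f))
  zero_at_infty' := by
    have h1 : Filter.Tendsto (fun z => (θ z : ℂ)) (𝓝 0) (𝓝 0) := by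
      have := (Complex.continuous_ofReal.comp hθ).tendsto 0
      rwa [Function.comp_apply, h0, Complex.ofReal_zero] at this
    exact h1.comp (zero_at_infty f)

@[simp] theorem ZeroAtInftyContinuousMap.compReal_apply (f : C₀(L, ℂ)) (θ : ℂ → ℝ)
    (hθ : Continuous θ) (h0 : θ 0 = 0) (x : L) : f.compReal θ hθ h0 x = θ (f x) := rfl

theorem ZeroAtInftyContinuousMap.tsupport_compReal_subset (f : C₀(L, ℂ)) (θ : ℂ → ℝ)
    (hθ : Continuous θ) (h0 : θ 0 = 0) : tsupport (f.compReal θ hθ h0) ⊆ tsupport f := by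
  refine closure_mono fun x hx hf => hx ?_
  rw [compReal_apply, hf, h0, Complex.ofReal_zero]

theorem ZeroAtInftyContinuousMap.exists_sqrt {f : C₀(L, ℂ)} (hf : ∀ x, ∃ r : ℝ, f x = r ∧ 0 ≤ r) :
    ∃ g : C₀(L, ℂ), star g * g = f := by
  refine ⟨f.compReal (fun z => √z.re) (by fun_prop) (by simp), ?_⟩
  ext x
  obtain ⟨r, hr, hr0⟩ := hf x
  simp only [ZeroAtInftyContinuousMap.mul_apply, ZeroAtInftyContinuousMap.star_apply,
    compReal_apply, RCLike.star_def, Complex.conj_ofReal]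
  rw [hr, Complex.ofReal_re, ← Complex.ofReal_mul, Real.mul_self_sqrt hr0]

theorem ZeroAtInftyContinuousMap.exists_norm_sub_mul_le [T2Space L] [LocallyCompactSpace L]
    (f : C₀(L, ℂ)) {ε : ℝ} (hε : 0 < ε) :
    ∃ e : C₀(L, ℂ), IsCompact (tsupport e) ∧ ‖f - f * e‖ ≤ ε := by
  obtain ⟨e, he, -, he1, her⟩ := exists_bump (f.isCompact_le_norm hε) isOpen_univ
    (Set.subset_univ _)
  refine ⟨e, he, (norm_le hε.le).2 fun x => ?_⟩
  rw [ZeroAtInftyContinuousMap.sub_apply, ZeroAtInftyContinuousMap.mul_apply]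
  by_cases hx : ε ≤ ‖f x‖
  · rw [he1 x hx, mul_one, sub_self, norm_zero]
    exact hε.le
  · obtain ⟨r, hr, hr0, hr1⟩ := her x
    have : f x - f x * e x = f x * ((1 - r : ℝ) : ℂ) := by
      rw [hr]
      push_cast
      ring
    rw [this, norm_mul, Complex.norm_real, Real.norm_of_nonneg (by linarith)]
    push Not at hx
    nlinarith [norm_nonneg (f x)]

end MulZeroAtInfty

/-! ### Operators acting as functions, and strong convergence -/

section Multipliers

variable {L : Type u} [TopologicalSpace L] {H : Type w} [NormedAddCommGroup H]
    [InnerProductSpace ℂ H] [CompleteSpace H]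

/-- The operator `T` acts as the function `F` on the range of `σ`. -/
def ActsAs (σ : C₀(L, ℂ) →⋆ₙₐ[ℂ] (H →L[ℂ] H)) (T : H →L[ℂ] H)
    (F : BoundedContinuousFunction L ℂ) : Prop :=
  ∀ f, T * σ f = σ (F.mulZeroAtInfty f)

variable {σ : C₀(L, ℂ) →⋆ₙₐ[ℂ] (H →L[ℂ] H)}

theorem actsAs_self (f : C₀(L, ℂ)) : ActsAs σ (σ f) f.toBCF := fun h => by
  rw [← map_mul]
  rfl

variable [T2Space L] [LocallyCompactSpace L]
    (hnd : (Submodule.span ℂ {η : H | ∃ f ξ, η = σ f ξ}).topologicalClosure = ⊤)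

include hnd

/-- The uniform bound makes the set of vectors where convergence holds a closed subspace. It
contains the vectors `σ f ξ` with `f` of compact support, which span a dense subspace by
nondegeneracy. -/
theorem tendsto_of_tendsto_mul {ι : Type v} {l : Filter ι} {T : ι → H →L[ℂ] H} {T₀ : H →L[ℂ] H}
    {C : ℝ} (hT : ∀ i, ‖T i‖ ≤ C)
    (h : ∀ f : C₀(L, ℂ), IsCompact (tsupport f) →
      Filter.Tendsto (fun i => T i * σ f) l (𝓝 (T₀ * σ f))) (ξ : H) :
    Filter.Tendsto (fun i => T i ξ) l (𝓝 (T₀ ξ)) := by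
  rcases isEmpty_or_nonempty ι with hι | ⟨⟨i₀⟩⟩
  · rw [Filter.filter_eq_bot_of_isEmpty l]
    exact Filter.tendsto_bot
  have hC : 0 ≤ C := (norm_nonneg _).trans (hT i₀)
  let M : Submodule ℂ H :=
    { carrier := {ξ | Filter.Tendsto (fun i => T i ξ) l (𝓝 (T₀ ξ))}
      add_mem' := fun {ξ η} hξ hη => by
        simpa using Filter.Tendsto.add hξ hη
      zero_mem' := by simpa using tendsto_const_nhds
      smul_mem' := fun c ξ hξ => by
        simpa using Filter.Tendsto.const_smul hξ c }
  have hclosed : IsClosed (M : Set H) := by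
    refine isClosed_of_closure_subset fun ξ hξ => ?_
    change Filter.Tendsto (fun i => T i ξ) l (𝓝 (T₀ ξ))
    rw [Metric.tendsto_nhds]
    intro ε hε
    have hpos : 0 < C + ‖T₀‖ + 1 := by positivity
    obtain ⟨η, hη, hηξ⟩ := Metric.mem_closure_iff.1 hξ (ε / 2 / (C + ‖T₀‖ + 1)) (by positivity)
    have hη' : Filter.Tendsto (fun i => T i η) l (𝓝 (T₀ η)) := hη
    filter_upwards [(Metric.tendsto_nhds.1 hη') (ε / 2) (half_pos hε)] with i hi
    rw [dist_eq_norm] at hi hηξ ⊢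
    have e1 : T i ξ - T₀ ξ = T i (ξ - η) + (T i η - T₀ η) - T₀ (ξ - η) := by
      simp only [map_sub]
      abel
    have e2 : ‖T i (ξ - η)‖ ≤ C * ‖ξ - η‖ :=
      ((T i).le_opNorm _).trans (mul_le_mul_of_nonneg_right (hT i) (norm_nonneg _))
    have e3 := T₀.le_opNorm (ξ - η)
    have e4 : (C + ‖T₀‖ + 1) * ‖ξ - η‖ < ε / 2 := by
      rw [lt_div_iff₀ hpos] at hηξ
      linarith
    rw [e1]
    calc _ ≤ ‖T i (ξ - η) + (T i η - T₀ η)‖ + ‖T₀ (ξ - η)‖ := norm_sub_le _ _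
      _ ≤ ‖T i (ξ - η)‖ + ‖T i η - T₀ η‖ + ‖T₀ (ξ - η)‖ := by gcongr; exact norm_add_le _ _
      _ < ε := by nlinarith [norm_nonneg (ξ - η)]
  have hM : M = ⊤ := by
    rw [← hclosed.submodule_topologicalClosure_eq]
    refine top_unique ?_
    rw [← hnd]
    refine Submodule.topologicalClosure_mono (Submodule.span_le.2 ?_)
    rintro _ ⟨f, η, rfl⟩
    refine hclosed.closure_subset (Metric.mem_closure_iff.2 fun ε hε => ?_)
    obtain ⟨e, he, hfe⟩ := f.exists_norm_sub_mul_le (ε := ε / (‖η‖ + 1)) (by positivity)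
    refine ⟨σ (f * e) η, ?_, ?_⟩
    · have hsupp : IsCompact (tsupport (f * e)) :=
        he.of_isClosed_subset (isClosed_tsupport _) (closure_mono fun x hx hex => hx (by
          rw [ZeroAtInftyContinuousMap.mul_apply, hex, mul_zero]))
      exact ((ContinuousLinearMap.apply ℂ H η).continuous.tendsto _).comp (h _ hsupp)
    · rw [dist_eq_norm, ← sub_apply, ← map_sub]
      calc _ ≤ ‖σ (f - f * e)‖ * ‖η‖ := ContinuousLinearMap.le_opNorm _ _
        _ ≤ ε / (‖η‖ + 1) * ‖η‖ := by
          gcongr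
          exact (NonUnitalStarAlgHom.norm_apply_le _ _).trans hfe
        _ < ε := by
          rw [div_mul_eq_mul_div, div_lt_iff₀ (by positivity)]
          nlinarith [norm_nonneg η]
  have : ξ ∈ M := hM ▸ Submodule.mem_top
  exact this

/-- Multiplied by a compactly supported function, locally uniform convergence becomes norm
convergence. -/
theorem tendsto_of_actsAs {ι : Type v} {l : Filter ι} {T : ι → H →L[ℂ] H} {T₀ : H →L[ℂ] H}
    {C : ℝ} (hT : ∀ i, ‖T i‖ ≤ C) {F : ι → BoundedContinuousFunction L ℂ}
    {F₀ : BoundedContinuousFunction L ℂ} (hF : ∀ i, ActsAs σ (T i) (F i)) (hF₀ : ActsAs σ T₀ F₀)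
    (h : TendstoLocallyUniformly (fun i x => F i x) F₀ l) (ξ : H) :
    Filter.Tendsto (fun i => T i ξ) l (𝓝 (T₀ ξ)) := by
  refine tendsto_of_tendsto_mul hnd hT (fun f hf => ?_) ξ
  simp_rw [hF _ f, hF₀ f]
  refine (σ.continuous_complex.tendsto _).comp ?_
  rw [Metric.tendsto_nhds]
  intro ε hε
  have hu := (tendstoLocallyUniformlyOn_iff_tendstoUniformlyOn_of_compact hf).1
    (h.tendstoLocallyUniformlyOn (s := tsupport f))
  rw [Metric.tendstoUniformlyOn_iff] at hu
  filter_upwards [hu (ε / 2 / (‖f‖ + 1)) (by positivity)] with i hi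
  rw [dist_eq_norm]
  refine lt_of_le_of_lt ((ZeroAtInftyContinuousMap.norm_le (half_pos hε).le).2 fun x => ?_)
    (half_lt_self hε)
  rw [ZeroAtInftyContinuousMap.sub_apply, BoundedContinuousFunction.mulZeroAtInfty_apply,
    BoundedContinuousFunction.mulZeroAtInfty_apply, ← sub_mul, norm_mul]
  by_cases hx : x ∈ tsupport f
  · have h1 := hi x hx
    rw [dist_comm, dist_eq_norm] at h1
    calc _ ≤ ε / 2 / (‖f‖ + 1) * ‖f‖ :=
          mul_le_mul h1.le (f.norm_apply_le x) (norm_nonneg _) (by positivity)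
      _ ≤ ε / 2 := by
        rw [div_mul_eq_mul_div, div_le_iff₀ (by positivity)]
        nlinarith [norm_nonneg f]
  · rw [image_eq_zero_of_notMem_tsupport hx, norm_zero, mul_zero]
    exact (half_pos hε).le

end Multipliers

/-! ### Pointwise bounds from quadratic forms -/

section Rep

variable {L : Type u} [TopologicalSpace L] [T2Space L] [LocallyCompactSpace L]
    {H : Type w} [NormedAddCommGroup H] [InnerProductSpace ℂ H] [CompleteSpace H]
    {σ : C₀(L, ℂ) →⋆ₙₐ[ℂ] (H →L[ℂ] H)} (hσ : Function.Injective σ)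

include hσ

/-- Values of a multiplier are approximate eigenvalues. -/
theorem ActsAs.exists_approx_eigenvector {T : H →L[ℂ] H} {F : BoundedContinuousFunction L ℂ}
    (hTF : ActsAs σ T F) (x : L) {δ : ℝ} (hδ : 0 < δ) :
    ∃ ξ : H, ξ ≠ 0 ∧ ‖T ξ - F x • ξ‖ ≤ δ * ‖ξ‖ := by
  have hW : IsOpen {y | ‖F y - F x‖ < δ} := isOpen_lt (by fun_prop) continuous_const
  obtain ⟨K, hK, hxK, hKW⟩ := exists_compact_subset hW (show x ∈ {y | ‖F y - F x‖ < δ} by simpa)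
  obtain ⟨f, hfx, hf⟩ := ZeroAtInftyContinuousMap.exists_bump_point isOpen_interior hxK
  -- The vector will be `σ f η`. Since `g` is 1 wherever `f` is nonzero, it may be inserted for
  -- free, and it confines `F - F x` to the set where this difference is smaller than `δ`.
  obtain ⟨g, -, hgs, hg1, hgr⟩ := ZeroAtInftyContinuousMap.exists_bump hK hW hKW
  have hσf : σ f ≠ 0 := fun h => by
    have : f = 0 := hσ (by rw [h, map_zero])
    rw [this] at hfx
    exact zero_ne_one hfx
  obtain ⟨η, hη⟩ : ∃ η, σ f η ≠ 0 := by
    by_contra h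
    push Not at h
    exact hσf (ContinuousLinearMap.ext h)
  refine ⟨σ f η, hη, ?_⟩
  have key : T * σ f - F x • σ f = σ (F.mulZeroAtInfty g - F x • g) * σ f := by
    rw [hTF, ← map_smul, ← map_sub, ← map_mul]
    congr 1
    ext y
    simp only [ZeroAtInftyContinuousMap.sub_apply, ZeroAtInftyContinuousMap.mul_apply,
      BoundedContinuousFunction.mulZeroAtInfty_apply, ZeroAtInftyContinuousMap.smul_apply,
      smul_eq_mul]
    by_cases hy : y ∈ K
    · rw [hg1 y hy]
      ring
    · rw [hf y fun h => hy (interior_subset h)]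
      ring
  have h1 : T (σ f η) - F x • σ f η = σ (F.mulZeroAtInfty g - F x • g) (σ f η) :=
    DFunLike.congr_fun key η
  rw [h1]
  refine (ContinuousLinearMap.le_opNorm _ _).trans (mul_le_mul_of_nonneg_right ?_ (norm_nonneg _))
  refine (NonUnitalStarAlgHom.norm_apply_le _ _).trans
    ((ZeroAtInftyContinuousMap.norm_le hδ.le).2 fun y => ?_)
  simp only [ZeroAtInftyContinuousMap.sub_apply, ZeroAtInftyContinuousMap.smul_apply,
    BoundedContinuousFunction.mulZeroAtInfty_apply, smul_eq_mul, ← sub_mul, norm_mul]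
  by_cases hy : y ∈ tsupport g
  · obtain ⟨r, hr, hr0, hr1⟩ := hgr y
    rw [hr, Complex.norm_real, Real.norm_of_nonneg hr0]
    have : ‖F y - F x‖ < δ := hgs hy
    nlinarith [norm_nonneg (F y - F x)]
  · rw [image_eq_zero_of_notMem_tsupport hy, norm_zero, mul_zero]
    exact hδ.le

theorem ActsAs.re_le {T : H →L[ℂ] H} {F : BoundedContinuousFunction L ℂ} (hTF : ActsAs σ T F)
    {ε : ℝ} (h : ∀ ξ, (inner ℂ (T ξ) ξ).re ≤ ε * ‖ξ‖ ^ 2) (x : L) : (F x).re ≤ ε := by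
  refine le_of_forall_pos_le_add fun δ hδ => ?_
  obtain ⟨ξ, hξ, hξδ⟩ := hTF.exists_approx_eigenvector hσ x hδ
  have hpos : 0 < ‖ξ‖ ^ 2 := by positivity
  have h1 : (inner ℂ (F x • ξ) ξ).re = (F x).re * ‖ξ‖ ^ 2 := by
    rw [inner_smul_left, inner_self_eq_norm_sq_to_K]
    have : ((‖ξ‖ : ℂ)) ^ 2 = ((‖ξ‖ ^ 2 : ℝ) : ℂ) := by push_cast; rfl
    simp [this, -Complex.ofReal_pow]
  have h2 : (inner ℂ (T ξ - F x • ξ) ξ).re ≥ -(δ * ‖ξ‖ ^ 2) := by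
    have := (Complex.abs_re_le_norm _).trans (norm_inner_le_norm (𝕜 := ℂ) (T ξ - F x • ξ) ξ)
    have h3 := (abs_le.1 this).1
    nlinarith [norm_nonneg ξ]
  rw [inner_sub_left, Complex.sub_re, h1] at h2
  have h3 := h ξ
  have : (F x).re * ‖ξ‖ ^ 2 ≤ (ε + δ) * ‖ξ‖ ^ 2 := by linarith
  exact le_of_mul_le_mul_right this hpos

end Rep

/-! ### Push-forwards and translates of functions supported in a special set -/

namespace FiniteCoveringSequence

section StageFunctions

set_option linter.unusedSectionVars false

variable {X : ℕ → Type u} [∀ n, TopologicalSpace (X n)] [∀ n, T2Space (X n)]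
    [LocallyPathConnectedSpace (X 0)]
    {S : FiniteCoveringSequence X}
    (hS : ∀ x : S.CoveringLimit, ∃ V, S.IsSpecialSet S.proj V ∧ x ∈ V)

/-- A special set is mapped homeomorphically to each stage. -/
theorem IsSpecialSet.exists_chart {V : Set S.CoveringLimit} (hV : S.IsSpecialSet S.proj V)
    (hS : ∀ x : S.CoveringLimit, ∃ V, S.IsSpecialSet S.proj V ∧ x ∈ V) (n : ℕ) :
    ∃ e : OpenPartialHomeomorph S.CoveringLimit (X n),
      e.source = V ∧ e.target = S.proj n '' V ∧ ⇑e = S.proj n := by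
  have hne : Nonempty S.CoveringLimit := (hV.2 0).2.1.nonempty.of_image.to_subtype.map Subtype.val
  exact ⟨OpenPartialHomeomorph.ofContinuousOpen ((hV.2 n).2.2.toPartialEquiv (S.proj n) V)
    (continuous_proj hS n).continuousOn (isOpenMap_proj hS n) hV.isOpen, rfl, rfl, rfl⟩

/-- The function is transported by the chart of `V` and extended by zero. The image of its support
is compact, hence closed in the Hausdorff stage, so no discontinuity arises at the edge of the
chart. -/
theorem exists_stage_function {V : Set S.CoveringLimit} (hV : S.IsSpecialSet S.proj V)
    (hS : ∀ x : S.CoveringLimit, ∃ V, S.IsSpecialSet S.proj V ∧ x ∈ V)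
    {f : C₀(S.CoveringLimit, ℂ)} (hf : IsCompact (tsupport f)) (hfV : tsupport f ⊆ V) (n : ℕ) :
    ∃ a : C₀(X n, ℂ), (∀ x ∈ V, a (S.proj n x) = f x) ∧
      ∀ z ∉ S.proj n '' tsupport f, a z = 0 := by
  classical
  obtain ⟨e, hes, het, he⟩ := hV.exists_chart hS n
  have hK : IsCompact (S.proj n '' tsupport f) := hf.image (continuous_proj hS n)
  have hKV : S.proj n '' tsupport f ⊆ e.target := by
    rw [het]
    exact Set.image_mono hfV
  let a : X n → ℂ := fun z => if z ∈ e.target then f (e.symm z) else 0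
  have ha0 : ∀ z ∉ S.proj n '' tsupport f, a z = 0 := by
    intro z hz
    by_cases hzt : z ∈ e.target
    · simp only [a, if_pos hzt]
      refine image_eq_zero_of_notMem_tsupport fun h => hz ⟨_, h, ?_⟩
      rw [← he, e.right_inv hzt]
    · simp only [a, if_neg hzt]
  have hac : Continuous a := by
    refine continuous_iff_continuousAt.2 fun z => ?_
    by_cases hz : z ∈ e.target
    · refine ContinuousAt.congr (f := fun z => f (e.symm z))
        ((map_continuous f).continuousAt.comp (e.continuousAt_symm hz)) ?_
      filter_upwards [e.open_target.mem_nhds hz] with y hy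
      simp only [a, if_pos hy]
    · refine ContinuousAt.congr (f := fun _ => 0) continuousAt_const ?_
      filter_upwards [hK.isClosed.isOpen_compl.mem_nhds fun h => hz (hKV h)] with y hy
      exact (ha0 y hy).symm
  refine ⟨.ofHasCompactSupport ⟨a, hac⟩ (HasCompactSupport.intro hK ha0), fun x hx => ?_, ha0⟩
  have hxs : x ∈ e.source := hes ▸ hx
  have h1 : S.proj n x ∈ e.target := by rw [← he]; exact e.map_source hxs
  change a (S.proj n x) = f x
  simp only [a, if_pos h1]
  rw [← he, e.left_inv hxs]

/-- `a` is the push-forward to stage `n` of the function `f` supported in `V`. -/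
def IsStageFunction (V : Set S.CoveringLimit) (f : C₀(S.CoveringLimit, ℂ)) (n : ℕ)
    (a : C₀(X n, ℂ)) : Prop :=
  (∀ x ∈ V, a (S.proj n x) = f x) ∧ ∀ z ∉ S.proj n '' tsupport f, a z = 0

theorem IsStageFunction.norm_le {V : Set S.CoveringLimit} {f : C₀(S.CoveringLimit, ℂ)} {n : ℕ}
    {a : C₀(X n, ℂ)} (ha : IsStageFunction V f n a) (hfV : tsupport f ⊆ V) : ‖a‖ ≤ ‖f‖ := by
  refine (ZeroAtInftyContinuousMap.norm_le (norm_nonneg _)).2 fun z => ?_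
  by_cases hz : z ∈ S.proj n '' tsupport f
  · obtain ⟨x, hx, rfl⟩ := hz
    rw [ha.1 x (hfV hx)]
    exact f.norm_apply_le x
  · rw [ha.2 z hz, norm_zero]
    exact norm_nonneg _

theorem IsStageFunction.mul_self {V : Set S.CoveringLimit} {f : C₀(S.CoveringLimit, ℂ)} {n : ℕ}
    {a : C₀(X n, ℂ)} (ha : IsStageFunction V f n a) (hfV : tsupport f ⊆ V) :
    IsStageFunction V (f * f) n (a * a) := by
  refine ⟨fun x hx => by simp [ha.1 x hx], fun z hz => ?_⟩
  rw [ZeroAtInftyContinuousMap.mul_apply, mul_self_eq_zero]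
  by_contra h
  obtain ⟨x, hx, rfl⟩ : z ∈ S.proj n '' tsupport f := by
    by_contra hc
    exact h (ha.2 z hc)
  rw [ha.1 x (hfV hx)] at h
  refine hz ⟨x, subset_tsupport _ ?_, rfl⟩
  rw [Function.mem_support, ZeroAtInftyContinuousMap.mul_apply]
  exact mul_self_ne_zero.2 h

include hS

/-- The action of a compatible family of covering transformations as a homeomorphism. -/
noncomputable def smulHomeomorph (hS : ∀ x : S.CoveringLimit, ∃ V, S.IsSpecialSet S.proj V ∧ x ∈ V)
    (d : S.towerGroup) : S.CoveringLimit ≃ₜ S.CoveringLimit where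
  toEquiv := MulAction.toPerm d
  continuous_toFun := continuous_smul hS d
  continuous_invFun := continuous_smul hS d⁻¹

/-- The translate `x ↦ f (d⁻¹ x)` of a function on the covering limit. -/
noncomputable def translate
    (hS : ∀ x : S.CoveringLimit, ∃ V, S.IsSpecialSet S.proj V ∧ x ∈ V) (d : S.towerGroup)
    (f : C₀(S.CoveringLimit, ℂ)) : C₀(S.CoveringLimit, ℂ) :=
  (smulHomeomorph hS d).zeroAtInftyAut f

theorem translate_apply (d : S.towerGroup) (f : C₀(S.CoveringLimit, ℂ)) (x : S.CoveringLimit) :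
    translate hS d f x = f (d⁻¹ • x) := rfl

theorem tsupport_translate (d : S.towerGroup) (f : C₀(S.CoveringLimit, ℂ)) :
    tsupport (translate hS d f) = (d • ·) '' tsupport f := by
  have h1 : Function.support (translate hS d f) = (d • ·) '' Function.support f := by
    ext x
    rw [Function.mem_support, translate_apply]
    constructor
    · intro h
      exact ⟨d⁻¹ • x, h, smul_inv_smul d x⟩
    · rintro ⟨y, hy, rfl⟩
      simpa using hy
  rw [tsupport, tsupport, h1]
  exact ((smulHomeomorph hS d).image_closure _).symm

theorem IsStageFunction.translate {V : Set S.CoveringLimit} {f : C₀(S.CoveringLimit, ℂ)} {n : ℕ}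
    {a : C₀(X n, ℂ)} (ha : IsStageFunction V f n a) (d : S.towerGroup) :
    IsStageFunction ((d • ·) '' V) (translate hS d f) n ((d.1 n).zeroAtInftyAut a) := by
  refine ⟨?_, fun z hz => ?_⟩
  · rintro _ ⟨x, hx, rfl⟩
    rw [Homeomorph.zeroAtInftyAut_apply, translate_apply, inv_smul_smul]
    change a ((d.1 n).symm (d.1 n (S.proj n x))) = _
    rw [Homeomorph.symm_apply_apply, ha.1 x hx]
  · rw [Homeomorph.zeroAtInftyAut_apply]
    refine ha.2 _ fun ⟨x, hx, hxz⟩ => hz ⟨d • x, ?_, ?_⟩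
    · rw [tsupport_translate]
      exact ⟨x, hx, rfl⟩
    · rw [proj_smul, hxz, Homeomorph.apply_symm_apply]

/-- The stage functions of `f` converge to `f`. -/
theorem tendstoLocallyUniformly_stage [∀ n, ConnectedSpace (X n)] {V : Set S.CoveringLimit}
    (hV : S.IsSpecialSet S.proj V)
    {f : C₀(S.CoveringLimit, ℂ)} (hf : IsCompact (tsupport f)) (hfV : tsupport f ⊆ V)
    {a : ∀ n, C₀(X n, ℂ)} (ha : ∀ n, IsStageFunction V f n (a n)) :
    TendstoLocallyUniformly (fun n x => a n (S.proj n x)) f Filter.atTop := by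
  intro u hu x
  suffices h : ∃ t ∈ 𝓝 x, ∃ N, ∀ n ≥ N, ∀ y ∈ t, a n (S.proj n y) = f y by
    obtain ⟨t, ht, N, hN⟩ := h
    refine ⟨t, ht, ?_⟩
    filter_upwards [Filter.eventually_ge_atTop N] with n hn y hy
    rw [hN n hn y hy]
    exact refl_mem_uniformity hu
  by_cases hx : x ∈ V
  · exact ⟨V, hV.isOpen.mem_nhds hx, 0, fun n _ y hy => (ha n).1 y hy⟩
  -- If `x` lay over the support at every stage, the points of the support below it would all have
  -- the same image in `X 0`. Injectivity on `V` makes them one point, which is then `x`.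
  obtain ⟨N, hN⟩ : ∃ N, S.proj N x ∉ S.proj N '' tsupport f := by
    by_contra h
    push Not at h
    obtain ⟨y, hy, hyx⟩ := h 0
    refine hx ?_
    have : y = x := S.ext_proj fun n => by
      obtain ⟨y', hy', hyx'⟩ := h n
      have : y' = y := (hV.2 0).2.2 (hfV hy') (hfV hy) (by
        rw [hyx, ← S.proj_comm (Nat.zero_le n), hyx', proj_comm])
      rw [← this, hyx']
    exact this ▸ hfV hy
  refine ⟨S.proj N ⁻¹' (S.proj N '' tsupport f)ᶜ, ((hf.image
    (continuous_proj hS N)).isClosed.isOpen_compl.preimage (continuous_proj hS N)).mem_nhds hN, N,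
    fun n hn y hy => ?_⟩
  have h0 : f y = 0 := image_eq_zero_of_notMem_tsupport fun h => hy ⟨y, h, rfl⟩
  rw [h0]
  refine (ha n).2 _ ?_
  rintro ⟨y', hy', hyy⟩
  exact hy ⟨y', hy', by rw [← S.proj_comm hn, hyy, proj_comm]⟩

variable [∀ n, ConnectedSpace (X n)]

/-- At most one translate of a function supported in a special set is nonzero at a given point. -/
theorem translate_eq_zero_of_ne {V : Set S.CoveringLimit} (hV : S.IsSpecialSet S.proj V)
    {f : C₀(S.CoveringLimit, ℂ)} (hfV : tsupport f ⊆ V) {n : ℕ} {d d' : S.towerGroup}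
    (hd : d ∈ S.towerKernel n) (hd' : d' ∈ S.towerKernel n) (hne : d' ≠ d) {x : S.CoveringLimit}
    (hx : x ∈ (d • ·) '' V) : translate hS d' f x = 0 := by
  by_contra h
  obtain ⟨y, hy, rfl⟩ := hx
  rw [translate_apply] at h
  have h1 : d'⁻¹ • d • y ∈ V := hfV (subset_tsupport _ h)
  have h2 : d'⁻¹ • d • y = y := (hV.2 n).2.2 h1 hy (by
    rw [← mul_smul, proj_smul, mem_towerKernel.1 (mul_mem (inv_mem hd') hd)]
    rfl)
  refine hne (towerGroup_ext d' d y ?_)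
  rw [inv_smul_eq_iff] at h2
  exact h2.symm

theorem norm_sum_translate_le {V : Set S.CoveringLimit} (hV : S.IsSpecialSet S.proj V)
    {f : C₀(S.CoveringLimit, ℂ)} (hfV : tsupport f ⊆ V) (n : ℕ)
    (F : Finset (S.towerKernel n)) : ‖∑ d ∈ F, translate hS d.1 f‖ ≤ ‖f‖ := by
  refine (ZeroAtInftyContinuousMap.norm_le (norm_nonneg _)).2 fun x => ?_
  have hsum : (∑ d ∈ F, translate hS d.1 f) x = ∑ d ∈ F, translate hS d.1 f x :=
    map_sum ({ toFun := fun h => h x, map_zero' := rfl, map_add' := fun _ _ => rfl } :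
      C₀(S.CoveringLimit, ℂ) →+ ℂ) _ _
  rw [hsum]
  by_cases h : ∃ d ∈ F, translate hS d.1 f x ≠ 0
  · obtain ⟨d, hd, hdx⟩ := h
    have hx : x ∈ (d.1 • ·) '' V :=
      ⟨d.1⁻¹ • x, hfV (subset_tsupport _ hdx), smul_inv_smul _ _⟩
    rw [Finset.sum_eq_single_of_mem d hd fun d' _ hne =>
      translate_eq_zero_of_ne hS hV hfV d.2 d'.2 (fun h => hne (Subtype.ext h)) hx]
    exact f.norm_apply_le _
  · push Not at h
    rw [Finset.sum_eq_zero h, norm_zero]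
    exact norm_nonneg _

/-- The partial sums are eventually constant near each point: over `V` exactly one translate
matters, and away from the image of the support all vanish. -/
theorem tendstoLocallyUniformly_sum_translate {V : Set S.CoveringLimit}
    (hV : S.IsSpecialSet S.proj V) {f : C₀(S.CoveringLimit, ℂ)} (hf : IsCompact (tsupport f))
    (hfV : tsupport f ⊆ V) {n : ℕ} {a : C₀(X n, ℂ)} (ha : IsStageFunction V f n a) :
    TendstoLocallyUniformly (fun (F : Finset (S.towerKernel n)) x =>
      (∑ d ∈ F, translate hS d.1 f) x) (fun x => a (S.proj n x)) Filter.atTop := by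
  intro u hu x
  suffices h : ∃ t ∈ 𝓝 x, ∃ F₀ : Finset (S.towerKernel n), ∀ F, F₀ ⊆ F → ∀ y ∈ t,
      (∑ d ∈ F, translate hS d.1 f) y = a (S.proj n y) by
    obtain ⟨t, ht, F₀, hF₀⟩ := h
    refine ⟨t, ht, ?_⟩
    filter_upwards [Filter.eventually_ge_atTop F₀] with F hF y hy
    rw [hF₀ F hF y hy]
    exact refl_mem_uniformity hu
  have hsum : ∀ (F : Finset (S.towerKernel n)) x,
      (∑ d ∈ F, translate hS d.1 f) x = ∑ d ∈ F, translate hS d.1 f x := fun F x =>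
    map_sum ({ toFun := fun h => h x, map_zero' := rfl, map_add' := fun _ _ => rfl } :
      C₀(S.CoveringLimit, ℂ) →+ ℂ) _ _
  have hproj : ∀ (d : S.towerKernel n) y, S.proj n (d.1⁻¹ • y) = S.proj n y := fun d y => by
    rw [proj_smul, mem_towerKernel.1 (inv_mem d.2)]
    rfl
  by_cases hx : S.proj n x ∈ S.proj n '' V
  · obtain ⟨y, hy, hyx⟩ := hx
    obtain ⟨d, hd, rfl⟩ := exists_towerKernel_smul_eq hyx
    refine ⟨(d • ·) '' V, (hV.smul d).1.isOpen.mem_nhds ⟨y, hy, rfl⟩, {⟨d, hd⟩},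
      fun F hF y hy => ?_⟩
    rw [hsum, Finset.sum_eq_single_of_mem ⟨d, hd⟩ (Finset.singleton_subset_iff.1 hF)
      fun d' _ hne => translate_eq_zero_of_ne hS hV hfV hd d'.2
        (fun h => hne (Subtype.ext h)) hy, translate_apply]
    obtain ⟨y, hy, rfl⟩ := hy
    rw [inv_smul_smul, ← ha.1 y hy, ← hproj ⟨d, hd⟩ (d • y), inv_smul_smul]
  · have hx' : S.proj n x ∉ S.proj n '' tsupport f := fun h => hx (Set.image_mono hfV h)
    refine ⟨S.proj n ⁻¹' (S.proj n '' tsupport f)ᶜ, ((hf.image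
      (continuous_proj hS n)).isClosed.isOpen_compl.preimage (continuous_proj hS n)).mem_nhds hx',
      ∅, fun F _ y hy => ?_⟩
    rw [hsum, ha.2 _ hy]
    refine Finset.sum_eq_zero fun d _ => ?_
    rw [translate_apply]
    refine image_eq_zero_of_notMem_tsupport fun h => hy ⟨_, h, hproj d y⟩

end StageFunctions

end FiniteCoveringSequence

theorem BoundedContinuousFunction.continuous_mulZeroAtInfty {L : Type u} [TopologicalSpace L]
    (f : C₀(L, ℂ)) :
    Continuous fun F : BoundedContinuousFunction L ℂ => F.mulZeroAtInfty f :=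
  AddMonoidHomClass.continuous_of_bound
    ({ toFun := fun F => F.mulZeroAtInfty f
       map_zero' := by ext; simp
       map_add' := fun F G => by ext; simp [add_mul] } :
      BoundedContinuousFunction L ℂ →+ C₀(L, ℂ)) ‖f‖ fun F => by
    rw [mul_comm]
    exact F.norm_mulZeroAtInfty_le f

theorem ZeroAtInftyContinuousMap.sum_apply {L : Type u} [TopologicalSpace L] {ι : Type v}
    (F : Finset ι) (f : ι → C₀(L, ℂ)) (x : L) : (∑ i ∈ F, f i) x = ∑ i ∈ F, f i x :=
  map_sum ({ toFun := fun h => h x, map_zero' := rfl, map_add' := fun _ _ => rfl } :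
    C₀(L, ℂ) →+ ℂ) _ _

/-! ### The image of `σ` lies in the noncommutative limit -/

namespace FiniteCoveringSequence

section SpecialOperators

set_option linter.unusedSectionVars false

variable {X : ℕ → Type u} [∀ n, TopologicalSpace (X n)] [∀ n, T2Space (X n)]
    [∀ n, LocallyCompactSpace (X n)] [∀ n, ConnectedSpace (X n)] [LocallyPathConnectedSpace (X 0)]
    {S : FiniteCoveringSequence X}
    (hS : ∀ x : S.CoveringLimit, ∃ V, S.IsSpecialSet S.proj V ∧ x ∈ V)
    {B : Type v} [NonUnitalCStarAlgebra B] {φ : ∀ n, C₀(X n, ℂ) →⋆ₙₐ[ℂ] B}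
    (hφ : IsCStarInductiveLimit S.pullback φ)
    {H : Type w} [NormedAddCommGroup H] [InnerProductSpace ℂ H] [CompleteSpace H]
    {R : CovariantRep (coveringGroup φ) H} {σ : C₀(S.CoveringLimit, ℂ) →⋆ₙₐ[ℂ] (H →L[ℂ] H)}
    (hnd : (Submodule.span ℂ {η : H | ∃ f ξ, η = σ f ξ}).topologicalClosure = ⊤)
    (hσR : ∀ (n : ℕ) (a : C₀(X n, ℂ)) (f f' : C₀(S.CoveringLimit, ℂ)),
      (∀ x, f' x = a (S.proj n x) * f x) → σ f' = R.ρ (φ n a) * σ f)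

include hσR

theorem actsAs_evalHom (b : B) : ActsAs σ (R.ρ b) (evalHom hS hφ b) := fun f =>
  congrFun (hφ.ext_of_continuous (f := fun b => R.ρ b * σ f)
    (g := fun b => σ ((evalHom hS hφ b).mulZeroAtInfty f))
    (R.ρ.continuous_complex.mul continuous_const)
    (σ.continuous_complex.comp ((BoundedContinuousFunction.continuous_mulZeroAtInfty f).comp
      (continuous_evalHom hS hφ)))
    fun n a => (hσR n a f _ fun x => by simp).symm) b

include hS hφ hnd

theorem tendsto_stage {V : Set S.CoveringLimit} (hV : S.IsSpecialSet S.proj V)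
    {f : C₀(S.CoveringLimit, ℂ)} (hf : IsCompact (tsupport f)) (hfV : tsupport f ⊆ V)
    {a : ∀ n, C₀(X n, ℂ)} (ha : ∀ n, IsStageFunction V f n (a n)) (ξ : H) :
    Filter.Tendsto (fun n => R.ρ (φ n (a n)) ξ) Filter.atTop (𝓝 (σ f ξ)) := by
  have := t2Space_coveringLimit hS
  have := locallyCompactSpace_coveringLimit hS
  refine tendsto_of_actsAs hnd (C := ‖f‖) (fun n => ?_)
    (fun n => actsAs_evalHom hS hφ hσR (φ n (a n))) (actsAs_self f) ?_ ξ
  · refine (NonUnitalStarAlgHom.norm_apply_le _ _).trans ?_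
    rw [hφ.norm_map]
    exact (ha n).norm_le hfV
  · simpa only [evalHom_apply] using! tendstoLocallyUniformly_stage hS hV hf hfV ha

/-- Covariance is assumed for `ρ` only. It passes to `σ` because `σ f` is the strong limit of the
operators of its stage functions, and conjugation is compatible with this limit. -/
theorem conj_eq_translate {V : Set S.CoveringLimit} (hV : S.IsSpecialSet S.proj V)
    {f : C₀(S.CoveringLimit, ℂ)} (hf : IsCompact (tsupport f)) (hfV : tsupport f ⊆ V)
    (g : coveringGroup φ) : (R.u g : H →L[ℂ] H) * σ f * star (R.u g : H →L[ℂ] H) =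
      σ (translate hS (galoisEquiv hS hφ g) f) := by
  choose a ha using exists_stage_function hV hS hf hfV
  ext ξ
  set d := galoisEquiv hS hφ g
  have hsupp := tsupport_translate hS d f
  have h1 := tendsto_stage hS hφ hnd hσR (hV.smul d).1 (f := translate hS d f)
    (by rw [hsupp]; exact hf.image (continuous_smul hS d))
    (by rw [hsupp]; exact Set.image_mono hfV)
    (fun n => IsStageFunction.translate hS (ha n) d) ξ
  have h2 := ((R.u g : H →L[ℂ] H).continuous.tendsto _).comp
    (tendsto_stage hS hφ hnd hσR hV hf hfV ha (star (R.u g : H →L[ℂ] H) ξ))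
  refine tendsto_nhds_unique h2 (h1.congr fun n => ?_)
  rw [← galois_apply hS hφ, R.covariant]
  rfl

theorem hasSum_conj {V : Set S.CoveringLimit} (hV : S.IsSpecialSet S.proj V)
    {f : C₀(S.CoveringLimit, ℂ)} (hf : IsCompact (tsupport f)) (hfV : tsupport f ⊆ V)
    {n : ℕ} {a : C₀(X n, ℂ)} (ha : IsStageFunction V f n a) (ξ : H) :
    HasSum (fun g : restrictionKernel φ n =>
      ((R.u g.1 : H →L[ℂ] H) * σ f * star (R.u g.1 : H →L[ℂ] H)) ξ) (R.ρ (φ n a) ξ) := by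
  have := t2Space_coveringLimit hS
  have := locallyCompactSpace_coveringLimit hS
  simp_rw [conj_eq_translate hS hφ hnd hσR hV hf hfV]
  let e : restrictionKernel φ n ≃ S.towerKernel n :=
    (galoisEquiv hS hφ).toEquiv.subtypeEquiv
      fun g => (galoisEquiv_mem_towerKernel_iff hS hφ g n).symm
  refine (e.hasSum_iff (f := fun d : S.towerKernel n => σ (translate hS d.1 f) ξ)).2 ?_
  have h := tendsto_of_actsAs hnd (C := ‖f‖) (l := Filter.atTop)
    (T := fun F : Finset (S.towerKernel n) => σ (∑ d ∈ F, translate hS d.1 f))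
    (fun F => (NonUnitalStarAlgHom.norm_apply_le _ _).trans (norm_sum_translate_le hS hV hfV n F))
    (fun F => actsAs_self _) (actsAs_evalHom hS hφ hσR (φ n a))
    (by
      have h := tendstoLocallyUniformly_sum_translate hS hV hf hfV ha
      rw [show (fun x => a (S.proj n x)) = ⇑(evalHom hS hφ (φ n a)) from
        funext fun x => (evalHom_apply hS hφ n a x).symm] at h
      exact h) ξ
  refine h.congr fun F => ?_
  rw [map_sum, _root_.sum_apply]

/-- Because the translates have disjoint supports, squaring commutes with summation: `b n = a n * a
n`, and the defect is zero at every stage. -/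
theorem isSpecialElement_of_nonneg {V : Set S.CoveringLimit} (hV : S.IsSpecialSet S.proj V)
    {f : C₀(S.CoveringLimit, ℂ)} (hf : IsCompact (tsupport f)) (hfV : tsupport f ⊆ V)
    (hf0 : ∀ x, ∃ r : ℝ, f x = r ∧ 0 ≤ r) : IsSpecialElement φ R (σ f) := by
  choose a ha using exists_stage_function hV hS hf hfV
  have hsub : tsupport (f * f) ⊆ tsupport f := closure_mono fun x hx h => hx (by
    rw [ZeroAtInftyContinuousMap.mul_apply, h, mul_zero])
  refine ⟨?_, a, fun n => a n * a n, fun n ξ => hasSum_conj hS hφ hnd hσR hV hf hfV (ha n) ξ,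
    fun n ξ => ?_, fun ε hε => ⟨0, fun n _ => by simpa using hε⟩⟩
  · obtain ⟨g, rfl⟩ := ZeroAtInftyContinuousMap.exists_sqrt hf0
    rw [map_mul, map_star, ContinuousLinearMap.star_eq_adjoint]
    exact (σ g).isPositive_adjoint_comp_self
  · rw [← map_mul]
    exact hasSum_conj hS hφ hnd hσR hV (hf.of_isClosed_subset (isClosed_tsupport _) hsub)
      (hsub.trans hfV) (IsStageFunction.mul_self (ha n) hfV) ξ

theorem apply_mem_ncInverseLimit_of_special {V : Set S.CoveringLimit}
    (hV : S.IsSpecialSet S.proj V)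
    {f : C₀(S.CoveringLimit, ℂ)} (hf : IsCompact (tsupport f)) (hfV : tsupport f ⊆ V) :
    σ f ∈ ncInverseLimit φ R := by
  have key : ∀ (θ : ℂ → ℝ) (hθ : Continuous θ) (h0 : θ 0 = 0), (∀ z, 0 ≤ θ z) →
      σ (f.compReal θ hθ h0) ∈ ncInverseLimit φ R := by
    intro θ hθ h0 hpos
    have hsub := f.tsupport_compReal_subset θ hθ h0
    exact NonUnitalStarSubalgebra.le_topologicalClosure _
      (NonUnitalStarAlgebra.subset_adjoin ℂ _
        (isSpecialElement_of_nonneg hS hφ hnd hσR hV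
          (hf.of_isClosed_subset (isClosed_tsupport _) hsub) (hsub.trans hfV)
          fun x => ⟨θ (f x), rfl, hpos _⟩))
  -- The positive and negative parts of the real and imaginary parts keep their support inside `V`.
  have h1 := key (fun z => max z.re 0) (by fun_prop) (by simp) fun z => le_max_right _ _
  have h2 := key (fun z => max (-z.re) 0) (by fun_prop) (by simp) fun z => le_max_right _ _
  have h3 := key (fun z => max z.im 0) (by fun_prop) (by simp) fun z => le_max_right _ _
  have h4 := key (fun z => max (-z.im) 0) (by fun_prop) (by simp) fun z => le_max_right _ _
  have h := add_mem (sub_mem h1 h2) (SMulMemClass.smul_mem Complex.I (sub_mem h3 h4))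
  rw [← map_sub, ← map_sub, ← map_smul, ← map_add] at h
  convert h using 2
  ext x
  simp only [ZeroAtInftyContinuousMap.add_apply, ZeroAtInftyContinuousMap.sub_apply,
    ZeroAtInftyContinuousMap.smul_apply, ZeroAtInftyContinuousMap.compReal_apply, smul_eq_mul]
  rw [← Complex.ofReal_sub, ← Complex.ofReal_sub]
  have e : ∀ t : ℝ, max t 0 - max (-t) 0 = t := fun t => by
    rcases le_total 0 t with ht | ht <;> simp [ht]
  rw [e, e, mul_comm, Complex.re_add_im]

/-- A partition of unity reduces compact support to support in special sets; cut-offs and norm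
closedness give the rest. -/
theorem apply_mem_ncInverseLimit (f : C₀(S.CoveringLimit, ℂ)) : σ f ∈ ncInverseLimit φ R := by
  have := t2Space_coveringLimit hS
  have := locallyCompactSpace_coveringLimit hS
  have hc : ∀ f : C₀(S.CoveringLimit, ℂ), IsCompact (tsupport f) → σ f ∈ ncInverseLimit φ R := by
    intro f hf
    choose V hV hxV using hS
    obtain ⟨t, ht⟩ := hf.elim_finite_subcover (fun x => V x) (fun x => (hV x).isOpen)
      fun x _ => Set.mem_iUnion.2 ⟨x, hxV x⟩
    let e := t.equivFin.symm
    obtain ⟨p, hp, hp1, -, hpc⟩ := exists_continuous_sum_one_of_isOpen_isCompact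
      (s := fun i => V (e i)) (fun i => (hV _).isOpen) hf (fun x hx => by
        obtain ⟨y, hy, hxy⟩ := Set.mem_iUnion₂.1 (ht hx)
        exact Set.mem_iUnion.2 ⟨e.symm ⟨y, hy⟩, by simpa using hxy⟩)
    have hs : ∀ i, tsupport (fun x => (p i x : ℂ)) = tsupport (p i) := fun i =>
      congrArg closure (Set.ext fun x => by simp)
    let q : ∀ i, C₀(S.CoveringLimit, ℂ) := fun i => .ofHasCompactSupport
      ⟨fun x => (p i x : ℂ), by fun_prop⟩ (by
        have : IsCompact (tsupport (p i)) := hpc i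
        rw [← hs] at this
        exact this)
    have hsub : ∀ i, tsupport (q i * f) ⊆ tsupport (p i) := fun i => by
      rw [← hs]
      exact closure_mono fun x hx h => hx (by
        rw [ZeroAtInftyContinuousMap.mul_apply]
        exact mul_eq_zero_of_left h _)
    have hsum : f = ∑ i, q i * f := by
      ext x
      rw [ZeroAtInftyContinuousMap.sum_apply]
      simp_rw [ZeroAtInftyContinuousMap.mul_apply]
      rw [← Finset.sum_mul]
      by_cases hx : x ∈ tsupport f
      · have h1 := hp1 hx
        have h2 : ∑ i, q i x = 1 := by
          change ∑ i, (p i x : ℂ) = 1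
          simp only [Finset.sum_apply, Pi.one_apply] at h1
          exact_mod_cast h1
        rw [h2, one_mul]
      · rw [image_eq_zero_of_notMem_tsupport hx, mul_zero]
    rw [hsum, map_sum]
    exact sum_mem fun i _ => apply_mem_ncInverseLimit_of_special (fun x => ⟨V x, hV x, hxV x⟩)
      hφ hnd hσR (hV (e i)) ((hpc i).of_isClosed_subset (isClosed_tsupport _) (hsub i))
      ((hsub i).trans (hp i))
  have hclosed : IsClosed (ncInverseLimit φ R : Set (H →L[ℂ] H)) :=
    NonUnitalStarSubalgebra.isClosed_topologicalClosure _
  refine hclosed.closure_subset (Metric.mem_closure_iff.2 fun ε hε => ?_)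
  obtain ⟨e, he, hfe⟩ := f.exists_norm_sub_mul_le (half_pos hε)
  refine ⟨_, hc (f * e) (he.of_isClosed_subset (isClosed_tsupport _) (closure_mono fun x hx h =>
    hx (by rw [ZeroAtInftyContinuousMap.mul_apply, h, mul_zero]))), ?_⟩
  rw [dist_eq_norm, ← map_sub]
  exact ((NonUnitalStarAlgHom.norm_apply_le _ _).trans hfe).trans_lt (half_lt_self hε)

end SpecialOperators

end FiniteCoveringSequence

/-! ### Limits of decreasing stage functions -/

namespace FiniteCoveringSequence

section LimitFunctions

set_option linter.unusedSectionVars false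

variable {X : ℕ → Type u} [∀ n, TopologicalSpace (X n)] [∀ n, T2Space (X n)]
    [LocallyPathConnectedSpace (X 0)]
    {S : FiniteCoveringSequence X}
    (hS : ∀ x : S.CoveringLimit, ∃ V, S.IsSpecialSet S.proj V ∧ x ∈ V)

theorem IsSpecialSet.isPreconnected {V : Set S.CoveringLimit} (hV : S.IsSpecialSet S.proj V)
    (hS : ∀ x : S.CoveringLimit, ∃ V, S.IsSpecialSet S.proj V ∧ x ∈ V) : IsPreconnected V := by
  obtain ⟨e, hes, het, he⟩ := hV.exists_chart hS 0
  rw [← hes, ← e.symm_image_target_eq_source, het]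
  refine (hV.2 0).2.1.isPreconnected.image _ ?_
  rw [← het]
  exact e.continuousOn_symm

theorem IsSpecialSet.isCompact_inter_preimage {V : Set S.CoveringLimit}
    (hV : S.IsSpecialSet S.proj V)
    (hS : ∀ x : S.CoveringLimit, ∃ V, S.IsSpecialSet S.proj V ∧ x ∈ V) {n : ℕ} {C : Set (X n)}
    (hC : IsCompact C) (hCV : C ⊆ S.proj n '' V) : IsCompact (V ∩ S.proj n ⁻¹' C) := by
  obtain ⟨e, hes, het, he⟩ := hV.exists_chart hS n
  rw [← he, ← hes, ← e.symm_image_eq_source_inter_preimage (het ▸ hCV)]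
  exact hC.image_of_continuousOn (e.continuousOn_symm.mono (het ▸ hCV))

/-- A decreasing sequence of functions on the stages with limit `α` which is almost attained
where `α` does not vanish, and whose limit separates the sheets. -/
structure IsDecreasingSystem (S : FiniteCoveringSequence X) (r : ∀ n, X n → ℝ) (ε : ℕ → ℝ)
    (α : S.CoveringLimit → ℝ) : Prop where
  continuous : ∀ n, Continuous (r n)
  isCompact : ∀ n δ, 0 < δ → IsCompact {z | δ ≤ r n z}
  nonneg : ∀ n z, 0 ≤ r n z
  anti : ∀ x, Antitone fun n => r n (S.proj n x)
  tendsto : ∀ x, Filter.Tendsto (fun n => r n (S.proj n x)) Filter.atTop (𝓝 (α x))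
  tendsto_zero : Filter.Tendsto ε Filter.atTop (𝓝 0)
  mul_sub_le : ∀ n k, n ≤ k → ∀ x,
    2 * r k (S.proj k x) * (r n (S.proj n x) - r k (S.proj k x)) ≤ ε n
  add_le : ∀ n x y, x ≠ y → S.proj n x = S.proj n y → α x + α y ≤ r n (S.proj n x)

namespace IsDecreasingSystem

variable {r : ∀ n, X n → ℝ} {ε : ℕ → ℝ} {α : S.CoveringLimit → ℝ}
    (h : IsDecreasingSystem S r ε α)

include h

theorem limit_le (n : ℕ) (x : S.CoveringLimit) : α x ≤ r n (S.proj n x) :=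
  (h.anti x).le_of_tendsto (h.tendsto x) n

theorem limit_nonneg (x : S.CoveringLimit) : 0 ≤ α x :=
  ge_of_tendsto' (h.tendsto x) fun _ => h.nonneg _ _

theorem limit_mul_sub_le (n : ℕ) (x : S.CoveringLimit) :
    2 * α x * (r n (S.proj n x) - α x) ≤ ε n := by
  refine le_of_tendsto (((h.tendsto x).const_mul 2).mul ((h.tendsto x).const_sub _)) ?_
  filter_upwards [Filter.eventually_ge_atTop n] with k hk
  exact h.mul_sub_le n k hk x

include hS

/-- Where `r n > δ`, the bound on `2 r_k (r_n - r_k)` forbids the value `r_k = r_n / 2`, since it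
would give `r_n ^ 2 / 2 ≤ ε n < δ ^ 2 / 2`. A connected set that starts above this gap stays above
it, and there the same bound controls `r_n - r_k`. -/
theorem sub_le_of_isPreconnected {W : Set S.CoveringLimit} (hW : IsPreconnected W) {n : ℕ} {δ : ℝ}
    (hδ : 0 < δ) (hr : ∀ y ∈ W, δ < r n (S.proj n y)) (hε : 2 * ε n < δ ^ 2)
    {x : S.CoveringLimit} (hx : x ∈ W) (hxα : r n (S.proj n x) < 2 * α x)
    {y : S.CoveringLimit} (hy : y ∈ W) : r n (S.proj n y) - α y ≤ ε n / δ := by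
  have hcont : ∀ k, Continuous fun x => r k (S.proj k x) := fun k =>
    (h.continuous k).comp (continuous_proj hS k)
  refine le_of_tendsto ((h.tendsto y).const_sub _) ?_
  filter_upwards [Filter.eventually_ge_atTop n] with k hk
  have h1 : r n (S.proj n y) < 2 * r k (S.proj k y) := by
    by_contra hc
    push Not at hc
    obtain ⟨z, hz, hzk⟩ := hW.intermediate_value₂ hx hy (hcont n).continuousOn
      ((hcont k).const_mul 2).continuousOn
      (hxα.le.trans (mul_le_mul_of_nonneg_left (h.limit_le k x) zero_le_two)) hc
    have h2 := h.mul_sub_le n k hk z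
    have h3 := hr z hz
    have h4 : r k (S.proj k z) = r n (S.proj n z) / 2 := by linarith
    rw [h4] at h2
    nlinarith
  have h2 := h.mul_sub_le n k hk y
  have h3 := hr y hy
  have h4 := h.anti y hk
  simp only at h4
  rw [le_div_iff₀ hδ]
  nlinarith [mul_le_mul_of_nonneg_right h1.le (sub_nonneg.2 h4),
    mul_le_mul_of_nonneg_right h3.le (sub_nonneg.2 h4)]

theorem tendstoLocallyUniformly :
    TendstoLocallyUniformly (fun n x => r n (S.proj n x)) α Filter.atTop := by
  have := locallyPathConnectedSpace_coveringLimit hS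
  have hcont : ∀ k, Continuous fun x => r k (S.proj k x) := fun k =>
    (h.continuous k).comp (continuous_proj hS k)
  rw [Metric.tendstoLocallyUniformly_iff]
  intro η hη x
  suffices hsuff : ∃ t ∈ 𝓝 x, ∃ N, ∀ y ∈ t, r N (S.proj N y) - α y < η by
    obtain ⟨t, ht, N, hN⟩ := hsuff
    refine ⟨t, ht, ?_⟩
    filter_upwards [Filter.eventually_ge_atTop N] with n hn y hy
    rw [dist_comm, Real.dist_eq, abs_of_nonneg (sub_nonneg.2 (h.limit_le n y))]
    have := h.anti y hn
    exact (sub_le_sub_right this _).trans_lt (hN y hy)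
  -- If `α x < η`, one stage below `η` near `x` suffices, as `α ≥ 0`. Otherwise the gap is used on a
  -- connected neighbourhood with `r n > η / 2`; the constant `η ^ 2 / 8` is `(η / 2) ^ 2 / 2`.
  rcases lt_or_ge (α x) η with hx | hx
  · obtain ⟨N, hN⟩ := ((h.tendsto x).eventually_lt_const hx).exists
    refine ⟨_, (isOpen_lt (hcont N) continuous_const).mem_nhds hN, N, fun y hy => ?_⟩
    have : r N (S.proj N y) < η := hy
    linarith [h.limit_nonneg y]
  · obtain ⟨n, hn, hnε⟩ := (((h.tendsto x).eventually_lt_const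
      (show α x < 2 * α x by linarith)).and
      (h.tendsto_zero.eventually_lt_const (show 0 < η ^ 2 / 8 by positivity))).exists
    have hopen : IsOpen {y | η / 2 < r n (S.proj n y)} := isOpen_lt continuous_const (hcont n)
    have hxm : x ∈ {y | η / 2 < r n (S.proj n y)} := by
      have := h.limit_le n x
      change η / 2 < r n (S.proj n x)
      linarith
    have hsub := connectedComponentIn_subset {y | η / 2 < r n (S.proj n y)} x
    refine ⟨_, hopen.connectedComponentIn.mem_nhds (mem_connectedComponentIn hxm), n,
      fun y hy => ?_⟩
    refine (h.sub_le_of_isPreconnected hS isPreconnected_connectedComponentIn (half_pos hη)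
      (fun z hz => hsub hz) (by nlinarith)
      (mem_connectedComponentIn hxm) hn hy).trans_lt ?_
    rw [div_lt_iff₀ (half_pos hη)]
    nlinarith

variable [∀ n, ConnectedSpace (X n)] [∀ n, LocallyCompactSpace (X n)]

/-- Properness holds only at the stages, whose fibres in the limit may be infinite. For large `n`,
however, at most one sheet over a small set carries values `α ≥ δ`, so the set `{δ ≤ α}` is locally
over `X n` contained in a compact piece of a single sheet. -/
theorem exists_isCompact {δ : ℝ} (hδ : 0 < δ) : ∃ K, IsCompact K ∧ ∀ x ∉ K, α x < δ := by
  obtain ⟨n, hn⟩ := (h.tendsto_zero.eventually_lt_const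
    (show 0 < δ ^ 2 / 8 by positivity)).exists
  suffices hsuff : ∃ Q, IsCompact Q ∧ ∀ x, S.proj n x ∈ {z | δ ≤ r n z} → δ ≤ α x → x ∈ Q by
    obtain ⟨Q, hQ, hQx⟩ := hsuff
    refine ⟨Q, hQ, fun x hx => ?_⟩
    by_contra hc
    push Not at hc
    exact hx (hQx x (hc.trans (h.limit_le n x)) hc)
  refine (h.isCompact n δ hδ).induction_on
    (p := fun s => ∃ Q, IsCompact Q ∧ ∀ x, S.proj n x ∈ s → δ ≤ α x → x ∈ Q)
    ⟨∅, isCompact_empty, fun _ h => h.elim⟩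
    (fun s t hst ⟨Q, hQ, hQx⟩ => ⟨Q, hQ, fun x hx => hQx x (hst hx)⟩)
    (fun s t ⟨Q, hQ, hQx⟩ ⟨Q', hQ', hQx'⟩ => ⟨Q ∪ Q', hQ.union hQ', fun x hx hxδ =>
      hx.elim (fun hx => .inl (hQx x hx hxδ)) fun hx => .inr (hQx' x hx hxδ)⟩) fun z hz => ?_
  obtain ⟨x, rfl⟩ := S.proj_surjective n z
  have hopen : IsOpen {y | δ / 2 < r n (S.proj n y)} :=
    isOpen_lt continuous_const ((h.continuous n).comp (continuous_proj hS n))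
  obtain ⟨V, hV, hxV, hVr⟩ := (isTopologicalBasis_special hS).exists_subset_of_mem_open
    (show x ∈ {y | δ / 2 < r n (S.proj n y)} by
      have : δ ≤ r n (S.proj n x) := hz
      change δ / 2 < r n (S.proj n x)
      linarith) hopen
  have hV : S.IsSpecialSet S.proj V := hV
  have hxn : S.proj n x ∈ S.proj n '' V := ⟨x, hxV, rfl⟩
  -- If some point over the image of `V` has `α ≥ δ`, the translate of `V` through it is the
  -- distinguished sheet.
  by_cases hex : ∃ y, S.proj n y ∈ S.proj n '' V ∧ δ ≤ α y
  · obtain ⟨y, ⟨v, hv, hvy⟩, hyδ⟩ := hex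
    obtain ⟨d, hd, rfl⟩ := exists_towerKernel_smul_eq hvy
    have hproj : ∀ z, S.proj n (d • z) = S.proj n z := fun z => by
      rw [proj_smul, mem_towerKernel.1 hd]
      rfl
    have himg : S.proj n '' ((d • ·) '' V) = S.proj n '' V := by
      rw [Set.image_image]
      simp_rw [hproj]
    have hV' := (hV.smul d).1
    obtain ⟨C, hC, hxC, hCV⟩ := exists_compact_subset (hV.2 n).1 hxn
    refine ⟨C, mem_nhdsWithin_of_mem_nhds (mem_interior_iff_mem_nhds.1 hxC), _,
      hV'.isCompact_inter_preimage hS hC (by rwa [himg]), fun w hw hwδ => ⟨?_, hw⟩⟩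
    obtain ⟨w', hw', hww⟩ := hCV hw
    have hww' : S.proj n (d • w') = S.proj n w := by rw [hproj, hww]
    have hsub : r n (S.proj n (d • w')) - α (d • w') ≤ ε n / (δ / 2) := by
      refine h.sub_le_of_isPreconnected hS (hV'.isPreconnected hS) (half_pos hδ) ?_
        (by nlinarith) (x := d • v) ⟨v, hv, rfl⟩ ?_ ⟨w', hw', rfl⟩
      · rintro _ ⟨z, hz, rfl⟩
        simp only
        rw [hproj]
        exact hVr hz
      · have h1 := h.limit_mul_sub_le n (d • v)
        nlinarith
    -- On the distinguished sheet `α` nearly exhausts `r n`, so by `add_le` a second point over the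
    -- same point of `X n` has too small a value.
    by_contra hne
    have h1 := h.add_le n (d • w') w (fun he => hne ⟨w', hw', he⟩) hww'
    rw [le_div_iff₀ (half_pos hδ)] at hsub
    nlinarith
  · push Not at hex
    exact ⟨_, mem_nhdsWithin_of_mem_nhds ((hV.2 n).1.mem_nhds hxn), ∅, isCompact_empty,
      fun w hw hwδ => absurd hwδ (not_le.2 (hex w hw))⟩

theorem exists_zeroAtInfty : ∃ f : C₀(S.CoveringLimit, ℂ), (∀ x, f x = α x) ∧
    TendstoLocallyUniformly (fun n x => (r n (S.proj n x) : ℂ)) f Filter.atTop := by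
  have hc : Continuous α := (h.tendstoLocallyUniformly hS).continuous (.of_forall fun n =>
    (h.continuous n).comp (continuous_proj hS n))
  refine ⟨⟨⟨fun x => (α x : ℂ), by fun_prop⟩, ?_⟩, fun x => rfl, ?_⟩
  · refine ZeroAtInftyContinuousMap.tendsto_zero_of_isCompact fun δ hδ => ?_
    obtain ⟨K, hK, hKα⟩ := h.exists_isCompact hS hδ
    refine ⟨K, hK, fun x hx => ?_⟩
    change ‖(α x : ℂ)‖ < δ
    rw [Complex.norm_real, Real.norm_of_nonneg (h.limit_nonneg x)]
    exact hKα x hx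
  · have h1 := h.tendstoLocallyUniformly hS
    rw [Metric.tendstoLocallyUniformly_iff] at h1 ⊢
    intro η hη x
    obtain ⟨t, ht, hN⟩ := h1 η hη x
    refine ⟨t, ht, hN.mono fun n hn y hy => ?_⟩
    change dist (α y : ℂ) _ < η
    rw [Complex.dist_eq, ← Complex.ofReal_sub, Complex.norm_real]
    exact hn y hy

end IsDecreasingSystem

end LimitFunctions

end FiniteCoveringSequence

/-! ### Sums of vectors with nonnegative inner products -/

section Summation

/-- Partial sums of a summable family over sets decreasing to a point converge to the term at this
point. -/
theorem tendsto_of_hasSum_indicator {ι : Type v} {E : Type w} [NormedAddCommGroup E]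
    {f : ι → E} (hf : Summable f) {s : ℕ → Set ι} (hs : Antitone s) {i₀ : ι}
    (hi₀ : ∀ n, i₀ ∈ s n) (hi : ∀ i ≠ i₀, ∃ n, i ∉ s n) {A : ℕ → E}
    (hA : ∀ n, HasSum ((s n).indicator f) (A n)) :
    Filter.Tendsto A Filter.atTop (𝓝 (f i₀)) := by
  classical
  rw [Metric.tendsto_atTop]
  intro ε hε
  obtain ⟨F, hF⟩ := hf.vanishing (Metric.ball_mem_nhds (0 : E) (half_pos hε))
  choose! N hN using hi
  -- From this index on, `s n` contains no element of `F` except possibly `i₀`, so what remains of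
  -- the sum lies in the small tail.
  refine ⟨F.sup N, fun n hn => ?_⟩
  have h1 : HasSum (fun i => (s n \ {i₀}).indicator f i) (A n - f i₀) := by
    have h2 := (hA n).sub (hasSum_pi_single i₀ (f i₀))
    refine h2.congr_fun fun i => ?_
    by_cases hii : i = i₀
    · subst hii
      simp [hi₀ n]
    · by_cases his : i ∈ s n <;> simp [hii, his]
  rw [dist_eq_norm]
  refine lt_of_le_of_lt (le_of_tendsto h1.norm (.of_forall fun t => ?_)) (half_lt_self hε)
  rw [← Finset.sum_filter_add_sum_filter_not t (· ∈ s n \ {i₀})]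
  rw [Finset.sum_congr rfl fun i hi => Set.indicator_of_mem (Finset.mem_filter.1 hi).2 f,
    Finset.sum_congr (s₁ := t.filter (· ∉ s n \ {i₀})) rfl
      fun i hi => Set.indicator_of_notMem (Finset.mem_filter.1 hi).2 f,
    Finset.sum_const_zero, add_zero]
  refine (mem_ball_zero_iff.1 (hF _ (Finset.disjoint_left.2 fun i hi hiF => ?_))).le
  obtain ⟨-, his, hii⟩ := Finset.mem_filter.1 hi
  exact hN i hii (hs ((Finset.le_sup hiF).trans hn) his)

theorem add_le_of_hasSum_indicator {ι : Type v} {f : ι → ℝ} (hf : ∀ i, 0 ≤ f i) {s t u : Set ι}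
    (hs : s ⊆ u) (ht : t ⊆ u) (hst : Disjoint s t) {p q r : ℝ} (hp : HasSum (s.indicator f) p)
    (hq : HasSum (t.indicator f) q) (hr : HasSum (u.indicator f) r) : p + q ≤ r := by
  refine hasSum_le (fun i => ?_) (hp.add hq) hr
  by_cases h1 : i ∈ s
  · simp [h1, Set.disjoint_left.1 hst h1, hs h1]
  · by_cases h2 : i ∈ t
    · simp [h1, h2, ht h2]
    · simp only [Set.indicator_of_notMem h1, Set.indicator_of_notMem h2, add_zero]
      exact Set.indicator_nonneg (fun i _ => hf i) i

theorem hasSum_re_inner {ι : Type v} {H : Type w} [NormedAddCommGroup H] [InnerProductSpace ℂ H]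
    {f : ι → H} {s : Set ι} {A : H} (h : HasSum (s.indicator f) A) (ξ : H) :
    HasSum (s.indicator fun i => (inner ℂ (f i) ξ).re) (inner ℂ A ξ).re := by
  have h1 := h.map ({ toFun := fun v => (inner ℂ v ξ).re
                      map_zero' := by simp
                      map_add' := fun v w => by simp } : H →+ ℝ)
    (Complex.continuous_re.comp (continuous_id.inner continuous_const))
  refine h1.congr_fun fun i => ?_
  by_cases hi : i ∈ s <;> simp [hi]

theorem sum_norm_sq_le {ι : Type v} {H : Type w} [NormedAddCommGroup H] [InnerProductSpace ℂ H]
    {f : ι → H} (hf : ∀ i j, 0 ≤ (inner ℂ (f i) (f j)).re) (t : Finset ι) :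
    ∑ i ∈ t, ‖f i‖ ^ 2 ≤ ‖∑ i ∈ t, f i‖ ^ 2 := by
  classical
  induction t using Finset.induction_on with
  | empty => simp
  | insert i t hi ih =>
    rw [Finset.sum_insert hi, Finset.sum_insert hi, norm_add_sq (𝕜 := ℂ)]
    have : 0 ≤ (inner ℂ (f i) (∑ j ∈ t, f j)).re := by
      rw [inner_sum, Complex.re_sum]
      exact Finset.sum_nonneg fun j _ => hf i j
    simp only [RCLike.re_to_complex]
    linarith

/-- A family of vectors with pairwise nonnegative inner products splits with a defect bounded by
the defect of the Pythagorean identity. -/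
theorem two_mul_re_inner_le {ι : Type v} {H : Type w} [NormedAddCommGroup H]
    [InnerProductSpace ℂ H] {f : ι → H} (hf : ∀ i j, 0 ≤ (inner ℂ (f i) (f j)).re)
    {s u : Set ι} (hsu : s ⊆ u) {A A' : H} {β : ℝ} (hA : HasSum (u.indicator f) A)
    (hA' : HasSum (s.indicator f) A')
    (hβ : HasSum (u.indicator fun i => ‖f i‖ ^ 2) β) :
    2 * (inner ℂ A' (A - A')).re ≤ ‖A‖ ^ 2 - β := by
  classical
  have hd : HasSum ((u \ s).indicator f) (A - A') := by
    refine (hA.sub hA').congr_fun fun i => ?_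
    by_cases hi : i ∈ s
    · simp [hi, hsu hi]
    · by_cases hi' : i ∈ u <;> simp [hi, hi']
  have hind : ∀ v : Set ι, ∀ i j, 0 ≤ (inner ℂ (v.indicator f i) (v.indicator f j)).re := by
    intro v i j
    by_cases hi : i ∈ v <;> by_cases hj : j ∈ v <;> simp [hi, hj, hf]
  have tA : Filter.Tendsto (fun t => ∑ i ∈ t, u.indicator f i) Filter.atTop (𝓝 A) := hA
  have tA' : Filter.Tendsto (fun t => ∑ i ∈ t, s.indicator f i) Filter.atTop (𝓝 A') := hA'
  have td : Filter.Tendsto (fun t => ∑ i ∈ t, (u \ s).indicator f i) Filter.atTop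
    (𝓝 (A - A')) := hd
  have tβ : Filter.Tendsto (fun t => ∑ i ∈ t, u.indicator (fun i => ‖f i‖ ^ 2) i) Filter.atTop
    (𝓝 β) := hβ
  -- For finite sums, `‖A‖ ^ 2` expands along the splitting into `s` and its complement in `u`; the
  -- two squared norms dominate the diagonal sum `β`, leaving the cross term.
  refine le_of_tendsto_of_tendsto' (((Complex.continuous_re.tendsto _).comp
    (tA'.inner (𝕜 := ℂ) td)).const_mul 2) ((tA.norm.pow 2).sub tβ) fun t => ?_
  have h1 := sum_norm_sq_le (hind s) t
  have h2 := sum_norm_sq_le (hind (u \ s)) t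
  have h3 : ∑ i ∈ t, u.indicator f i =
      ∑ i ∈ t, s.indicator f i + ∑ i ∈ t, (u \ s).indicator f i := by
    rw [← Finset.sum_add_distrib]
    refine Finset.sum_congr rfl fun i _ => ?_
    by_cases hi : i ∈ s
    · simp [hi, hsu hi]
    · by_cases hi' : i ∈ u <;> simp [hi, hi']
  have h4 : ∑ i ∈ t, u.indicator (fun i => ‖f i‖ ^ 2) i =
      ∑ i ∈ t, ‖s.indicator f i‖ ^ 2 + ∑ i ∈ t, ‖(u \ s).indicator f i‖ ^ 2 := by
    rw [← Finset.sum_add_distrib]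
    refine Finset.sum_congr rfl fun i _ => ?_
    by_cases hi : i ∈ s
    · simp [hi, hsu hi]
    · by_cases hi' : i ∈ u <;> simp [hi, hi']
  rw [h3, h4, norm_add_sq (𝕜 := ℂ)]
  simp only [Function.comp_apply, RCLike.re_to_complex]
  linarith

end Summation

/-! ### The action of the group on operators -/

section Conjugation

variable {B : Type v} [NonUnitalCStarAlgebra B] {G : Subgroup (B ≃⋆ₐ[ℂ] B)}
    {H : Type w} [NormedAddCommGroup H] [InnerProductSpace ℂ H] [CompleteSpace H]
    (R : CovariantRep G H)

/-- The action of the group on operators. -/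
noncomputable def CovariantRep.conj (g : G) (T : H →L[ℂ] H) : H →L[ℂ] H :=
  (R.u g : H →L[ℂ] H) * T * star (R.u g : H →L[ℂ] H)

theorem CovariantRep.conj_one (T : H →L[ℂ] H) : R.conj 1 T = T := by
  simp [conj]

theorem CovariantRep.conj_mul (g h : G) (T : H →L[ℂ] H) :
    R.conj (g * h) T = R.conj g (R.conj h T) := by
  simp [conj, mul_assoc]

theorem CovariantRep.conj_mul_conj (g : G) (T T' : H →L[ℂ] H) :
    R.conj g T * R.conj g T' = R.conj g (T * T') := by
  have h : star (R.u g : H →L[ℂ] H) * (R.u g : H →L[ℂ] H) = 1 :=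
    Unitary.star_mul_self_of_mem (R.u g).2
  simp only [conj]
  calc _ = (R.u g : H →L[ℂ] H) * T * (star (R.u g : H →L[ℂ] H) * (R.u g : H →L[ℂ] H)) * T' *
        star (R.u g : H →L[ℂ] H) := by simp only [mul_assoc]
    _ = _ := by rw [h, mul_one, mul_assoc (R.u g : H →L[ℂ] H)]

theorem CovariantRep.conj_isPositive (g : G) {T : H →L[ℂ] H} (hT : T.IsPositive) :
    (R.conj g T).IsPositive := by
  have := hT.conj_adjoint (R.u g : H →L[ℂ] H)
  rwa [← ContinuousLinearMap.star_eq_adjoint] at this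

theorem CovariantRep.ρ_apply_eq_conj (g : G) (b : B) : R.ρ (g.1 b) = R.conj g (R.ρ b) :=
  R.covariant g b

theorem CovariantRep.norm_conj_apply_sq (g : G) {T : H →L[ℂ] H} (hT : T.IsPositive) (ξ : H) :
    ‖R.conj g T ξ‖ ^ 2 = (inner ℂ (R.conj g (T * T) ξ) ξ).re := by
  rw [← R.conj_mul_conj]
  exact (norm_sq_eq_re_inner (𝕜 := ℂ) _).trans
    (congrArg Complex.re ((R.conj_isPositive g hT).isSymmetric _ _).symm)

end Conjugation

/-! ### Special elements lie in the image of `σ` -/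

namespace FiniteCoveringSequence

section SpecialElements

set_option linter.unusedSectionVars false

variable {X : ℕ → Type u} [∀ n, TopologicalSpace (X n)] [∀ n, T2Space (X n)]
    [∀ n, LocallyCompactSpace (X n)] [∀ n, ConnectedSpace (X n)] [LocallyPathConnectedSpace (X 0)]
    {S : FiniteCoveringSequence X}
    (hS : ∀ x : S.CoveringLimit, ∃ V, S.IsSpecialSet S.proj V ∧ x ∈ V)
    {B : Type v} [NonUnitalCStarAlgebra B] {φ : ∀ n, C₀(X n, ℂ) →⋆ₙₐ[ℂ] B}
    (hφ : IsCStarInductiveLimit S.pullback φ)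
    {H : Type w} [NormedAddCommGroup H] [InnerProductSpace ℂ H] [CompleteSpace H]
    {R : CovariantRep (coveringGroup φ) H} {σ : C₀(S.CoveringLimit, ℂ) →⋆ₙₐ[ℂ] (H →L[ℂ] H)}
    (hσ : Function.Injective σ)
    (hnd : (Submodule.span ℂ {η : H | ∃ f ξ, η = σ f ξ}).topologicalClosure = ⊤)
    (hσR : ∀ (n : ℕ) (a : C₀(X n, ℂ)) (f f' : C₀(S.CoveringLimit, ℂ)),
      (∀ x, f' x = a (S.proj n x) * f x) → σ f' = R.ρ (φ n a) * σ f)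

include hφ in
theorem restrictionKernel_antitone : Antitone (restrictionKernel φ) := fun m n hmn g hg a => by
  rw [← hφ.compatible hmn]
  exact hg _

include hφ in
theorem exists_notMem_restrictionKernel {g : coveringGroup φ} (hg : g ≠ 1) :
    ∃ n, g ∉ restrictionKernel φ n := by
  by_contra h
  push Not at h
  refine hg (Subtype.ext (DFunLike.coe_injective ?_))
  exact hφ.ext_of_continuous (f := g.1) (g := fun b => b)
    (g.1 : B →⋆ₙₐ[ℂ] B).continuous_complex continuous_id fun n a => h n a

theorem inner_ρ_ρ (b c : B) (ξ η : H) :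
    inner ℂ (R.ρ b ξ) (R.ρ c η) = inner ℂ (R.ρ (star c * b) ξ) η := by
  rw [map_mul, map_star, ContinuousLinearMap.star_eq_adjoint]
  exact (ContinuousLinearMap.adjoint_inner_left (R.ρ c) η (R.ρ b ξ)).symm

include hσ hσR in
theorem evalHom_re_le {b : B} {ε : ℝ} (h : ∀ ξ, (inner ℂ (R.ρ b ξ) ξ).re ≤ ε * ‖ξ‖ ^ 2)
    (x : S.CoveringLimit) : (evalHom hS hφ b x).re ≤ ε := by
  have := t2Space_coveringLimit hS
  have := locallyCompactSpace_coveringLimit hS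
  exact (actsAs_evalHom hS hφ hσR b).re_le hσ h x

variable {T : H →L[ℂ] H} (hT : T.IsPositive) {a b : ∀ n, C₀(X n, ℂ)}
    (ha : ∀ n ξ, HasSum ((restrictionKernel φ n : Set (coveringGroup φ)).indicator
      fun g => R.conj g T ξ) (R.ρ (φ n (a n)) ξ))
    (hb : ∀ n ξ, HasSum ((restrictionKernel φ n : Set (coveringGroup φ)).indicator
      fun g => R.conj g (T * T) ξ) (R.ρ (φ n (b n)) ξ))

theorem re_inner_conj_nonneg (hT : T.IsPositive) (g : coveringGroup φ) (ξ : H) :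
    0 ≤ (inner ℂ (R.conj g T ξ) ξ).re :=
  (R.conj_isPositive g hT).re_inner_nonneg_left ξ

include hT ha

theorem re_inner_stage_nonneg (n : ℕ) (ξ : H) : 0 ≤ (inner ℂ (R.ρ (φ n (a n)) ξ) ξ).re :=
  (hasSum_re_inner (ha n ξ) ξ).nonneg fun _ =>
    Set.indicator_nonneg (fun g _ => re_inner_conj_nonneg hT g ξ) _

theorem im_inner_stage (n : ℕ) (ξ : H) : (inner ℂ (R.ρ (φ n (a n)) ξ) ξ).im = 0 := by
  -- Pairing with `Complex.I • ξ` turns the imaginary part into a real part, up to sign.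
  have h1 := hasSum_re_inner (ha n ξ) (Complex.I • ξ)
  have h2 : ∀ g, (inner ℂ (R.conj g T ξ) (Complex.I • ξ)).re = 0 := fun g => by
    rw [inner_smul_right, Complex.I_mul_re, neg_eq_zero]
    have := (R.conj_isPositive g hT).inner_nonneg_left ξ
    exact (Complex.nonneg_iff.1 this).2.symm
  simp_rw [h2, Set.indicator_zero] at h1
  have h3 := h1.unique hasSum_zero
  rwa [inner_smul_right, Complex.I_mul_re, neg_eq_zero] at h3

include hS hφ hσ hσR

/-- The quadratic form of `ρ (φ n (a n))` is real and nonnegative; the multiples by `-1` and `±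
Complex.I` turn this into pointwise bounds on `a n`. -/
theorem stage_eq_ofReal (n : ℕ) (z : X n) : a n z = ((a n z).re : ℂ) ∧ 0 ≤ (a n z).re := by
  obtain ⟨x, rfl⟩ := S.proj_surjective n z
  have h1 := evalHom_re_le hS hφ hσ hσR (b := -φ n (a n)) (ε := 0) (fun ξ => by
    rw [map_neg, neg_apply, inner_neg_left, Complex.neg_re, zero_mul,
      neg_nonpos]
    exact re_inner_stage_nonneg hT ha n ξ) x
  have h2 : ∀ c : ℂ, c.re = 0 → (c * a n (S.proj n x)).re ≤ 0 := fun c hc => by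
    have := evalHom_re_le hS hφ hσ hσR (b := c • φ n (a n)) (ε := 0) (fun ξ => by
      rw [map_smul, smul_apply, inner_smul_left, Complex.mul_re,
        im_inner_stage hT ha, Complex.conj_re, hc]
      simp) x
    rwa [map_smul, BoundedContinuousFunction.smul_apply, evalHom_apply, smul_eq_mul] at this
  have h3 := h2 Complex.I (by simp)
  have h4 := h2 (-Complex.I) (by simp)
  rw [map_neg, BoundedContinuousFunction.neg_apply, evalHom_apply, Complex.neg_re] at h1
  simp only [neg_mul, Complex.neg_re, Complex.I_mul_re, neg_neg] at h3 h4
  exact ⟨Complex.ext rfl (by rw [Complex.ofReal_im]; linarith), by linarith⟩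

omit hS hσ hσR hT in
theorem tendsto_stage_special (ξ : H) :
    Filter.Tendsto (fun n => R.ρ (φ n (a n)) ξ) Filter.atTop (𝓝 (T ξ)) := by
  -- Stage 0 sums over the whole group, which gives the summability needed for the smaller sums to
  -- tend to the term of the identity.
  have h0 : (restrictionKernel φ 0 : Set (coveringGroup φ)) = Set.univ :=
    Set.eq_univ_of_forall fun g => g.2
  have h1 : Summable fun g => R.conj g T ξ := by
    have := (ha 0 ξ).summable
    rwa [h0, Set.indicator_univ] at this
  have h2 := tendsto_of_hasSum_indicator h1
    (s := fun n => (restrictionKernel φ n : Set (coveringGroup φ)))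
    (fun m n hmn => restrictionKernel_antitone hφ hmn) (i₀ := 1) (fun n => one_mem _)
    (fun g hg => exists_notMem_restrictionKernel hφ hg) fun n => ha n ξ
  rwa [R.conj_one] at h2

/-- Nothing is yet known about whether the translates of `T` commute. They are strong limits of
translated stage functions, for which positivity of products is clear, and the inequality passes to
the limit. -/
theorem re_inner_conj_conj_nonneg (g h : coveringGroup φ) (ξ : H) :
    0 ≤ (inner ℂ (R.conj g T ξ) (R.conj h T ξ)).re := by
  have hlim : ∀ g : coveringGroup φ, Filter.Tendsto (fun n => R.ρ (g.1 (φ n (a n))) ξ) Filter.atTop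
      (𝓝 (R.conj g T ξ)) := fun g =>
    (((R.u g : H →L[ℂ] H).continuous.tendsto _).comp
      (tendsto_stage_special hφ ha (star (R.u g : H →L[ℂ] H) ξ))).congr fun n => by
        rw [R.ρ_apply_eq_conj]
        rfl
  refine ge_of_tendsto' ((Complex.continuous_re.tendsto _).comp ((hlim g).inner (hlim h)))
    fun n => ?_
  rw [Function.comp_apply, inner_ρ_ρ, galois_apply hS hφ, galois_apply hS hφ, ← map_star, ← map_mul]
  have hreal := stage_eq_ofReal hS hφ hσ hσR hT ha n
  -- With `e` a square root of the product of the two functions, the inner product is the squared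
  -- norm of the image of `ξ` under `e`.
  obtain ⟨e, he⟩ := ZeroAtInftyContinuousMap.exists_sqrt
    (f := star (((galoisEquiv hS hφ h).1 n).zeroAtInftyAut (a n)) *
      ((galoisEquiv hS hφ g).1 n).zeroAtInftyAut (a n)) fun z => by
    rw [ZeroAtInftyContinuousMap.mul_apply, ZeroAtInftyContinuousMap.star_apply,
      Homeomorph.zeroAtInftyAut_apply, Homeomorph.zeroAtInftyAut_apply, (hreal _).1,
      (hreal (((galoisEquiv hS hφ g).1 n).symm z)).1, RCLike.star_def, Complex.conj_ofReal,
      ← Complex.ofReal_mul]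
    exact ⟨_, rfl, mul_nonneg (hreal _).2 (hreal _).2⟩
  rw [← he, map_mul, map_star, ← inner_ρ_ρ]
  exact inner_self_nonneg (𝕜 := ℂ)

theorem stage_anti (x : S.CoveringLimit) : Antitone fun n => (a n (S.proj n x)).re := by
  intro n k hnk
  have h := evalHom_re_le hS hφ hσ hσR (b := φ k (a k) - φ n (a n)) (ε := 0) (fun ξ => by
    rw [map_sub, sub_apply, inner_sub_left, Complex.sub_re, zero_mul,
      sub_nonpos]
    have h1 := add_le_of_hasSum_indicator (fun g => re_inner_conj_nonneg (R := R) hT g ξ)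
      (restrictionKernel_antitone hφ hnk) (Set.empty_subset _) (Set.disjoint_empty _)
      (hasSum_re_inner (ha k ξ) ξ) (q := 0)
      (by rw [Set.indicator_empty]; exact hasSum_zero) (hasSum_re_inner (ha n ξ) ξ)
    rwa [add_zero] at h1) x
  rw [map_sub, BoundedContinuousFunction.sub_apply, evalHom_apply, evalHom_apply,
    Complex.sub_re] at h
  exact sub_nonpos.1 h

include hb in
-- This is the gap estimate. Apply `two_mul_re_inner_le` to the vectors `gTξ`, with `J k` inside `J
-- n`: the diagonal sum is `⟨ρ(b_n)ξ, ξ⟩`, so the defect becomes the quadratic form of `a_n² - b_n`,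
-- and a bound for all `ξ` is a pointwise bound.
theorem stage_mul_sub_le {n k : ℕ} (hnk : n ≤ k) (x : S.CoveringLimit) :
    2 * (a k (S.proj k x)).re * ((a n (S.proj n x)).re - (a k (S.proj k x)).re) ≤
      ‖a n * a n - b n‖ := by
  have hstar : star (φ n (a n)) = φ n (a n) := by
    rw [← map_star]
    congr 1
    ext z
    rw [ZeroAtInftyContinuousMap.star_apply, (stage_eq_ofReal hS hφ hσ hσR hT ha n z).1,
      RCLike.star_def, Complex.conj_ofReal]
  have h := evalHom_re_le hS hφ hσ hσR
    (b := (2 : ℂ) • (star (φ n (a n) - φ k (a k)) * φ k (a k))) (ε := ‖a n * a n - b n‖)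
    (fun ξ => by
      have h1 := two_mul_re_inner_le
        (fun g h => re_inner_conj_conj_nonneg hS hφ hσ hσR hT ha g h ξ)
        (restrictionKernel_antitone hφ hnk) (ha n ξ) (ha k ξ)
        (β := (inner ℂ (R.ρ (φ n (b n)) ξ) ξ).re) (by
          simp_rw [R.norm_conj_apply_sq _ hT]
          exact hasSum_re_inner (hb n ξ) ξ)
      have h2 : (inner ℂ (R.ρ ((2 : ℂ) • (star (φ n (a n) - φ k (a k)) * φ k (a k))) ξ) ξ).re =
          2 * (inner ℂ (R.ρ (φ k (a k)) ξ) (R.ρ (φ n (a n)) ξ - R.ρ (φ k (a k)) ξ)).re := by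
        rw [map_smul, smul_apply, inner_smul_left, ← inner_ρ_ρ, map_sub,
          sub_apply, Complex.conj_ofNat]
        simp
      have h3 : ‖R.ρ (φ n (a n)) ξ‖ ^ 2 = (inner ℂ (R.ρ (φ n (a n * a n)) ξ) ξ).re := by
        rw [map_mul]
        nth_rw 2 [← hstar]
        rw [← inner_ρ_ρ]
        exact norm_sq_eq_re_inner (𝕜 := ℂ) _
      have h4 : (inner ℂ (R.ρ (φ n (a n * a n - b n)) ξ) ξ).re ≤
          ‖a n * a n - b n‖ * ‖ξ‖ ^ 2 := by
        refine (Complex.re_le_norm _).trans ((norm_inner_le_norm _ _).trans ?_)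
        rw [pow_two, ← mul_assoc]
        gcongr
        refine (ContinuousLinearMap.le_opNorm _ _).trans ?_
        gcongr
        exact (NonUnitalStarAlgHom.norm_apply_le _ _).trans (NonUnitalStarAlgHom.norm_apply_le _ _)
      rw [map_sub, map_sub, sub_apply, inner_sub_left, Complex.sub_re] at h4
      rw [h2]
      linarith) x
  have e1 := (stage_eq_ofReal hS hφ hσ hσR hT ha n (S.proj n x)).1
  have e2 := (stage_eq_ofReal hS hφ hσ hσR hT ha k (S.proj k x)).1
  refine le_of_eq_of_le ?_ h
  rw [map_smul, map_mul, map_star, map_sub, BoundedContinuousFunction.smul_apply,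
    BoundedContinuousFunction.mul_apply, BoundedContinuousFunction.star_apply,
    BoundedContinuousFunction.sub_apply, evalHom_apply, evalHom_apply, e1, e2,
    ← Complex.ofReal_sub, RCLike.star_def, Complex.conj_ofReal, ← Complex.ofReal_mul]
  simp
  ring

/-- The subgroup `J k` and its coset by `g` are disjoint inside `J n`; the sum over the coset is the
translate of `a k` by `g`. -/
theorem stage_add_le {n k : ℕ} (hnk : n ≤ k) {g : coveringGroup φ} (hg : g ∈ restrictionKernel φ n)
    (hgk : g ∉ restrictionKernel φ k) (x : S.CoveringLimit) :
    (a k (S.proj k x)).re + (a k (S.proj k ((galoisEquiv hS hφ g)⁻¹ • x))).re ≤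
      (a n (S.proj n x)).re := by
  have h := evalHom_re_le hS hφ hσ hσR
    (b := φ k (a k) + g.1 (φ k (a k)) - φ n (a n)) (ε := 0) (fun ξ => by
      rw [map_sub, map_add, sub_apply, add_apply,
        inner_sub_left, inner_add_left, Complex.sub_re, Complex.add_re, zero_mul, sub_nonpos]
      have h1 : HasSum ({h | g⁻¹ * h ∈ restrictionKernel φ k}.indicator fun h => R.conj h T ξ)
          (R.ρ (g.1 (φ k (a k))) ξ) := by
        rw [R.ρ_apply_eq_conj, ← (Equiv.mulLeft g).hasSum_iff]
        refine ((ha k (star (R.u g : H →L[ℂ] H) ξ)).mapL (R.u g : H →L[ℂ] H)).congr_fun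
          fun h => ?_
        by_cases hh : h ∈ restrictionKernel φ k
        · simp [hh, R.conj_mul]
          rfl
        · simp [hh]
      exact add_le_of_hasSum_indicator (fun g => re_inner_conj_nonneg (R := R) hT g ξ)
        (restrictionKernel_antitone hφ hnk)
        (fun h hh => by
          have := mul_mem hg (restrictionKernel_antitone hφ hnk hh)
          rwa [mul_inv_cancel_left] at this)
        (Set.disjoint_left.2 fun h hh hh' => hgk (by
          have := mul_mem hh (inv_mem hh')
          simpa using this))
        (hasSum_re_inner (ha k ξ) ξ) (hasSum_re_inner h1 ξ) (hasSum_re_inner (ha n ξ) ξ)) x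
  rw [map_sub, map_add, BoundedContinuousFunction.sub_apply, BoundedContinuousFunction.add_apply,
    evalHom_galois_apply, evalHom_apply, evalHom_apply, evalHom_apply, Complex.sub_re,
    Complex.add_re] at h
  exact sub_nonpos.1 h

omit ha hT in
include hnd in
/-- Special elements come from functions on the covering limit. -/
theorem exists_of_isSpecialElement (hTs : IsSpecialElement φ R T) : ∃ f, σ f = T := by
  obtain ⟨hT, a, b, ha, hb, hab⟩ := hTs
  replace ha : ∀ n ξ, HasSum ((restrictionKernel φ n : Set (coveringGroup φ)).indicator
      fun g => R.conj g T ξ) (R.ρ (φ n (a n)) ξ) := fun n ξ =>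
    hasSum_subtype_iff_indicator.1 (ha n ξ)
  replace hb : ∀ n ξ, HasSum ((restrictionKernel φ n : Set (coveringGroup φ)).indicator
      fun g => R.conj g (T * T) ξ) (R.ρ (φ n (b n)) ξ) := fun n ξ =>
    hasSum_subtype_iff_indicator.1 (hb n ξ)
  have hreal := stage_eq_ofReal hS hφ hσ hσR hT ha
  have hanti := stage_anti hS hφ hσ hσR hT ha
  have hbdd : ∀ x, BddBelow (Set.range fun n => (a n (S.proj n x)).re) := fun x =>
    ⟨0, by rintro _ ⟨n, rfl⟩; exact (hreal n _).2⟩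
  have hlim : IsDecreasingSystem S (fun n z => (a n z).re) (fun n => ‖a n * a n - b n‖)
      (fun x => ⨅ n, (a n (S.proj n x)).re) :=
    { continuous := fun n => by fun_prop
      isCompact := fun n δ hδ => by
        convert (a n).isCompact_le_norm hδ using 4 with z
        rw [(hreal n z).1, Complex.norm_real, Complex.ofReal_re, Real.norm_of_nonneg (hreal n z).2]
      nonneg := fun n z => (hreal n z).2
      anti := hanti
      tendsto := fun x => tendsto_atTop_ciInf (hanti x) (hbdd x)
      tendsto_zero := by
        rw [Metric.tendsto_atTop]
        simpa using hab
      mul_sub_le := fun n k hnk x => stage_mul_sub_le hS hφ hσ hσR hT ha hb hnk x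
      add_le := fun n x y hxy hn => by
        -- Distinct points over the same point of `X n` differ by a nontrivial `g` in `J n`. A stage
        -- `k` at which `g` acts nontrivially makes `stage_add_le` applicable, and the infima lie
        -- below the values at that stage.
        obtain ⟨d, hd, rfl⟩ := exists_towerKernel_smul_eq hn.symm
        obtain ⟨g, rfl⟩ := (galoisEquiv hS hφ).surjective d
        have hg1 : g ≠ 1 := by
          rintro rfl
          exact hxy (by simp)
        obtain ⟨k, hk⟩ := exists_notMem_restrictionKernel hφ hg1
        have h1 := stage_add_le hS hφ hσ hσR hT ha (le_max_left n k)
          ((galoisEquiv_mem_towerKernel_iff hS hφ g n).1 hd)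
          (fun h => hk (restrictionKernel_antitone hφ (le_max_right n k) h))
          (galoisEquiv hS hφ g • y)
        rw [inv_smul_smul] at h1
        exact (add_le_add (ciInf_le (hbdd _) _) (ciInf_le (hbdd _) _)).trans h1 }
  obtain ⟨f, -, hfu⟩ := hlim.exists_zeroAtInfty hS
  have := t2Space_coveringLimit hS
  have := locallyCompactSpace_coveringLimit hS
  -- Both `T` and `σ f` are the strong limit of the operators `ρ (φ n (a n))`.
  refine ⟨f, ContinuousLinearMap.ext fun ξ => tendsto_nhds_unique ?_
    (tendsto_stage_special hφ ha ξ)⟩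
  refine tendsto_of_actsAs hnd (C := ‖a 0‖) (fun n => ?_)
    (fun n => actsAs_evalHom hS hφ hσR (φ n (a n))) (actsAs_self f) ?_ ξ
  · refine (NonUnitalStarAlgHom.norm_apply_le _ _).trans
      ((NonUnitalStarAlgHom.norm_apply_le _ _).trans
        ((ZeroAtInftyContinuousMap.norm_le (norm_nonneg _)).2 fun z => ?_))
    obtain ⟨x, rfl⟩ := S.proj_surjective n z
    rw [(hreal n _).1, Complex.norm_real, Real.norm_of_nonneg (hreal n _).2]
    exact (hanti x (Nat.zero_le n)).trans ((Complex.re_le_norm _).trans ((a 0).norm_apply_le _))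
  · have e : (fun (n : ℕ) (x : S.CoveringLimit) => evalHom hS hφ (φ n (a n)) x) =
        fun n x => (((a n (S.proj n x)).re : ℝ) : ℂ) := by
      funext n x
      rw [evalHom_apply]
      exact (hreal n _).1
    rw [e]
    exact hfu

end SpecialElements

end FiniteCoveringSequence

/-! ### The isomorphism, its uniqueness, and the atomic representation -/

namespace FiniteCoveringSequence

section InverseLimits

set_option linter.unusedSectionVars false

variable {X : ℕ → Type u} [∀ n, TopologicalSpace (X n)] [∀ n, T2Space (X n)]
    [∀ n, LocallyCompactSpace (X n)] [∀ n, ConnectedSpace (X n)] [LocallyPathConnectedSpace (X 0)]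
    {S : FiniteCoveringSequence X}
    (hS : ∀ x : S.CoveringLimit, ∃ V, S.IsSpecialSet S.proj V ∧ x ∈ V)
    {B : Type v} [NonUnitalCStarAlgebra B] {φ : ∀ n, C₀(X n, ℂ) →⋆ₙₐ[ℂ] B}
    (hφ : IsCStarInductiveLimit S.pullback φ)

include hS hφ in
-- A faithful `σ` is isometric, so its range is closed; containing all special elements, it contains
-- the closed algebra they generate.
theorem exists_starAlgEquiv_ncInverseLimit
    {H : Type w} [NormedAddCommGroup H] [InnerProductSpace ℂ H] [CompleteSpace H]
    {R : CovariantRep (coveringGroup φ) H} {σ : C₀(S.CoveringLimit, ℂ) →⋆ₙₐ[ℂ] (H →L[ℂ] H)}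
    (hσ : Function.Injective σ)
    (hnd : (Submodule.span ℂ {η : H | ∃ f ξ, η = σ f ξ}).topologicalClosure = ⊤)
    (hσR : ∀ (n : ℕ) (a : C₀(X n, ℂ)) (f f' : C₀(S.CoveringLimit, ℂ)),
      (∀ x, f' x = a (S.proj n x) * f x) → σ f' = R.ρ (φ n a) * σ f) :
    ∃ Φ : C₀(S.CoveringLimit, ℂ) ≃⋆ₐ[ℂ] ncInverseLimit φ R, ∀ f, (Φ f).1 = σ f := by
  have hmem := apply_mem_ncInverseLimit hS hφ hnd hσR
  have hiso : Isometry σ := NonUnitalStarAlgHom.isometry σ hσ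
  have hclosed : IsClosed (NonUnitalStarAlgHom.range σ : Set (H →L[ℂ] H)) := by
    rw [NonUnitalStarAlgHom.coe_range]
    exact hiso.isClosedEmbedding.isClosed_range
  have hle : ncInverseLimit φ R ≤ NonUnitalStarAlgHom.range σ := by
    refine NonUnitalStarSubalgebra.topologicalClosure_minimal _ ?_ hclosed
    exact NonUnitalStarAlgebra.adjoin_le fun T hT =>
      exists_of_isSpecialElement hS hφ hσ hnd hσR hT
  refine ⟨StarAlgEquiv.ofBijective (NonUnitalStarAlgHom.codRestrict σ (ncInverseLimit φ R) hmem)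
    ⟨fun f f' h => hσ (congrArg Subtype.val h), fun T => ?_⟩, fun f => rfl⟩
  obtain ⟨f, hf⟩ := hle T.2
  exact ⟨f, Subtype.ext hf⟩

/-- Composed with `ψ`, evaluation at `x` is a character, hence evaluation at some `y`. Commutation
with functions from the stages forces `x` and `y` to have the same coordinates. -/
theorem apply_eq_self_of_intertwining (ψ : C₀(S.CoveringLimit, ℂ) →⋆ₙₐ[ℂ] C₀(S.CoveringLimit, ℂ))
    (hψ : Function.Surjective ψ)
    (h : ∀ (n : ℕ) (a : C₀(X n, ℂ)) f, ψ ((boundedPullback hS n a).mulZeroAtInfty f) =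
      (boundedPullback hS n a).mulZeroAtInfty (ψ f)) (f : C₀(S.CoveringLimit, ℂ)) : ψ f = f := by
  have := t2Space_coveringLimit hS
  have := locallyCompactSpace_coveringLimit hS
  ext x
  let χ : C₀(S.CoveringLimit, ℂ) →⋆ₙₐ[ℂ] ℂ :=
    { toFun := fun f => ψ f x
      map_smul' := fun z f => by simp
      map_zero' := by simp
      map_add' := fun f g => by simp
      map_mul' := fun f g => by simp
      map_star' := fun f => by
        rw [map_star]
        rfl }
  have hχ : χ ≠ 0 := fun h0 => by
    obtain ⟨e, he, -⟩ := ZeroAtInftyContinuousMap.exists_bump_point (x := x) isOpen_univ trivial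
    obtain ⟨f, rfl⟩ := hψ e
    have : ψ f x = 0 := DFunLike.congr_fun h0 f
    rw [he] at this
    exact one_ne_zero this
  obtain ⟨y, hy⟩ := ZeroAtInftyContinuousMap.exists_eval_of_character χ hχ
  have hyx : y = x := S.ext_proj fun n => ZeroAtInftyContinuousMap.eq_of_forall_apply_eq fun a => by
    obtain ⟨e, he, -⟩ := ZeroAtInftyContinuousMap.exists_bump_point (x := y) isOpen_univ trivial
    have h1 := hy ((boundedPullback hS n a).mulZeroAtInfty e)
    have h2 : ψ ((boundedPullback hS n a).mulZeroAtInfty e) x = a (S.proj n x) * ψ e x := by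
      rw [h]
      rfl
    have h3 : ψ e x = e y := hy e
    rw [h3, he, mul_one] at h2
    have h4 : (boundedPullback hS n a).mulZeroAtInfty e y = a (S.proj n y) * e y := rfl
    rw [he, mul_one] at h4
    rw [← h4, ← h2]
    exact h1.symm
  exact (hy f).trans (congrArg f hyx)

/-- The point of the covering limit at which a character is the evaluation. -/
noncomputable def charPoint (χ : Character B) : S.CoveringLimit :=
  (Equiv.ofBijective _ (evalChar_bijective hS hφ)).symm χ

theorem evalHom_charPoint (χ : Character B) (b : B) :
    evalHom hS hφ b (charPoint hS hφ χ) = χ.1 b := by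
  rw [← evalChar_apply]
  exact congrArg (fun χ : Character B => χ.1 b)
    ((Equiv.ofBijective _ (evalChar_bijective hS hφ)).apply_symm_apply χ)

theorem charPoint_evalChar (x : S.CoveringLimit) : charPoint hS hφ (evalChar hS hφ x) = x :=
  (Equiv.ofBijective _ (evalChar_bijective hS hφ)).symm_apply_apply x

/-- Functions on the covering limit as multiplication operators on `ℓ²` of the characters. -/
noncomputable def atomicMul :
    C₀(S.CoveringLimit, ℂ) →⋆ₙₐ[ℂ] (EllTwo (Character B) →L[ℂ] EllTwo (Character B)) where
  toFun f := mulOp (fun χ => f (charPoint hS hφ χ)) ‖f‖ (norm_nonneg f)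
    (fun χ => f.norm_apply_le _)
  map_smul' z f := by ext ξ χ; simp [mul_assoc]
  map_zero' := by ext ξ χ; simp
  map_add' f g := by ext ξ χ; simp [add_mul]
  map_mul' f g := by ext ξ χ; simp [mul_assoc]
  map_star' f := by
    rw [ContinuousLinearMap.star_eq_adjoint, ContinuousLinearMap.eq_adjoint_iff]
    intro ξ η
    rw [lp.inner_eq_tsum, lp.inner_eq_tsum]
    refine tsum_congr fun χ => ?_
    simp
    ring

theorem atomicMul_apply (f : C₀(S.CoveringLimit, ℂ)) (ξ : EllTwo (Character B)) (χ : Character B) :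
    atomicMul hS hφ f ξ χ = f (charPoint hS hφ χ) * ξ χ := rfl

theorem atomicMul_injective : Function.Injective (atomicMul hS hφ) := by
  classical
  intro f g h
  ext x
  have h1 := congrArg (fun T : EllTwo (Character B) →L[ℂ] EllTwo (Character B) =>
    (T (lp.single 2 (evalChar hS hφ x) (1 : ℂ))) (evalChar hS hφ x)) h
  simp only [atomicMul_apply] at h1
  rwa [lp.single_apply_self, mul_one, mul_one, charPoint_evalChar] at h1

theorem atomicMul_nondegenerate :
    (Submodule.span ℂ {η : EllTwo (Character B) |
      ∃ f ξ, η = atomicMul hS hφ f ξ}).topologicalClosure = ⊤ := by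
  classical
  have := t2Space_coveringLimit hS
  have := locallyCompactSpace_coveringLimit hS
  refine Submodule.eq_top_iff'.2 fun ξ => ?_
  refine mem_closure_of_tendsto (lp.hasSum_single (by norm_num) ξ) (.of_forall fun F =>
    sum_mem fun χ _ => Submodule.subset_span ?_)
  obtain ⟨f, hf, -⟩ := ZeroAtInftyContinuousMap.exists_bump_point (x := charPoint hS hφ χ)
    isOpen_univ trivial
  refine ⟨f, lp.single 2 χ (ξ χ), ?_⟩
  ext χ'
  rw [atomicMul_apply]
  by_cases h : χ' = χ
  · subst h
    rw [hf, one_mul]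
  · rw [lp.single_apply_ne _ _ _ h, mul_zero]

theorem atomicMul_intertwining (n : ℕ) (a : C₀(X n, ℂ)) (f f' : C₀(S.CoveringLimit, ℂ))
    (h : ∀ x, f' x = a (S.proj n x) * f x) :
    atomicMul hS hφ f' = (atomicRep (coveringGroup φ)).ρ (φ n a) * atomicMul hS hφ f := by
  ext ξ χ
  change f' (charPoint hS hφ χ) * ξ χ = χ.1 (φ n a) * (f (charPoint hS hφ χ) * ξ χ)
  rw [h, ← evalHom_charPoint hS hφ χ, evalHom_apply, mul_assoc]

include hS hφ in
theorem existsUnique_starAlgEquiv_atomicRep :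
    ∃! Φ : C₀(S.CoveringLimit, ℂ) ≃⋆ₐ[ℂ] ncInverseLimit φ (atomicRep (coveringGroup φ)),
      ∀ (n : ℕ) (a : C₀(X n, ℂ)) (f f' : C₀(S.CoveringLimit, ℂ)),
        (∀ x, f' x = a (S.proj n x) * f x) →
        (Φ f').1 = (atomicRep (coveringGroup φ)).ρ (φ n a) * (Φ f).1 := by
  obtain ⟨Φ, hΦ⟩ := exists_starAlgEquiv_ncInverseLimit hS hφ (atomicMul_injective hS hφ)
    (atomicMul_nondegenerate hS hφ) (atomicMul_intertwining hS hφ)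
  have hΦn : ∀ (n : ℕ) (a : C₀(X n, ℂ)) (f f' : C₀(S.CoveringLimit, ℂ)),
      (∀ x, f' x = a (S.proj n x) * f x) →
      (Φ f').1 = (atomicRep (coveringGroup φ)).ρ (φ n a) * (Φ f).1 := fun n a f f' h => by
    rw [hΦ, hΦ, atomicMul_intertwining hS hφ n a f f' h]
  refine ⟨Φ, hΦn, fun Ψ hΨ => ?_⟩
  -- Two solutions differ by an automorphism commuting with all stage functions, and such an
  -- automorphism is the identity.
  let ψ : C₀(S.CoveringLimit, ℂ) ≃⋆ₐ[ℂ] C₀(S.CoveringLimit, ℂ) := Ψ.trans Φ.symm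
  have hψ : ∀ f, Φ (ψ f) = Ψ f := fun f => Φ.apply_symm_apply _
  have key := apply_eq_self_of_intertwining hS
    (ψ : C₀(S.CoveringLimit, ℂ) →⋆ₙₐ[ℂ] C₀(S.CoveringLimit, ℂ)) ψ.surjective fun n a f => by
      refine EquivLike.injective Φ (Subtype.ext ?_)
      have h1 := hΦn n a (ψ f) ((boundedPullback hS n a).mulZeroAtInfty (ψ f)) fun x => rfl
      have h2 := hΨ n a f ((boundedPullback hS n a).mulZeroAtInfty f) fun x => rfl
      rw [← hψ, ← hψ, ← h1] at h2
      exact h2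
  refine DFunLike.ext _ _ fun f => ?_
  rw [← hψ f]
  exact congrArg Φ (key f)

end InverseLimits

end FiniteCoveringSequence

theorem mainTheorem2 {X : ℕ → Type u} [∀ n, TopologicalSpace (X n)] [∀ n, T2Space (X n)]
    [∀ n, LocallyCompactSpace (X n)] [∀ n, SecondCountableTopology (X n)]
    [∀ n, ConnectedSpace (X n)] [LocallyPathConnectedSpace (X 0)]
    (S : FiniteCoveringSequence X)
    (hS : ∀ x : S.CoveringLimit, ∃ V, S.IsSpecialSet S.proj V ∧ x ∈ V) :
    S.IsInverseLimit S.proj ∧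
    ∀ (B : Type v) [NonUnitalCStarAlgebra B] (φ : ∀ n, C₀(X n, ℂ) →⋆ₙₐ[ℂ] B),
      IsCStarInductiveLimit S.pullback φ →
      IsRegularSequence φ S.deckAut ∧
      Function.Injective (atomicRep (coveringGroup φ)).ρ ∧
      (∃! Φ : C₀(S.CoveringLimit, ℂ) ≃⋆ₐ[ℂ] ncInverseLimit φ (atomicRep (coveringGroup φ)),
        ∀ (n : ℕ) (a : C₀(X n, ℂ)) (f f' : C₀(S.CoveringLimit, ℂ)),
          (∀ x, f' x = a (S.proj n x) * f x) →
          (Φ f').1 = (atomicRep (coveringGroup φ)).ρ (φ n a) * (Φ f).1) ∧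
      ∀ (H : Type w) [NormedAddCommGroup H] [InnerProductSpace ℂ H] [CompleteSpace H]
        (R : CovariantRep (coveringGroup φ) H)
        (σ : C₀(S.CoveringLimit, ℂ) →⋆ₙₐ[ℂ] (H →L[ℂ] H)),
        Function.Injective σ →
        (Submodule.span ℂ {η : H | ∃ f ξ, η = σ f ξ}).topologicalClosure = ⊤ →
        (∀ (n : ℕ) (a : C₀(X n, ℂ)) (f f' : C₀(S.CoveringLimit, ℂ)),
          (∀ x, f' x = a (S.proj n x) * f x) → σ f' = R.ρ (φ n a) * σ f) →
        ∃ Φ : C₀(S.CoveringLimit, ℂ) ≃⋆ₐ[ℂ] ncInverseLimit φ R, ∀ f, (Φ f).1 = σ f := by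
  refine ⟨FiniteCoveringSequence.isInverseLimit_proj hS, fun B _ φ hφ =>
    ⟨FiniteCoveringSequence.isRegularSequence hS hφ,
      FiniteCoveringSequence.atomicRep_injective hS hφ,
      FiniteCoveringSequence.existsUnique_starAlgEquiv_atomicRep hS hφ,
      fun H _ _ _ R σ hσ hnd hσR =>
        FiniteCoveringSequence.exists_starAlgEquiv_ncInverseLimit hS hφ hσ hnd hσR⟩⟩
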